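/- Conventions. Let $(\Omega,\Sigma,\mu)$ be a localizable measure space, i.e. $\mu$ is semifinite and every family of measurable sets has an essential supremum (equivalently, $L^\infty$ is canonically the dual of $L^1$; every $\sigma$-finite measure is localizable). Write $L^p=L^p(\Omega,\Sigma,\mu)$ for the complex spaces. Let $\sigma\subseteq\mathbb R$ be compact, let $BV(\sigma)$ be the algebra of functions $f:\sigma\to\mathbb C$ of bounded variation with norm $\|f\|_{BV}=\sup_\sigma|f|+\operatorname{var}(f,\sigma)$, and let $AC(\sigma)$ be the closure of the polynomials in $BV(\sigma)$. An $AC(\sigma)$ functional calculus for a bounded operator $S$ on a Banach space $X$ is a norm bounded unital algebra homomorphism $\Phi:AC(\sigma)\to B(X)$ with $\Phi(t\mapsto t)=S$; it is bounded by $M$ if $\|\Phi(f)\|\le M\|f\|_{BV}$ for all $f\in AC(\sigma)$. $S$ is a real $AC(\sigma)$ operator if it has such a functional calculus. The functional calculus extends to a $BV(\sigma)$ functional calculus if there is a norm bounded unital algebra homomorphism $\Psi:BV(\sigma)\to B(X)$ with $\Psi|_{AC(\sigma)}=\Phi$. A linear transformation $T$, defined on a linear space $\operatorname{Dom}(T)$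 of equivalence classes of measurable functions $\Omega\to\mathbb C$ and with values in such classes, defines the operator $T_p\in B(L^p)$ if $L^p\subseteq\operatorname{Dom}(T)$ and $T|_{L^p}=T_p$. Theorem. Let $1<r<\infty$ and let $T$ be a linear transformation which, for every $p\in(r,\infty)$, defines a real $AC(\sigma)$ operator $T_p$ on $L^p$. Suppose that the $AC(\sigma)$ functional calculi of the operators $T_p$, $p\in(r,\infty)$, are all bounded by one constant $M$. Then the restriction of $T$ to the linear span of $\bigcup_{r<p<\infty}L^p$ has an extension to a linear transformation $T'$ which defines a real $AC(\sigma)$ operator $T_\infty$ on $L^\infty$, and if $\operatorname{Dom}(T)\cap L^\infty$ is contained in that span, then $T'$ can be taken to be an extension of $T$ itself. Furthermore, the $AC(\sigma)$ functional calculus of $T_\infty$ extends to a $BV(\sigma)$ functional calculus $\Psi_\infty$, and for every $f\in BV(\sigma)$ the operator $\Psi_\infty(f)$ is the adjoint of a bounded operator $U_f$ on $L^1$, that is, $\int (U_f y)\,x\,d\mu=\int y\,(\Psi_\infty(f)x)\,d\mu$ for all $y\in L^1$, $x\in L^\infty$. -/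

import Mathlib

open MeasureTheory TopologicalSpace
open scoped ENNReal Polynomial

noncomputable section

/-! ### Functions of bounded variation and absolutely continuous functions on `σ ⊆ ℝ` -/

/-- `‖f‖_BV = sup_σ |f| + var(f, σ)` for a function `f : σ → ℂ`, `σ ⊆ ℝ`
(meaningful for functions of bounded variation). -/
def bvNorm {σ : Compacts ℝ} (f : σ → ℂ) : ℝ :=
  (⨆ t, ‖f t‖) + (eVariationOn f Set.univ).toReal

section aux

variable {σ : Compacts ℝ} {f g : σ → ℂ}

lemma bv_bddAbove (hf : BoundedVariationOn f Set.univ) :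
    BddAbove (Set.range fun t => ‖f t‖) := by
  rcases isEmpty_or_nonempty σ with h | ⟨⟨a⟩⟩
  · simp [Set.range_eq_empty]
  · refine ⟨‖f a‖ + (eVariationOn f Set.univ).toReal, ?_⟩
    rintro _ ⟨t, rfl⟩
    have h1 := hf.dist_le (Set.mem_univ t) (Set.mem_univ a)
    have h2 := norm_le_norm_add_norm_sub (f a) (f t)
    rw [dist_eq_norm, norm_sub_rev] at h1
    simp only
    linarith [norm_sub_rev (f a) (f t)]

lemma bv_le_sup (hf : BoundedVariationOn f Set.univ) (t : σ) : ‖f t‖ ≤ ⨆ t, ‖f t‖ :=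
  le_ciSup (bv_bddAbove hf) t

lemma bv_sup_nonneg : 0 ≤ ⨆ t, ‖f t‖ := Real.iSup_nonneg fun _ => norm_nonneg _

lemma bvNorm_nonneg : 0 ≤ bvNorm f := add_nonneg bv_sup_nonneg ENNReal.toReal_nonneg

lemma bv_const (c : ℂ) : BoundedVariationOn (fun _ : σ => c) Set.univ := by
  have : eVariationOn (fun _ : σ => c) Set.univ = 0 :=
    eVariationOn.constant_on (by rintro _ ⟨_, _, rfl⟩ _ ⟨_, _, rfl⟩; rfl)
  simp [BoundedVariationOn, this]

lemma bv_eVariationOn_add_le :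
    eVariationOn (f + g) Set.univ ≤ eVariationOn f Set.univ + eVariationOn g Set.univ := by
  refine iSup_le ?_
  rintro ⟨n, ⟨u, hu, us⟩⟩
  calc ∑ i ∈ Finset.range n, edist ((f + g) (u (i + 1))) ((f + g) (u i))
      ≤ ∑ i ∈ Finset.range n, (edist (f (u (i + 1))) (f (u i))
          + edist (g (u (i + 1))) (g (u i))) :=
        Finset.sum_le_sum fun i _ => edist_add_add_le _ _ _ _
    _ = _ := Finset.sum_add_distrib
    _ ≤ _ := add_le_add (eVariationOn.sum_le hu us) (eVariationOn.sum_le hu us)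

lemma bv_add (hf : BoundedVariationOn f Set.univ) (hg : BoundedVariationOn g Set.univ) :
    BoundedVariationOn (f + g) Set.univ :=
  ne_top_of_le_ne_top (ENNReal.add_ne_top.2 ⟨hf, hg⟩) bv_eVariationOn_add_le

lemma bv_mul (hf : BoundedVariationOn f Set.univ) (hg : BoundedVariationOn g Set.univ) :
    BoundedVariationOn (f * g) Set.univ := hf.smul hg

lemma bvNorm_add_le (hf : BoundedVariationOn f Set.univ) (hg : BoundedVariationOn g Set.univ) :
    bvNorm (f + g) ≤ bvNorm f + bvNorm g := by
  have h1 : ⨆ t, ‖(f + g) t‖ ≤ (⨆ t, ‖f t‖) + ⨆ t, ‖g t‖ :=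
    Real.iSup_le (fun t => (norm_add_le _ _).trans (add_le_add (bv_le_sup hf t) (bv_le_sup hg t)))
      (add_nonneg bv_sup_nonneg bv_sup_nonneg)
  have h2 : (eVariationOn (f + g) Set.univ).toReal
      ≤ (eVariationOn f Set.univ).toReal + (eVariationOn g Set.univ).toReal := by
    rw [← ENNReal.toReal_add hf hg]
    exact ENNReal.toReal_mono (ENNReal.add_ne_top.2 ⟨hf, hg⟩) bv_eVariationOn_add_le
  unfold bvNorm
  linarith

lemma bvNorm_mul_le (hf : BoundedVariationOn f Set.univ) (hg : BoundedVariationOn g Set.univ) :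
    bvNorm (f * g) ≤ bvNorm f * bvNorm g := by
  set A := ⨆ t, ‖f t‖ with hA
  set B := ⨆ t, ‖g t‖ with hB
  have hA0 : 0 ≤ A := bv_sup_nonneg
  have hB0 : 0 ≤ B := bv_sup_nonneg
  have h1 : ⨆ t, ‖(f * g) t‖ ≤ A * B :=
    Real.iSup_le (fun t => by
      simpa using mul_le_mul (bv_le_sup hf t) (bv_le_sup hg t) (norm_nonneg _) hA0)
      (mul_nonneg hA0 hB0)
  have hb : ∀ (h : σ → ℂ), BoundedVariationOn h Set.univ →
      ∀ x ∈ Set.univ, ‖h x‖ₑ ≤ ENNReal.ofReal (⨆ t, ‖h t‖) := fun h hh x _ => by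
    rw [← ofReal_norm]
    exact ENNReal.ofReal_le_ofReal (bv_le_sup hh x)
  have h2 := eVariationOn_smul_le (f := f) (g := g) (s := Set.univ) (hb f hf) (hb g hg)
  have h3 : (eVariationOn (f * g) Set.univ).toReal
      ≤ A * (eVariationOn g Set.univ).toReal + B * (eVariationOn f Set.univ).toReal := by
    have h4 := ENNReal.toReal_mono (by finiteness [hf, hg]) h2
    rwa [ENNReal.toReal_add (by finiteness [hf, hg]) (by finiteness [hf, hg]), ENNReal.toReal_mul,
      ENNReal.toReal_mul, ENNReal.toReal_ofReal hA0, ENNReal.toReal_ofReal hB0] at h4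
  have h5 : 0 ≤ (eVariationOn f Set.univ).toReal * (eVariationOn g Set.univ).toReal := by positivity
  unfold bvNorm
  nlinarith

lemma bv_polynomial (p : ℂ[X]) :
    BoundedVariationOn (fun t : σ => p.eval ((t : ℝ) : ℂ)) Set.univ := by
  obtain ⟨C, hC⟩ := σ.isCompact.isBounded.exists_norm_le
  have hid : BoundedVariationOn (fun t : σ => (t : ℝ)) Set.univ :=
    MonotoneOn.boundedVariationOn (C := C) (fun a _ b _ h => h) (fun x _ => hC x x.2)
  have hid' : BoundedVariationOn (fun t : σ => ((t : ℝ) : ℂ)) Set.univ :=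
    (Complex.isometry_ofReal.lipschitz).comp_boundedVariationOn hid
  induction p using Polynomial.induction_on' with
  | add p q hp hq => simpa [Pi.add_def] using bv_add hp hq
  | monomial n a =>
    simp only [Polynomial.eval_monomial]
    refine bv_mul (bv_const a) ?_
    induction n with
    | zero => simpa using bv_const 1
    | succ n ih => simpa [pow_succ, Pi.mul_def] using bv_mul ih hid'

end aux

/-- `BV(σ)`: the algebra of complex functions of bounded variation on the compact set `σ ⊆ ℝ`. -/
def BV (σ : Compacts ℝ) : Subalgebra ℂ (σ → ℂ) where
  carrier := {f | BoundedVariationOn f Set.univ}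
  mul_mem' hf hg := bv_mul hf hg
  add_mem' hf hg := bv_add hf hg
  algebraMap_mem' c := bv_const c

/-- The restriction of a polynomial to `σ`, as an element of `BV(σ)`. -/
def polyBV (σ : Compacts ℝ) (p : ℂ[X]) : BV σ :=
  ⟨fun t => p.eval ((t : ℝ) : ℂ), bv_polynomial p⟩

lemma polyBV_add {σ : Compacts ℝ} (p q : ℂ[X]) : polyBV σ (p + q) = polyBV σ p + polyBV σ q := by
  ext t; simp [polyBV]

lemma polyBV_mul {σ : Compacts ℝ} (p q : ℂ[X]) : polyBV σ (p * q) = polyBV σ p * polyBV σ q := by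
  ext t; simp [polyBV]

lemma bvNorm_zero {σ : Compacts ℝ} : bvNorm (0 : σ → ℂ) = 0 := by
  have : eVariationOn (0 : σ → ℂ) Set.univ = 0 :=
    eVariationOn.constant_on (by rintro _ ⟨_, _, rfl⟩ _ ⟨_, _, rfl⟩; rfl)
  simp [bvNorm, this]

/-- `AC(σ)`: the closure of the polynomials in `BV(σ)` with respect to the norm `bvNorm`. -/
def AC (σ : Compacts ℝ) : Subalgebra ℂ (BV σ) where
  carrier := {f | ∀ ε : ℝ, 0 < ε → ∃ p : ℂ[X], bvNorm (f - polyBV σ p : BV σ).1 < ε}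
  add_mem' := by
    intro f g hf hg ε hε
    obtain ⟨p, hp⟩ := hf (ε / 2) (by positivity)
    obtain ⟨q, hq⟩ := hg (ε / 2) (by positivity)
    refine ⟨p + q, ?_⟩
    have h := bvNorm_add_le (f - polyBV σ p).2 (g - polyBV σ q).2
    have e : f + g - polyBV σ (p + q) = (f - polyBV σ p) + (g - polyBV σ q) := by
      rw [polyBV_add]; ring
    rw [e]
    exact h.trans_lt (by linarith)
  mul_mem' := by
    intro f g hf hg ε hε
    have hf0 : 0 ≤ bvNorm f.1 := bvNorm_nonneg
    have hg0 : 0 ≤ bvNorm g.1 := bvNorm_nonneg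
    obtain ⟨q, hq⟩ := hg (ε / (2 * (bvNorm f.1 + 1))) (by positivity)
    have hq0 : 0 ≤ bvNorm (polyBV σ q).1 := bvNorm_nonneg
    obtain ⟨p, hp⟩ := hf (ε / (2 * (bvNorm (polyBV σ q).1 + 1))) (by positivity)
    refine ⟨p * q, ?_⟩
    have e : f * g - polyBV σ (p * q)
        = f * (g - polyBV σ q) + (f - polyBV σ p) * polyBV σ q := by
      rw [polyBV_mul]; ring
    rw [e]
    have h := bvNorm_add_le (f * (g - polyBV σ q)).2 ((f - polyBV σ p) * polyBV σ q).2
    have h1 := bvNorm_mul_le f.2 (g - polyBV σ q).2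
    have h2 := bvNorm_mul_le (f - polyBV σ p).2 (polyBV σ q).2
    rw [lt_div_iff₀ (by positivity)] at hp hq
    have n1 : 0 ≤ bvNorm (g - polyBV σ q).1 := bvNorm_nonneg
    have n2 : 0 ≤ bvNorm (f - polyBV σ p).1 := bvNorm_nonneg
    refine h.trans_lt ?_
    simp only [Subalgebra.coe_mul] at h1 h2 ⊢
    nlinarith
  algebraMap_mem' := by
    intro c ε hε
    refine ⟨Polynomial.C c, ?_⟩
    have e : algebraMap ℂ (BV σ) c - polyBV σ (Polynomial.C c) = 0 := by
      ext t; simp [polyBV]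
    rw [e]
    simpa using bvNorm_zero.trans_lt hε

/-- The identity function `t ↦ t` on `σ`, as an element of `AC(σ)`. -/
def AC.ident (σ : Compacts ℝ) : AC σ :=
  ⟨polyBV σ Polynomial.X, fun ε hε => ⟨Polynomial.X, by
    rw [sub_self]; simpa using bvNorm_zero.trans_lt hε⟩⟩

/-! ### Functional calculi -/

section calculus

variable {X : Type*} [NormedAddCommGroup X] [NormedSpace ℂ X]

/-- `Φ : AC(σ) → B(X)` (a unital algebra homomorphism) is an `AC(σ)` functional calculus for `T`,
bounded by `M`. -/
def IsACCalculus (σ : Compacts ℝ) (T : X →L[ℂ] X) (M : ℝ) (Φ : AC σ →ₐ[ℂ] (X →L[ℂ] X)) : Prop :=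
  Φ (AC.ident σ) = T ∧ ∀ f : AC σ, ‖Φ f‖ ≤ M * bvNorm f.1.1

/-- `T` is a real `AC(σ)` operator: it has a norm bounded `AC(σ)` functional calculus. -/
def IsRealACOperator (σ : Compacts ℝ) (T : X →L[ℂ] X) : Prop :=
  ∃ (M : ℝ) (Φ : AC σ →ₐ[ℂ] (X →L[ℂ] X)), IsACCalculus σ T M Φ

/-- The norm continuous unital algebra homomorphism `Ψ : BV(σ) → B(X)` extends `Φ`. -/
def IsBVExtension (σ : Compacts ℝ) (Φ : AC σ →ₐ[ℂ] (X →L[ℂ] X))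
    (Ψ : BV σ →ₐ[ℂ] (X →L[ℂ] X)) : Prop :=
  (∃ C : ℝ, ∀ f : BV σ, ‖Ψ f‖ ≤ C * bvNorm f.1) ∧ ∀ f : AC σ, Ψ f.1 = Φ f

end calculus

/-! ### Linear transformations on classes of measurable functions -/

section measure

variable {Ω : Type*} [MeasurableSpace Ω]

/-- The measure `μ` is localizable: it is semifinite and every family of measurable sets has an
essential supremum. (Equivalently, `L^∞` is canonically the dual of `L^1`.) -/
structure IsLocalizable (μ : Measure Ω) : Prop where
  semifinite : ∀ s, MeasurableSet s → μ s = ∞ → ∃ t ⊆ s, MeasurableSet t ∧ 0 < μ t ∧ μ t < ∞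
  exists_essSup : ∀ 𝓔 : Set (Set Ω), (∀ E ∈ 𝓔, MeasurableSet E) →
    ∃ H, MeasurableSet H ∧ (∀ E ∈ 𝓔, μ (E \ H) = 0) ∧
      ∀ G, MeasurableSet G → (∀ E ∈ 𝓔, μ (E \ G) = 0) → μ (H \ G) = 0

variable {μ : Measure Ω}

/-- The linear transformation `T`, whose domain is a space of (classes of) measurable functions
`Ω → ℂ`, defines the bounded operator `S` on `L^p`: `L^p ⊆ Dom T` and `T` restricts to `S`. -/
def DefinesOnLp (T : (Ω →ₘ[μ] ℂ) →ₗ.[ℂ] (Ω →ₘ[μ] ℂ)) (p : ℝ≥0∞) [Fact (1 ≤ p)]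
    (S : Lp ℂ p μ →L[ℂ] Lp ℂ p μ) : Prop :=
  ∀ x : Lp ℂ p μ, ∃ h : (x : Ω →ₘ[μ] ℂ) ∈ T.domain, T ⟨x, h⟩ = (S x : Ω →ₘ[μ] ℂ)

/-- The linear span of the spaces `L^p`, `r < p < ∞`. -/
def lpSpan (μ : Measure Ω) (r : ℝ≥0∞) : Submodule ℂ (Ω →ₘ[μ] ℂ) :=
  ⨆ p : Set.Ioo r ∞, Lp.LpSubmodule ℂ ℂ (p : ℝ≥0∞) μ

/-- `V` on `L^∞` is the adjoint of `U` on `L^1` for the pairing `⟨y, x⟩ = ∫ y x dμ`. -/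
def IsAdjointOfL1 (V : Lp ℂ ∞ μ →L[ℂ] Lp ℂ ∞ μ) (U : Lp ℂ 1 μ →L[ℂ] Lp ℂ 1 μ) : Prop :=
  ∀ (y : Lp ℂ 1 μ) (x : Lp ℂ ∞ μ), ∫ ω, U y ω * x ω ∂μ = ∫ ω, y ω * V x ω ∂μ

end measure

end

/-! ### Variation estimates by a dominating real function. -/

section BVToolbox

variable {σ : Compacts ℝ}

/-! The work is done on a single space L^p with p = 2(k+1) > r, and the result is carried to L^∞
through L^1.

L^p satisfies Clarkson's inequality, so uniformly convex functionals attain their minimum on nested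
closed midpoint convex sets, and no weak compactness is needed. Fix t ∈ σ and x ∈ L^p. Applying the
calculus Φ at x to functions with value 1 at t, of bounded norm and with supports shrinking to t,
produces such nested sets. A common point gives the mean ergodic decomposition of x into a vector of
ker (S - t) and one in the closure of range (S - t). Hence Φ(w)x is small whenever w has bounded
norm, vanishes at t and lives close to t (`ACCalculus.exists_forall_bumps_le`). By compactness of σ,
the piecewise affine interpolants of f ∈ BV(σ) converge strongly under Φ along the refinement of
subdivisions, and their defect of multiplicativity tends to 0. The limit is a BV(σ) calculus Ψ,
where Ψ(f)x is a limit of vectors Φ(g)x with ‖g‖ ≤ 4‖f‖ (`ACCalculus.exists_BV_extension`).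

The calculi on different spaces L^n agree on common vectors, because both are limits of the same
polynomials in T. Since one constant bounds them all, n → ∞ shows that Φ(g) is bounded for the
supremum norm on L^p ∩ L^∞ (`IsACCalculus.ae_norm_le`), and Ψ(f) inherits this. Such an operator has
a preadjoint on L^1: for y ∈ L^1 ∩ L^q, with q conjugate to p, the functional x ↦ ∫ y Ψ(f)x is given
by a density, and the supremum bound makes that density integrable (`Lp.exists_preadjoint`).
Localizability identifies the dual of L^1 with L^∞, so the preadjoint has an adjoint Θ(f) on L^∞.
Two dualisations restore the order of products, and Θ(f) is determined by Ψ(f), so Θ is an algebra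
homomorphism. Put T_∞ = Θ(t ↦ t).

Every bounded element of the span of the L^q lies in one L^q, and there approximation by simple
functions shows that T and T_∞ agree (`exists_mem_Lp_of_mem_lpSpan`, `Transfers.coe_eq`). So T, or
its restriction to the span, can be glued with T_∞. An AC(σ) calculus is determined by its operator,
so any calculus of T_∞ is the restriction of Θ. -/

/-- The sum over any partition is dominated by a telescoping sum of increments of `H`. -/
lemma eVariationOn_le_of_dominated {h : σ → ℂ} {H : σ → ℝ} {A : ℝ}
    (hH : ∀ x y, x ≤ y → ‖h y - h x‖ ≤ H y - H x) (hA : ∀ x y, x ≤ y → H y - H x ≤ A) :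
    eVariationOn h Set.univ ≤ ENNReal.ofReal A := by
  refine iSup_le ?_
  rintro ⟨n, ⟨u, hu, us⟩⟩
  calc ∑ i ∈ Finset.range n, edist (h (u (i + 1))) (h (u i))
      ≤ ∑ i ∈ Finset.range n, ENNReal.ofReal (H (u (i + 1)) - H (u i)) := by
        refine Finset.sum_le_sum fun i _ => ?_
        rw [edist_dist, dist_eq_norm]
        exact ENNReal.ofReal_le_ofReal (hH _ _ (hu (Nat.le_succ i)))
    _ = ENNReal.ofReal (∑ i ∈ Finset.range n, (H (u (i + 1)) - H (u i))) := by
        rw [ENNReal.ofReal_sum_of_nonneg]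
        exact fun i _ => (norm_nonneg _).trans (hH _ _ (hu (Nat.le_succ i)))
    _ ≤ ENNReal.ofReal A := by
        rw [Finset.sum_range_sub (fun i => H (u i))]
        exact ENNReal.ofReal_le_ofReal (hA _ _ (hu (Nat.zero_le n)))

lemma boundedVariationOn_of_dominated {h : σ → ℂ} {H : σ → ℝ} {A : ℝ}
    (hH : ∀ x y, x ≤ y → ‖h y - h x‖ ≤ H y - H x) (hA : ∀ x y, x ≤ y → H y - H x ≤ A) :
    BoundedVariationOn h Set.univ :=
  ne_top_of_le_ne_top ENNReal.ofReal_ne_top (eVariationOn_le_of_dominated hH hA)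

lemma bvNorm_le_of_dominated {h : σ → ℂ} {H : σ → ℝ} {A B : ℝ}
    (hH : ∀ x y, x ≤ y → ‖h y - h x‖ ≤ H y - H x) (hA : ∀ x y, x ≤ y → H y - H x ≤ A)
    (hA0 : 0 ≤ A) (hB : ∀ x, ‖h x‖ ≤ B) (hB0 : 0 ≤ B) : bvNorm h ≤ B + A :=
  add_le_add (Real.iSup_le hB hB0)
    (ENNReal.toReal_le_of_le_ofReal hA0 (eVariationOn_le_of_dominated hH hA))

lemma norm_le_bvNorm {f : σ → ℂ} (hf : BoundedVariationOn f Set.univ) (t : σ) :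
    ‖f t‖ ≤ bvNorm f :=
  (bv_le_sup hf t).trans (le_add_of_nonneg_right ENNReal.toReal_nonneg)

lemma sum_norm_sub_le_bvNorm {f : σ → ℂ} (hf : BoundedVariationOn f Set.univ)
    {t : ℕ → σ} (ht : Monotone t) (n : ℕ) :
    ∑ i ∈ Finset.range n, ‖f (t (i + 1)) - f (t i)‖ ≤ bvNorm f := by
  refine le_trans ?_ (le_add_of_nonneg_left bv_sup_nonneg)
  have h := ENNReal.toReal_mono hf
    (eVariationOn.sum_le (n := n) ht (fun i => Set.mem_univ (t i)) (f := f))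
  rw [ENNReal.toReal_sum (fun _ _ => edist_ne_top _ _)] at h
  simpa [edist_dist, dist_eq_norm] using h

lemma bvNorm_neg (f : σ → ℂ) : bvNorm (-f) = bvNorm f := by
  have : eVariationOn (-f) Set.univ = eVariationOn f Set.univ := by
    simp [eVariationOn, edist_neg_neg]
  simp [bvNorm, this]

lemma bvNorm_smul_le (c : ℂ) {f : σ → ℂ} (hf : BoundedVariationOn f Set.univ) :
    bvNorm (c • f) ≤ ‖c‖ * bvNorm f := by
  have h := bvNorm_mul_le (bv_const (σ := σ) c) hf
  have h2 : bvNorm (fun _ : σ => c) ≤ ‖c‖ + 0 :=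
    bvNorm_le_of_dominated (H := fun _ => 0) (by simp) (by simp) le_rfl (by simp) (norm_nonneg _)
  have e : c • f = (fun _ : σ => c) * f := by ext; simp
  rw [e]
  refine h.trans (mul_le_mul_of_nonneg_right (by simpa using h2) bvNorm_nonneg)

lemma BV.bvNorm_sub_le (f g : BV σ) : bvNorm (f - g).1 ≤ bvNorm f.1 + bvNorm g.1 := by
  have h := bvNorm_add_le f.2 (-g).2
  have e : (f - g).1 = f.1 + (-g).1 := by simp [sub_eq_add_neg]
  rw [e]
  refine h.trans_eq ?_
  congr 1
  exact bvNorm_neg g.1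

lemma bvNorm_le_of_monotone {h : σ → ℝ} (hm : Monotone h) {C : ℝ} (hC : ∀ x, |h x| ≤ C)
    (hC0 : 0 ≤ C) : bvNorm (fun s => (h s : ℂ)) ≤ 3 * C := by
  have := bvNorm_le_of_dominated (h := fun s => (h s : ℂ)) (H := h) (A := 2 * C) (B := C)
    (fun x y hxy => by
      rw [← Complex.ofReal_sub, Complex.norm_real, Real.norm_eq_abs,
        abs_of_nonneg (sub_nonneg.2 (hm hxy))])
    (fun x y _ => by linarith [(abs_le.1 (hC x)).1, (abs_le.1 (hC y)).2]) (by linarith)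
    (fun x => by simpa using hC x) hC0
  linarith

lemma bvNorm_le_of_antitone {h : σ → ℝ} (hm : Antitone h) {C : ℝ} (hC : ∀ x, |h x| ≤ C)
    (hC0 : 0 ≤ C) : bvNorm (fun s => (h s : ℂ)) ≤ 3 * C := by
  have := bvNorm_le_of_monotone (h := fun s => - h s) hm.neg (C := C) (by simpa using hC) hC0
  have e : (fun s => ((-h s : ℝ) : ℂ)) = -fun s => (h s : ℂ) := by ext; simp
  rwa [e, bvNorm_neg] at this

lemma boundedVariationOn_of_monotone {h : σ → ℝ} (hm : Monotone h) {C : ℝ}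
    (hC : ∀ x, |h x| ≤ C) : BoundedVariationOn (fun s => (h s : ℂ)) Set.univ :=
  boundedVariationOn_of_dominated (H := h) (A := 2 * C)
    (fun x y hxy => by
      rw [← Complex.ofReal_sub, Complex.norm_real, Real.norm_eq_abs,
        abs_of_nonneg (sub_nonneg.2 (hm hxy))])
    (fun x y _ => by linarith [(abs_le.1 (hC x)).1, (abs_le.1 (hC y)).2])

end BVToolbox

/-! ### Positive parts and ramps belong to AC(σ). -/

section Ramps

lemma exists_polynomial_derivative_eq {K : Type*} [Field K] [CharZero K] (q : K[X]) :
    ∃ Q : K[X], Q.derivative = q := by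
  induction q using Polynomial.induction_on' with
  | add p q hp hq =>
    obtain ⟨P, rfl⟩ := hp
    obtain ⟨Q, rfl⟩ := hq
    exact ⟨P + Q, by simp⟩
  | monomial n a =>
    refine ⟨Polynomial.monomial (n + 1) (a / (n + 1)), ?_⟩
    have : (n + 1 : K) ≠ 0 := by exact_mod_cast Nat.succ_ne_zero n
    rw [Polynomial.derivative_monomial]
    simp [div_mul_cancel₀ _ this]

/-- Squaring smooths the kink: the first order remainder is at most `(y - s) ^ 2`, on either side of
`c`. This feeds the C¹ regularisation in `truncBV_mem_AC`. -/
lemma hasDerivAt_sq_max_sub (c s : ℝ) :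
    HasDerivAt (fun s => (max (c - s) 0) ^ 2) (-(2 * max (c - s) 0)) s := by
  have key : ∀ y, |(max (c - y) 0) ^ 2 - (max (c - s) 0) ^ 2 - (y - s) * -(2 * max (c - s) 0)|
      ≤ (y - s) ^ 2 := by
    intro y
    rw [abs_le]
    rcases max_cases (c - y) 0 with ⟨h1, h1'⟩ | ⟨h1, h1'⟩ <;>
    rcases max_cases (c - s) 0 with ⟨h2, h2'⟩ | ⟨h2, h2'⟩ <;> rw [h1, h2] <;> constructor <;>
      nlinarith
  rw [hasDerivAt_iff_isLittleO]
  refine Asymptotics.IsBigO.trans_isLittleO (g := fun y => (y - s) ^ 2) ?_ ?_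
  · refine Asymptotics.IsBigO.of_bound 1 (Filter.Eventually.of_forall fun y => ?_)
    simpa using key y
  · have h : (fun y : ℝ => y - s) =o[nhds s] fun _ => (1 : ℝ) := by
      rw [Asymptotics.isLittleO_one_iff]
      have : Filter.Tendsto (fun y : ℝ => y - s) (nhds s) (nhds (s - s)) :=
        (continuous_id.sub continuous_const).tendsto s
      simpa using this
    simpa [pow_two] using h.mul_isBigO (Asymptotics.isBigO_refl (fun y : ℝ => y - s) (nhds s))

variable (σ : Compacts ℝ)

lemma antitone_max_sub (c : ℝ) : Antitone fun s : σ => max (c - (s : ℝ)) 0 := fun _ _ hst =>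
  max_le_max (sub_le_sub_left (Subtype.coe_le_coe.2 hst) c) le_rfl

lemma boundedVariationOn_max_sub (c : ℝ) :
    BoundedVariationOn (fun s : σ => ((max (c - (s : ℝ)) 0 : ℝ) : ℂ)) Set.univ := by
  obtain ⟨C, hC⟩ := σ.isCompact.isBounded.exists_norm_le
  refine boundedVariationOn_of_dominated (H := fun s => -max (c - (s : ℝ)) 0) (A := |c| + C)
    (fun x y hxy => ?_) fun x y _ => ?_
  · have := antitone_max_sub σ c hxy
    simp only at this
    rw [← Complex.ofReal_sub, Complex.norm_real, Real.norm_eq_abs, abs_sub_comm,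
        abs_of_nonneg (sub_nonneg.2 this)]
    linarith
  · have h1 : 0 ≤ max (c - (y : ℝ)) 0 := le_max_right _ _
    have h2 : max (c - (x : ℝ)) 0 ≤ |c| + C := by
      refine max_le ?_ (add_nonneg (abs_nonneg _) ((norm_nonneg _).trans (hC x x.2)))
      have := hC x x.2
      rw [Real.norm_eq_abs] at this
      linarith [le_abs_self c, neg_abs_le (x : ℝ)]
    linarith

/-- The function `s ↦ max (c - s) 0` on `σ`, as an element of `BV(σ)`. -/
noncomputable def truncBV (c : ℝ) : BV σ :=
  ⟨fun s => ((max (c - (s : ℝ)) 0 : ℝ) : ℂ), boundedVariationOn_max_sub σ c⟩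

/-- `max a 0` minus its `C¹` regularisation is antitone in `s` where `a = c - s`. -/
lemma trunc_sub_regularised (c ε : ℝ) (hε : 0 < ε) :
    let R : ℝ → ℝ := fun s => max (c - s) 0 -
      ((max (c - s) 0) ^ 2 - (max (c - ε - s) 0) ^ 2) / (2 * ε)
    Antitone R ∧ ∀ s, 0 ≤ R s ∧ R s ≤ ε := by
  intro R
  -- With m = min (max (c - s) 0) ε this reads R = m - m²/(2ε), which is increasing in m on [0, ε],
  -- while m decreases in s.
  have hR : ∀ s, R s = (2 * ε * min (max (c - s) 0) ε - (min (max (c - s) 0) ε) ^ 2) / (2 * ε) := by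
    intro s
    simp only [R]
    rw [eq_div_iff (by positivity), sub_mul, div_mul_cancel₀ _ (by positivity)]
    rcases max_cases (c - s) 0 with ⟨h1, h1'⟩ | ⟨h1, h1'⟩ <;>
    rcases max_cases (c - ε - s) 0 with ⟨h2, h2'⟩ | ⟨h2, h2'⟩ <;>
    rcases min_cases (max (c - s) 0) ε with ⟨h3, h3'⟩ | ⟨h3, h3'⟩ <;>
    rw [h3, h2, h1] <;> rw [h1] at h3' <;> nlinarith
  have hm : ∀ s, 0 ≤ min (max (c - s) 0) ε ∧ min (max (c - s) 0) ε ≤ ε := fun s =>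
    ⟨le_min (le_max_right _ _) hε.le, min_le_right _ _⟩
  refine ⟨fun s t hst => ?_, fun s => ?_⟩
  · rw [hR, hR]
    gcongr ?_ / _
    have h1 : min (max (c - t) 0) ε ≤ min (max (c - s) 0) ε :=
      min_le_min (max_le_max (by linarith) le_rfl) le_rfl
    nlinarith [hm s, hm t]
  · rw [hR]
    constructor
    · apply div_nonneg _ (by positivity)
      nlinarith [hm s]
    · rw [div_le_iff₀ (by positivity)]
      nlinarith [hm s]

/-- Uniform approximation does not control variation, but uniform approximation of the derivative
does. The kink is smoothed to a C¹ function `K`; Weierstrass approximates its derivative on an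
interval containing σ, and an antiderivative `P` makes `K - P` Lipschitz with a small constant. The
smoothing error `R` is monotone with values in [0, ε], so its variation is small too. -/
lemma truncBV_mem_AC (c : ℝ) : truncBV σ c ∈ AC σ := by
  intro δ hδ
  obtain ⟨R₀, hR₀⟩ := σ.isCompact.isBounded.exists_norm_le
  obtain ⟨r, hr0, hr⟩ : ∃ r : ℝ, 0 ≤ r ∧ ∀ s ∈ σ, |s| ≤ r :=
    ⟨max R₀ 0, le_max_right _ _, fun s hs => (hR₀ s hs).trans (le_max_left _ _)⟩
  -- The factor 2 + 3r collects the variation bound ε(2r) + ε and the supremum bound ε + εr obtained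
  -- at the end.
  obtain ⟨ε, hε, hεδ⟩ : ∃ ε : ℝ, 0 < ε ∧ ε * (2 + 3 * r) < δ := by
    refine ⟨δ / (2 * (2 + 3 * r)), by positivity, ?_⟩
    rw [div_mul_eq_mul_div, div_lt_iff₀ (by positivity)]
    nlinarith [mul_pos hδ (show 0 < 2 + 3 * r by positivity)]
  set φ : ℝ → ℝ := fun s => -((max (c - s) 0 - max (c - ε - s) 0) / ε) with hφ
  set K : ℝ → ℝ := fun s => ((max (c - s) 0) ^ 2 - (max (c - ε - s) 0) ^ 2) / (2 * ε) with hK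
  have hKd : ∀ s, HasDerivAt K (φ s) s := by
    intro s
    have := ((hasDerivAt_sq_max_sub c s).sub (hasDerivAt_sq_max_sub (c - ε) s)).div_const (2 * ε)
    refine this.congr_deriv ?_
    simp only [hφ]
    field_simp
    ring
  obtain ⟨q, hq⟩ := exists_polynomial_near_of_continuousOn (-r) r φ
    (Continuous.continuousOn (by fun_prop)) ε hε
  obtain ⟨Q, hQ⟩ := exists_polynomial_derivative_eq q
  -- The constant of integration makes `P` and `K` equal at 0, so the Lipschitz estimate on [-r, r]
  -- also bounds the supremum of `K - P`; 0 need not belong to σ.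
  set P : ℝ[X] := Q + Polynomial.C (K 0 - Q.eval 0) with hP
  have hP0 : P.eval 0 = K 0 := by simp [hP]
  have hPd : ∀ s, HasDerivAt (fun s => K s - P.eval s) (φ s - q.eval s) s := fun s => by
    refine (hKd s).sub ((P.hasDerivAt s).congr_deriv ?_)
    simp [hP, hQ]
  have hlip : ∀ x ∈ Set.Icc (-r) r, ∀ y ∈ Set.Icc (-r) r,
      |(K y - P.eval y) - (K x - P.eval x)| ≤ ε * |y - x| := by
    intro x hx y hy
    have := (convex_Icc (-r) r).norm_image_sub_le_of_norm_hasDerivWithin_le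
      (f := fun s => K s - P.eval s) (f' := fun s => φ s - q.eval s) (C := ε)
      (fun s _ => (hPd s).hasDerivWithinAt)
      (fun s hs => by rw [Real.norm_eq_abs, abs_sub_comm]; exact (hq s hs).le) hx hy
    simpa using this
  obtain ⟨hanti, hbd⟩ := trunc_sub_regularised c ε hε
  set R : ℝ → ℝ := fun s => max (c - s) 0 -
      ((max (c - s) 0) ^ 2 - (max (c - ε - s) 0) ^ 2) / (2 * ε) with hRdef
  refine ⟨P.map (algebraMap ℝ ℂ), ?_⟩
  have hval : ∀ s : σ, (truncBV σ c - polyBV σ (P.map (algebraMap ℝ ℂ)) : BV σ).1 s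
      = ((R s + (K s - P.eval (s : ℝ)) : ℝ) : ℂ) := by
    intro s
    have : (P.map (algebraMap ℝ ℂ)).eval ((s : ℝ) : ℂ) = ((P.eval (s : ℝ) : ℝ) : ℂ) := by
      have := Polynomial.eval_map_apply (f := algebraMap ℝ ℂ) (p := P) (s : ℝ)
      simpa using this
    change ((max (c - (s : ℝ)) 0 : ℝ) : ℂ) - _ = _
    simp only [polyBV]
    rw [this]
    simp only [R, K]
    push_cast
    ring
  have hmem : ∀ s : σ, (s : ℝ) ∈ Set.Icc (-r) r := fun s => abs_le.1 (hr s s.2)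
  have h0 : (0 : ℝ) ∈ Set.Icc (-r) r := ⟨by linarith, hr0⟩
  have := bvNorm_le_of_dominated
    (h := (truncBV σ c - polyBV σ (P.map (algebraMap ℝ ℂ)) : BV σ).1)
    (H := fun s => ε * s - R s) (A := ε * (2 * r) + ε) (B := ε + ε * r)
    (fun x y hxy => by
      have hxy' : (x : ℝ) ≤ y := hxy
      rw [hval, hval, ← Complex.ofReal_sub, Complex.norm_real, Real.norm_eq_abs]
      have h1 := hlip x (hmem x) y (hmem y)
      rw [abs_of_nonneg (sub_nonneg.2 hxy')] at h1
      have h2 := hanti hxy'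
      rw [abs_le] at h1 ⊢
      constructor <;> linarith)
    (fun x y _ => by
      have := (hmem x).1; have := (hmem y).2; have := (hbd x).2; have := (hbd y).1
      nlinarith) (by positivity)
    (fun x => by
      rw [hval, Complex.norm_real, Real.norm_eq_abs]
      have h1 := hlip 0 h0 x (hmem x)
      rw [hP0, sub_self, sub_zero, sub_zero] at h1
      have h2 : ε * |(x : ℝ)| ≤ ε * r := mul_le_mul_of_nonneg_left (hr x x.2) hε.le
      have h3 := hbd x
      refine (abs_add_le _ _).trans (add_le_add ?_ (h1.trans h2))
      rw [abs_of_nonneg h3.1]; exact h3.2) (by positivity)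
  linarith

/-- The function `s ↦ max (c - s) 0` on `σ`, as an element of `AC(σ)`. -/
noncomputable def truncAC (c : ℝ) : AC σ := ⟨truncBV σ c, truncBV_mem_AC σ c⟩

/-- The ramp equal to `1` left of `a` and to `0` right of `b`, affine in between. -/
noncomputable def rampAC (a b : ℝ) : AC σ := ((b - a : ℝ) : ℂ)⁻¹ • (truncAC σ b - truncAC σ a)

/-- The real function underlying `rampAC`. -/
noncomputable def ramp (a b s : ℝ) : ℝ := (b - a)⁻¹ * (max (b - s) 0 - max (a - s) 0)

lemma rampAC_apply (a b : ℝ) (s : σ) : (rampAC σ a b).1.1 s = (ramp a b s : ℂ) := by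
  simp [rampAC, truncAC, truncBV, ramp]

end Ramps

lemma ramp_eq_zero {a b s : ℝ} (hab : a ≤ b) (hs : b ≤ s) : ramp a b s = 0 := by
  rw [ramp, max_eq_right (by linarith), max_eq_right (by linarith)]; simp

lemma ramp_eq_one {a b s : ℝ} (hab : a < b) (hs : s ≤ a) : ramp a b s = 1 := by
  rw [ramp, max_eq_left (by linarith), max_eq_left (by linarith)]
  have : b - a ≠ 0 := by linarith
  field_simp
  ring

lemma ramp_nonneg {a b : ℝ} (hab : a ≤ b) (s : ℝ) : 0 ≤ ramp a b s :=
  mul_nonneg (inv_nonneg.2 (by linarith)) (sub_nonneg.2 (max_le_max (by linarith) le_rfl))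

lemma ramp_le_one {a b : ℝ} (hab : a ≤ b) (s : ℝ) : ramp a b s ≤ 1 := by
  rcases hab.eq_or_lt with rfl | h
  · simp [ramp]
  · rw [ramp, inv_mul_le_iff₀ (by linarith)]
    rcases max_cases (b - s) 0 with ⟨h1, h1'⟩ | ⟨h1, h1'⟩ <;>
    rcases max_cases (a - s) 0 with ⟨h2, h2'⟩ | ⟨h2, h2'⟩ <;> linarith

lemma ramp_antitone {a b : ℝ} (hab : a ≤ b) : Antitone (ramp a b) := by
  intro s t hst
  refine mul_le_mul_of_nonneg_left ?_ (inv_nonneg.2 (by linarith))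
  rcases max_cases (b - s) 0 with ⟨h1, h1'⟩ | ⟨h1, h1'⟩ <;>
  rcases max_cases (a - s) 0 with ⟨h2, h2'⟩ | ⟨h2, h2'⟩ <;>
  rcases max_cases (b - t) 0 with ⟨h3, h3'⟩ | ⟨h3, h3'⟩ <;>
  rcases max_cases (a - t) 0 with ⟨h4, h4'⟩ | ⟨h4, h4'⟩ <;> linarith

lemma bvNorm_rampAC_le {σ : Compacts ℝ} {a b : ℝ} (hab : a ≤ b) :
    bvNorm (rampAC σ a b).1.1 ≤ 3 := by
  have e : (rampAC σ a b).1.1 = fun s : σ => (ramp a b s : ℂ) := funext (rampAC_apply σ a b)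
  rw [e]
  have := bvNorm_le_of_antitone (σ := σ) (h := fun s => ramp a b s) (C := 1)
    (fun s t hst => ramp_antitone hab hst)
    (fun s => by rw [abs_of_nonneg (ramp_nonneg hab _)]; exact ramp_le_one hab _) zero_le_one
  linarith

instance AC.instCommRing (σ : Compacts ℝ) : CommRing (AC σ) := Subalgebra.toCommRing (AC σ)

instance AC.instAddCommGroup (σ : Compacts ℝ) : AddCommGroup (AC σ) :=
  (AC.instCommRing σ).toAddCommGroup

instance AC.instAddGroup (σ : Compacts ℝ) : AddGroup (AC σ) := (AC.instAddCommGroup σ).toAddGroup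

/-! ### Minimisation of uniformly convex functionals. -/

section NestedMinimisation

open Filter Topology

/-- A continuous functional that is uniformly convex attains its minimum on the intersection of a
decreasing sequence of closed midpoint convex sets. -/
lemma exists_forall_le_of_uniformlyConvex {X : Type*} [NormedAddCommGroup X] [NormedSpace ℂ X]
    [CompleteSpace X] {F : X → ℝ} (hF : Continuous F) {p : ℕ} {c : ℝ} (hc : 0 < c)
    (hconv : ∀ x y, F ((2⁻¹ : ℂ) • (x + y)) + c * ‖x - y‖ ^ p ≤ (F x + F y) / 2)
    {b B : ℝ} (hb : ∀ x, b ≤ F x) {K : ℕ → Set X} (hK : Antitone K) (hKc : ∀ n, IsClosed (K n))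
    (hKm : ∀ n, ∀ x ∈ K n, ∀ y ∈ K n, (2⁻¹ : ℂ) • (x + y) ∈ K n)
    (hKB : ∀ n, ∃ x ∈ K n, F x ≤ B) :
    ∃ x, (∀ n, x ∈ K n) ∧ ∀ y, (∀ n, y ∈ K n) → F x ≤ F y := by
  have hne : ∀ n, (F '' K n).Nonempty := fun n => by
    obtain ⟨x, hx, -⟩ := hKB n; exact ⟨_, x, hx, rfl⟩
  have hbdd : ∀ n, BddBelow (F '' K n) := fun n => ⟨b, by rintro _ ⟨x, -, rfl⟩; exact hb x⟩
  set d : ℕ → ℝ := fun n => sInf (F '' K n) with hd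
  have hdle : ∀ n, ∀ x ∈ K n, d n ≤ F x := fun n x hx => csInf_le (hbdd n) ⟨x, hx, rfl⟩
  have hdmono : Monotone d := fun m n hmn =>
    csInf_le_csInf (hbdd m) (hne n) (Set.image_mono (hK hmn))
  have hdB : ∀ n, d n ≤ B := fun n => by
    obtain ⟨x, hx, hxB⟩ := hKB n; exact (hdle n x hx).trans hxB
  have hdlim : Tendsto d atTop (𝓝 (⨆ n, d n)) :=
    tendsto_atTop_ciSup hdmono ⟨B, by rintro _ ⟨n, rfl⟩; exact hdB n⟩
  set D := ⨆ n, d n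
  have hdD : ∀ n, d n ≤ D := fun n => le_ciSup (f := d) ⟨B, by rintro _ ⟨n, rfl⟩; exact hdB n⟩ n
  have hex : ∀ n : ℕ, ∃ x ∈ K n, F x < d n + 1 / ((n : ℝ) + 1) := fun n => by
    obtain ⟨_, ⟨x, hx, rfl⟩, h⟩ := Real.lt_sInf_add_pos (hne n) (Nat.one_div_pos_of_nat (n := n))
    exact ⟨x, hx, h⟩
  choose x hxK hxF using hex
  -- The midpoint of `x n` and `x m` lies in `K n`, so `F` is at least `d n` there; uniform
  -- convexity turns this into a bound for the distance.
  have hest : ∀ n m, n ≤ m → c * ‖x n - x m‖ ^ p ≤ (D - d n) / 2 + 1 / ((n : ℝ) + 1) := by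
    intro n m hnm
    have h1 := hconv (x n) (x m)
    have h2 := hdle n _ (hKm n _ (hxK n) _ (hK hnm (hxK m)))
    have h3 := hxF n
    have h4 := hxF m
    have h5 := hdD m
    have h6 := Nat.one_div_le_one_div (α := ℝ) hnm
    linarith
  have hlim0 : Tendsto (fun n : ℕ => (D - d n) / 2 + 1 / ((n : ℝ) + 1)) atTop (𝓝 0) := by
    have := ((tendsto_const_nhds (x := D)).sub hdlim).div_const 2
    simpa using this.add (tendsto_one_div_add_atTop_nhds_zero_nat (𝕜 := ℝ))
  have hcau : CauchySeq x := by
    rw [Metric.cauchySeq_iff']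
    intro ε hε
    obtain ⟨N, hN⟩ := ((tendsto_order.1 hlim0).2 (c * ε ^ p) (by positivity)).exists
    refine ⟨N, fun n hn => ?_⟩
    have h := (hest N n hn).trans_lt hN
    rw [dist_comm, dist_eq_norm]
    exact lt_of_pow_lt_pow_left₀ p hε.le (lt_of_mul_lt_mul_left h hc.le)
  obtain ⟨z, hz⟩ := cauchySeq_tendsto_of_complete hcau
  refine ⟨z, fun n => (hKc n).mem_of_tendsto hz ?_, fun y hy => ?_⟩
  · filter_upwards [eventually_ge_atTop n] with m hm using hK hm (hxK m)
  · have h1 : Tendsto (fun n => F (x n)) atTop (𝓝 (F z)) := (hF.tendsto z).comp hz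
    have h2 := hdlim.add (tendsto_one_div_add_atTop_nhds_zero_nat (𝕜 := ℝ))
    rw [add_zero] at h2
    have h3 : F z ≤ D := le_of_tendsto_of_tendsto' h1 h2 fun n => (hxF n).le
    exact h3.trans (ciSup_le fun n => hdle n y (hy n))

/-- Clarkson's inequality with exponent `p` holds in `X`. -/
def IsClarkson (X : Type*) [NormedAddCommGroup X] (p : ℕ) : Prop :=
  ∀ x y : X, ‖x + y‖ ^ p + ‖x - y‖ ^ p ≤ 2 ^ p * ((‖x‖ ^ p + ‖y‖ ^ p) / 2)

/-- Rescaled by `2 ^ p`, Clarkson's inequality is the uniform convexity of `‖·‖ ^ p` that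
`exists_forall_le_of_uniformlyConvex` asks for. -/
lemma IsClarkson.midpoint {X : Type*} [NormedAddCommGroup X] [NormedSpace ℂ X] {p : ℕ}
    (hX : IsClarkson X p) (x y : X) :
    ‖(2⁻¹ : ℂ) • (x + y)‖ ^ p + (2 ^ p)⁻¹ * ‖x - y‖ ^ p ≤ (‖x‖ ^ p + ‖y‖ ^ p) / 2 := by
  have := hX x y
  rw [norm_smul, mul_pow]
  have e : ‖(2⁻¹ : ℂ)‖ ^ p = (2 ^ p)⁻¹ := by simp
  rw [e, ← mul_add, inv_mul_le_iff₀ (by positivity)]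
  exact this

end NestedMinimisation

/-! ### Division by s - t in AC(σ), and bumps near a point. -/

section Polynomials

variable (σ : Compacts ℝ)

/-- The restriction of a polynomial to `σ`, as an element of `AC(σ)`. -/
noncomputable def polyAC (p : ℂ[X]) : AC σ :=
  ⟨polyBV σ p, fun ε hε => ⟨p, by rw [sub_self]; simpa using bvNorm_zero.trans_lt hε⟩⟩

lemma polyAC_eq_aeval (p : ℂ[X]) : polyAC σ p = Polynomial.aeval (AC.ident σ) p := by
  induction p using Polynomial.induction_on' with
  | add p q hp hq => rw [map_add, ← hp, ← hq]; ext; simp [polyAC, polyBV]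
  | monomial n a =>
    rw [Polynomial.aeval_monomial]
    ext t
    simp [polyAC, polyBV, AC.ident]

/-- The function `s ↦ s - t` on `σ`. -/
noncomputable def shiftAC (t : ℝ) : AC σ := AC.ident σ - algebraMap ℂ (AC σ) t

variable {σ}

@[simp] lemma shiftAC_apply (t : ℝ) (s : σ) : (shiftAC σ t).1.1 s = ((s - t : ℝ) : ℂ) := by
  simp [shiftAC, AC.ident, polyBV]

lemma bvNorm_algebraMap_le (c : ℂ) : bvNorm (algebraMap ℂ (AC σ) c).1.1 ≤ ‖c‖ := by
  have := bvNorm_le_of_dominated (σ := σ) (h := (algebraMap ℂ (AC σ) c).1.1) (H := fun _ => 0)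
    (A := 0) (B := ‖c‖) (by simp) (by simp) le_rfl (by simp) (norm_nonneg _)
  simpa using this

lemma AC.bvNorm_sub_le (f g : AC σ) : bvNorm (f - g).1.1 ≤ bvNorm f.1.1 + bvNorm g.1.1 :=
  BV.bvNorm_sub_le f.1 g.1

lemma AC.bvNorm_mul_le (f g : AC σ) : bvNorm (f * g).1.1 ≤ bvNorm f.1.1 * bvNorm g.1.1 :=
  _root_.bvNorm_mul_le f.1.2 g.1.2

/-- Every `f ∈ AC(σ)` is, up to a small error, `f t` plus a multiple of `s - t`. -/
lemma AC.exists_shift_mul (f : AC σ) (t : σ) {ε : ℝ} (hε : 0 < ε) :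
    ∃ h : AC σ, bvNorm (f - algebraMap ℂ _ (f.1.1 t) - shiftAC σ t * h).1.1 < ε := by
  obtain ⟨p, hp⟩ := f.2 (ε / 2) (half_pos hε)
  obtain ⟨q, hq⟩ := Polynomial.X_sub_C_dvd_sub_C_eval (p := p) (a := ((t : ℝ) : ℂ))
  refine ⟨polyAC σ q, ?_⟩
  -- Since X - t divides p - p(t), with quotient q, the error is f - p minus its own value at t, of
  -- norm at most twice that of f - p.
  have e : f - algebraMap ℂ _ (f.1.1 t) - shiftAC σ t * polyAC σ q
      = (f - polyAC σ p) - algebraMap ℂ _ ((f - polyAC σ p).1.1 t) := by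
    ext s
    have := congrArg (Polynomial.eval ((s : ℝ) : ℂ)) hq
    simp only [Polynomial.eval_sub, Polynomial.eval_C, Polynomial.eval_mul, Polynomial.eval_X]
      at this
    change f.1.1 s - f.1.1 t - (shiftAC σ t).1.1 s * q.eval ((s : ℝ) : ℂ)
      = f.1.1 s - p.eval ((s : ℝ) : ℂ) - (f.1.1 t - p.eval ((t : ℝ) : ℂ))
    rw [shiftAC_apply]
    push_cast
    linear_combination this
  rw [e]
  have h1 := AC.bvNorm_sub_le (f - polyAC σ p) (algebraMap ℂ _ ((f - polyAC σ p).1.1 t))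
  have h2 := bvNorm_algebraMap_le (σ := σ) ((f - polyAC σ p).1.1 t)
  have h3 := norm_le_bvNorm (f - polyAC σ p).1.2 t
  have h4 : bvNorm (f - polyAC σ p).1.1 < ε / 2 := hp
  linarith

/-- Functions in `AC(σ)` with value `c` at `t`, supported near `t`, of bounded norm. -/
def bumps (t : σ) (η : ℝ) (c : ℂ) : Set (AC σ) :=
  {w | bvNorm w.1.1 ≤ 12 ∧ w.1.1 t = c ∧ ∀ s : σ, η < |(s : ℝ) - t| → w.1.1 s = 0}

/-- On the set where `w` can be nonzero, s - t equals its truncation to [-η, η], a monotone function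
of norm at most 3η; the other factor 12 is the norm bound in `bumps`. -/
lemma bvNorm_shiftAC_mul_le {t : σ} {η : ℝ} (hη : 0 ≤ η) {c : ℂ} {w : AC σ}
    (hw : w ∈ bumps t η c) : bvNorm (shiftAC σ t * w).1.1 ≤ 36 * η := by
  set k : σ → ℝ := fun s => max (-η) (min η (s - t)) with hk
  have hkm : Monotone k := fun a b hab =>
    max_le_max le_rfl (min_le_min le_rfl (sub_le_sub_right (Subtype.coe_le_coe.2 hab) _))
  have hkb : ∀ s, |k s| ≤ η := fun s =>
    abs_le.2 ⟨le_max_left _ _, max_le (by linarith) (min_le_left _ _)⟩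
  have e : (shiftAC σ t * w).1.1 = (fun s => (k s : ℂ)) * w.1.1 := by
    ext s
    change (shiftAC σ t).1.1 s * w.1.1 s = k s * w.1.1 s
    rw [shiftAC_apply]
    by_cases hs : η < |(s : ℝ) - t|
    · simp [hw.2.2 s hs]
    · have := abs_le.1 (not_lt.1 hs)
      simp only [hk]
      rw [min_eq_right this.2, max_eq_right this.1]
  rw [e]
  refine (_root_.bvNorm_mul_le (boundedVariationOn_of_monotone hkm hkb) w.1.2).trans ?_
  have h1 := bvNorm_le_of_monotone hkm hkb hη
  have h2 := hw.1
  have h3 : 0 ≤ bvNorm w.1.1 := bvNorm_nonneg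
  nlinarith

/-- A tent: the difference of the ramps descending on [t, t + η] and on [t - η, t]. -/
lemma exists_mem_bumps_one (t : σ) {η : ℝ} (hη : 0 < η) : ∃ w, w ∈ bumps t η 1 := by
  refine ⟨rampAC σ t (t + η) - rampAC σ (t - η) t, ?_, ?_, fun s hs => ?_⟩
  · have := AC.bvNorm_sub_le (rampAC σ t (t + η)) (rampAC σ (t - η) t)
    have h1 := bvNorm_rampAC_le (σ := σ) (a := t) (b := t + η) (by linarith)
    have h2 := bvNorm_rampAC_le (σ := σ) (a := t - η) (b := t) (by linarith)
    linarith
  · change (rampAC σ t (t + η)).1.1 t - (rampAC σ (t - η) t).1.1 t = 1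
    rw [rampAC_apply, rampAC_apply, ramp_eq_one (by linarith) le_rfl,
      ramp_eq_zero (by linarith) le_rfl]
    simp
  · change (rampAC σ t (t + η)).1.1 s - (rampAC σ (t - η) t).1.1 s = 0
    rw [rampAC_apply, rampAC_apply]
    rcases lt_abs.1 hs with h | h
    · rw [ramp_eq_zero (by linarith) (by linarith), ramp_eq_zero (by linarith) (by linarith)]
      simp
    · rw [ramp_eq_one (by linarith) (by linarith), ramp_eq_one (by linarith) (by linarith)]
      simp

end Polynomials

/-! ### Mean ergodic decomposition and local smallness of the calculus. -/

section Ergodic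

open Filter Topology

variable {σ : Compacts ℝ} {X : Type*} [NormedAddCommGroup X] [NormedSpace ℂ X]
  {Φ : AC σ →ₐ[ℂ] (X →L[ℂ] X)} {M : ℝ}

lemma ACCalculus.norm_apply_le (hΦ : ∀ f : AC σ, ‖Φ f‖ ≤ M * bvNorm f.1.1) (f : AC σ) (x : X) :
    ‖Φ f x‖ ≤ M * bvNorm f.1.1 * ‖x‖ :=
  (Φ f).le_of_opNorm_le (hΦ f) x

lemma ACCalculus.exists_apply_sub (hM : 0 ≤ M) (hΦ : ∀ f : AC σ, ‖Φ f‖ ≤ M * bvNorm f.1.1)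
    (f : AC σ) (t : σ) (x : X) {ε : ℝ} (hε : 0 < ε) :
    ∃ h : AC σ, ‖Φ f x - f.1.1 t • x - Φ (shiftAC σ t) (Φ h x)‖ ≤ ε := by
  obtain ⟨h, hh⟩ := AC.exists_shift_mul f t (ε := ε / (M * ‖x‖ + 1)) (by positivity)
  refine ⟨h, ?_⟩
  have e : Φ f x - f.1.1 t • x - Φ (shiftAC σ t) (Φ h x)
      = Φ (f - algebraMap ℂ _ (f.1.1 t) - shiftAC σ t * h) x := by
    simp [map_sub, map_mul, Algebra.algebraMap_eq_smul_one]
  rw [e]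
  refine (ACCalculus.norm_apply_le hΦ _ x).trans ?_
  rw [lt_div_iff₀ (by positivity)] at hh
  have := bvNorm_nonneg (f := (f - algebraMap ℂ _ (f.1.1 t) - shiftAC σ t * h).1.1)
  nlinarith

/-- Up to a small error, Φ(f) - f(t) is Φ(h)(S - t), which kills ker (S - t). -/
lemma ACCalculus.apply_of_mem_ker (hM : 0 ≤ M) (hΦ : ∀ f : AC σ, ‖Φ f‖ ≤ M * bvNorm f.1.1)
    (f : AC σ) {t : σ} {x : X} (hx : Φ (shiftAC σ t) x = 0) : Φ f x = f.1.1 t • x := by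
  refine sub_eq_zero.1 (norm_le_zero_iff.1 (le_of_forall_pos_le_add fun ε hε => ?_))
  obtain ⟨h, hh⟩ := ACCalculus.exists_apply_sub hM hΦ f t x hε
  have : Φ (shiftAC σ t) (Φ h x) = 0 := by
    rw [← mul_apply_eq_comp, ← map_mul, mul_comm, map_mul,
      mul_apply_eq_comp, hx, map_zero]
  rw [this, sub_zero] at hh
  simpa using hh

lemma ACCalculus.sub_mem_closure_range (hM : 0 ≤ M) (hΦ : ∀ f : AC σ, ‖Φ f‖ ≤ M * bvNorm f.1.1)
    (f : AC σ) (t : σ) (x : X) :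
    Φ f x - f.1.1 t • x ∈ closure (Set.range (Φ (shiftAC σ t))) := by
  rw [Metric.mem_closure_iff]
  intro ε hε
  obtain ⟨h, hh⟩ := ACCalculus.exists_apply_sub hM hΦ f t x (half_pos hε)
  exact ⟨_, ⟨Φ h x, rfl⟩, by rw [dist_eq_norm]; linarith⟩

/-- The mean ergodic decomposition `X = ker (S - t) + closure (range (S - t))`. -/
lemma ACCalculus.exists_decomposition [CompleteSpace X] {p : ℕ}
    (hX : IsClarkson X p) (hM : 0 ≤ M) (hΦ : ∀ f : AC σ, ‖Φ f‖ ≤ M * bvNorm f.1.1)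
    (t : σ) (y : X) :
    ∃ z, Φ (shiftAC σ t) z = 0 ∧ y - z ∈ closure (Set.range (Φ (shiftAC σ t))) := by
  set A : ℕ → Set X := fun n => (fun w => Φ w y) '' bumps t (1 / ((n : ℝ) + 1)) 1 with hA
  have hpos : ∀ n : ℕ, (0 : ℝ) < 1 / ((n : ℝ) + 1) := fun n => Nat.one_div_pos_of_nat
  have hbound : ∀ η c, ∀ w ∈ bumps t η c, ‖Φ w y‖ ≤ M * 12 * ‖y‖ := fun η c w hw =>
    (ACCalculus.norm_apply_le hΦ w y).trans (by gcongr; exact hw.1)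
  -- Only a common point of the closures of the nested sets `A n` is needed; minimality is
  -- discarded.
  obtain ⟨z, hz, -⟩ := exists_forall_le_of_uniformlyConvex (X := X) (F := fun x => ‖x‖ ^ p)
    (by fun_prop) (c := (2 ^ p)⁻¹) (by positivity) hX.midpoint (b := 0)
    (B := (M * 12 * ‖y‖) ^ p) (fun x => by positivity) (K := fun n => closure (A n))
    (fun m n hmn => closure_mono (Set.image_mono fun w hw =>
      ⟨hw.1, hw.2.1, fun s hs => hw.2.2 s ((Nat.one_div_le_one_div hmn).trans_lt hs)⟩))
    (fun n => isClosed_closure)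
    (fun n x hx x' hx' => map_mem_closure₂ (f := fun x x' => (2⁻¹ : ℂ) • (x + x'))
      (by fun_prop) hx hx' (by
        rintro _ ⟨w, hw, rfl⟩ _ ⟨w', hw', rfl⟩
        refine ⟨(2⁻¹ : ℂ) • (w + w'), ⟨?_, ?_, fun s hs => ?_⟩, by simp⟩
        · have h1 := bvNorm_smul_le (2⁻¹ : ℂ) (w + w').1.2
          have h2 := bvNorm_add_le w.1.2 w'.1.2
          have h3 := hw.1
          have h4 := hw'.1
          have h5 : ‖(2⁻¹ : ℂ)‖ = 2⁻¹ := by simp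
          rw [h5] at h1
          change bvNorm ((2⁻¹ : ℂ) • (w + w').1.1) ≤ 12
          change bvNorm (w + w').1.1 ≤ _ at h2
          linarith
        · change (2⁻¹ : ℂ) * (w.1.1 t + w'.1.1 t) = 1
          rw [hw.2.1, hw'.2.1]; norm_num
        · change (2⁻¹ : ℂ) * (w.1.1 s + w'.1.1 s) = 0
          rw [hw.2.2 s hs, hw'.2.2 s hs]; norm_num))
    (fun n => by
      obtain ⟨w, hw⟩ := exists_mem_bumps_one t (hpos n)
      exact ⟨_, subset_closure ⟨w, hw, rfl⟩,
        pow_le_pow_left₀ (norm_nonneg _) (hbound _ _ w hw) _⟩)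
  refine ⟨z, ?_, ?_⟩
  · have h : ∀ n : ℕ, ‖Φ (shiftAC σ t) z‖ ≤ M * 36 * ‖y‖ * (1 / ((n : ℝ) + 1)) := fun n => by
      have hcl : IsClosed {x : X | ‖Φ (shiftAC σ t) x‖ ≤ M * 36 * ‖y‖ * (1 / ((n : ℝ) + 1))} :=
        isClosed_le (by fun_prop) continuous_const
      refine closure_minimal ?_ hcl (hz n)
      rintro _ ⟨w, hw, rfl⟩
      have h1 : Φ (shiftAC σ t) (Φ w y) = Φ (shiftAC σ t * w) y := by rw [map_mul]; rfl
      change ‖Φ (shiftAC σ t) (Φ w y)‖ ≤ _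
      rw [h1]
      refine (ACCalculus.norm_apply_le hΦ _ y).trans ?_
      have h2 := bvNorm_shiftAC_mul_le (hpos n).le hw
      calc _ ≤ M * (36 * (1 / ((n : ℝ) + 1))) * ‖y‖ := by gcongr
        _ = _ := by ring
    have h2 := (tendsto_one_div_add_atTop_nhds_zero_nat (𝕜 := ℝ)).const_mul (M * 36 * ‖y‖)
    rw [mul_zero] at h2
    exact norm_le_zero_iff.1 (ge_of_tendsto' h2 h)
  · have hcl : IsClosed {x : X | y - x ∈ closure (Set.range (Φ (shiftAC σ t)))} :=
      isClosed_closure.preimage (by fun_prop)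
    refine closure_minimal ?_ hcl (hz 0)
    rintro _ ⟨w, hw, rfl⟩
    -- y - Φ(w)y is Φ(1 - w)y, and 1 - w vanishes at t.
    have := ACCalculus.sub_mem_closure_range hM hΦ (1 - w) t y
    have e : Φ (1 - w) y - (1 - w).1.1 t • y = y - Φ w y := by
      have : (1 - w).1.1 t = 0 := by
        change (1 : ℂ) - w.1.1 t = 0
        rw [hw.2.1, sub_self]
      rw [this, zero_smul, sub_zero, map_sub, map_one]; rfl
    rwa [e] at this

/-- The calculus is locally small on functions that vanish at `t` and live near `t`. -/
lemma ACCalculus.exists_forall_bumps_le [CompleteSpace X] {p : ℕ}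
    (hX : IsClarkson X p) (hM : 0 ≤ M) (hΦ : ∀ f : AC σ, ‖Φ f‖ ≤ M * bvNorm f.1.1)
    (t : σ) (x : X) {δ : ℝ} (hδ : 0 < δ) :
    ∃ η > 0, ∀ w ∈ bumps t η 0, ‖Φ w x‖ ≤ δ := by
  obtain ⟨z, hz, hv⟩ := ACCalculus.exists_decomposition hX hM hΦ t x
  obtain ⟨_, ⟨u, rfl⟩, hu⟩ := Metric.mem_closure_iff.1 hv (δ / (2 * (12 * M + 1))) (by positivity)
  rw [dist_eq_norm, lt_div_iff₀ (by positivity)] at hu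
  refine ⟨δ / (2 * (36 * M * ‖u‖ + 1)), by positivity, fun w hw => ?_⟩
  set η := δ / (2 * (36 * M * ‖u‖ + 1)) with hη
  have hη0 : 0 < η := by positivity
  have hη1 : η * (36 * M * ‖u‖ + 1) = δ / 2 := by rw [hη]; field_simp
  -- x is split as z + (S - t)u + error. The eigenvector z is killed because w(t) = 0; the error
  -- costs 12M times its norm; the middle term costs 36Mη‖u‖. The constants leave δ/2 for each of
  -- the last two.
  have e : Φ w x = Φ w (x - z - Φ (shiftAC σ t) u) + Φ (shiftAC σ t * w) u := by
    have h1 : Φ w z = 0 := by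
      rw [ACCalculus.apply_of_mem_ker hM hΦ w hz, hw.2.1, zero_smul]
    have h2 : Φ (shiftAC σ t * w) u = Φ w (Φ (shiftAC σ t) u) := by
      rw [mul_comm, map_mul]; rfl
    rw [h2, map_sub, map_sub, h1]; abel
  rw [e]
  refine (norm_add_le _ _).trans ?_
  have h1 := ACCalculus.norm_apply_le hΦ w (x - z - Φ (shiftAC σ t) u)
  have h2 := ACCalculus.norm_apply_le hΦ (shiftAC σ t * w) u
  have h3 := bvNorm_shiftAC_mul_le hη0.le hw
  have h4 := hw.1
  have h5 : M * bvNorm w.1.1 * ‖x - z - Φ (shiftAC σ t) u‖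
      ≤ M * 12 * ‖x - z - Φ (shiftAC σ t) u‖ := by gcongr
  have h6 : M * bvNorm (shiftAC σ t * w).1.1 * ‖u‖ ≤ M * (36 * η) * ‖u‖ := by gcongr
  have h7 := norm_nonneg (x - z - Φ (shiftAC σ t) u)
  nlinarith

end Ergodic

/-! ### Step functions approximating the ramp operators at a vector. -/

section Cells

variable {σ : Compacts ℝ}

/-- When t lies on the same side of both descents, the two ramps agree at t, and they also agree
away from t because each descent takes place within η of t. -/
lemma rampAC_sub_mem_bumps {t a b a' b' : σ} {η : ℝ} (hab : a < b) (hab' : a' < b')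
    (ht : (t ≤ a ∧ t ≤ a') ∨ (b ≤ t ∧ b' ≤ t)) (h1 : (t : ℝ) - η ≤ a) (h1' : (t : ℝ) - η ≤ a')
    (h2 : (b : ℝ) ≤ t + η) (h2' : (b' : ℝ) ≤ t + η) :
    rampAC σ a b - rampAC σ a' b' ∈ bumps t η 0 := by
  have hab : (a : ℝ) < b := hab
  have hab' : (a' : ℝ) < b' := hab'
  have hval : ∀ s : σ, (rampAC σ a b - rampAC σ a' b').1.1 s = ramp a b s - ramp a' b' s := by
    intro s
    rw [← rampAC_apply, ← rampAC_apply]; rfl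
  refine ⟨?_, ?_, fun s hs => ?_⟩
  · have := AC.bvNorm_sub_le (rampAC σ a b) (rampAC σ a' b')
    have := bvNorm_rampAC_le (σ := σ) hab.le
    have := bvNorm_rampAC_le (σ := σ) hab'.le
    linarith
  · rw [hval]
    rcases ht with ⟨h, h'⟩ | ⟨h, h'⟩
    · rw [ramp_eq_one hab h, ramp_eq_one hab' h', sub_self]
    · rw [ramp_eq_zero hab.le h, ramp_eq_zero hab'.le h', sub_self]
  · rw [hval]
    rcases lt_abs.1 hs with h | h
    · rw [ramp_eq_zero hab.le (by linarith), ramp_eq_zero hab'.le (by linarith), sub_self]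
    · rw [ramp_eq_one hab (by linarith), ramp_eq_one hab' (by linarith), sub_self]

/-- The constant 12 of `bumps` is 3 + 3·3, as needed here. -/
lemma rampAC_sub_sq_mem_bumps {t a b : σ} {η : ℝ} (hab : a < b) (ht : t ≤ a ∨ b ≤ t)
    (h1 : (t : ℝ) - η ≤ a) (h2 : (b : ℝ) ≤ t + η) :
    rampAC σ a b - rampAC σ a b * rampAC σ a b ∈ bumps t η 0 := by
  have hab : (a : ℝ) < b := hab
  have hval : ∀ s : σ, (rampAC σ a b - rampAC σ a b * rampAC σ a b).1.1 s
      = ramp a b s - ramp a b s * ramp a b s := by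
    intro s
    rw [← rampAC_apply]; rfl
  refine ⟨?_, ?_, fun s hs => ?_⟩
  · have h3 := AC.bvNorm_sub_le (rampAC σ a b) (rampAC σ a b * rampAC σ a b)
    have h4 := AC.bvNorm_mul_le (rampAC σ a b) (rampAC σ a b)
    have h5 := bvNorm_rampAC_le (σ := σ) hab.le
    have h6 : 0 ≤ bvNorm (rampAC σ a b).1.1 := bvNorm_nonneg
    nlinarith
  · rw [hval]
    rcases ht with h | h
    · rw [ramp_eq_one hab h]; simp
    · rw [ramp_eq_zero hab.le h]; simp
  · rw [hval]
    rcases lt_abs.1 hs with h | h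
    · rw [ramp_eq_zero hab.le (by linarith)]; simp
    · rw [ramp_eq_one hab (by linarith)]; simp

/-- Given a radius around every point of `σ`, there is a finite set `G` such that any two pairs of
points in a common cell of `G` are neighbours in `σ` or lie on one side of the centre of one of the
given neighbourhoods. -/
lemma exists_finset_cells {η : σ → ℝ} (hη : ∀ t, 0 < η t) :
    ∃ G : Finset σ, ∀ a b a' b' : σ, a < b → a' < b' →
      (∀ g ∈ G, (g ≤ a ∧ g ≤ a') ∨ (b ≤ g ∧ b' ≤ g)) →
      (a = a' ∧ b = b' ∧ ∀ s : σ, s ≤ a ∨ b ≤ s) ∨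
      ∃ t : σ, ((t ≤ a ∧ t ≤ a') ∨ (b ≤ t ∧ b' ≤ t)) ∧ (t : ℝ) - η t ≤ a ∧ (t : ℝ) - η t ≤ a' ∧
        (b : ℝ) ≤ t + η t ∧ (b' : ℝ) ≤ t + η t := by
  classical
  have : CompactSpace σ := isCompact_iff_compactSpace.1 σ.isCompact
  obtain ⟨I, hI⟩ := (isCompact_univ (X := σ)).elim_finite_subcover
    (fun t : σ => Metric.ball t (η t)) (fun t => Metric.isOpen_ball)
    (fun t _ => Set.mem_iUnion.2 ⟨t, Metric.mem_ball_self (hη t)⟩)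
  have hmin : ∀ t : σ, ∃ m, IsLeast (Metric.closedBall t (η t)) m := fun t =>
    (Metric.isClosed_closedBall.isCompact).exists_isLeast ⟨t, Metric.mem_closedBall_self (hη t).le⟩
  have hmax : ∀ t : σ, ∃ m, IsGreatest (Metric.closedBall t (η t)) m := fun t =>
    (Metric.isClosed_closedBall.isCompact).exists_isGreatest
      ⟨t, Metric.mem_closedBall_self (hη t).le⟩
  choose l hl using hmin
  choose u hu using hmax
  -- Besides the centres, `G` contains the least and greatest points of σ in each closed ball of the
  -- subcover.
  refine ⟨I ∪ I.image l ∪ I.image u, fun a b a' b' hab hab' hG => ?_⟩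
  -- If a point s of σ lies strictly inside, the extreme points of a ball around s cannot separate
  -- the pairs from s, so both pairs stay in that ball. Otherwise the interval is a gap of σ and the
  -- pairs coincide.
  by_cases hs : ∃ s : σ, min a a' < s ∧ s < max b b'
  · right
    obtain ⟨s, hs1, hs2⟩ := hs
    obtain ⟨t, htI, ht⟩ : ∃ t ∈ I, s ∈ Metric.ball t (η t) := by
      simpa using hI (Set.mem_univ s)
    have hst := Metric.ball_subset_closedBall ht
    have h1 := (hl t).2 hst
    have h2 := (hu t).2 hst
    have h3 := abs_le.1 (Metric.mem_closedBall.1 (hl t).1 : |((l t : σ) : ℝ) - t| ≤ η t)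
    have h4 := abs_le.1 (Metric.mem_closedBall.1 (hu t).1 : |((u t : σ) : ℝ) - t| ≤ η t)
    have h5 : l t ≤ a ∧ l t ≤ a' := by
      refine (hG (l t) (by simp only [Finset.mem_union, Finset.mem_image]; grind)).resolve_right ?_
      rintro ⟨h, h'⟩
      exact absurd (hs2.trans_le (max_le h h')) (not_lt.2 h1)
    have h6 : b ≤ u t ∧ b' ≤ u t := by
      refine (hG (u t) (by simp only [Finset.mem_union, Finset.mem_image]; grind)).resolve_left ?_
      rintro ⟨h, h'⟩
      exact absurd ((le_min h h').trans_lt hs1) (not_lt.2 h2)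
    have e1 : ((l t : σ) : ℝ) ≤ a := h5.1
    have e2 : ((l t : σ) : ℝ) ≤ a' := h5.2
    have e3 : (b : ℝ) ≤ u t := h6.1
    have e4 : (b' : ℝ) ≤ u t := h6.2
    exact ⟨t, hG t (by simp [htI]), by linarith, by linarith, by linarith, by linarith⟩
  · left
    push Not at hs
    have ha : ∀ s, min a a' < s → b ≤ s ∧ b' ≤ s := fun s h =>
      ⟨(le_max_left _ _).trans (hs s h), (le_max_right _ _).trans (hs s h)⟩
    have h1 : a ≤ min a a' := not_lt.1 fun h => absurd (ha _ h).1 (not_le.2 hab)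
    have h2 : a' ≤ min a a' := not_lt.1 fun h => absurd (ha _ h).2 (not_le.2 hab')
    have h3 : a = a' := le_antisymm (h1.trans (min_le_right _ _)) (h2.trans (min_le_left _ _))
    subst h3
    rw [min_self] at ha
    refine ⟨rfl, le_antisymm (ha _ hab').1 (ha _ hab).2, fun s => ?_⟩
    rcases le_or_gt s a with h | h
    · exact Or.inl h
    · exact Or.inr (ha s h).1

/-- A function on a finite set extends to a step function with jumps in that set. -/
lemma exists_step_function {α X : Type*} [LinearOrder α] [AddCommGroup X] (G : Finset α)
    (u : α → X) : ∃ c : α → X, ∀ a, ∀ m ∈ G, m ≤ a → (∀ g ∈ G, g ≤ a → g ≤ m) →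
      ∑ g ∈ G with g ≤ a, c g = u m := by
  classical
  induction G using Finset.induction_on_max with
  | empty => exact ⟨0, by simp⟩
  | insert g₀ G hG ih =>
    obtain ⟨c, hc⟩ := ih
    have hg₀ : g₀ ∉ G := fun h => lt_irrefl _ (hG _ h)
    -- The jump at the new largest point corrects the total of all earlier jumps to the prescribed
    -- value.
    refine ⟨Function.update c g₀ (u g₀ - ∑ g ∈ G, c g), fun a m hm hma hmax => ?_⟩
    have hsum : ∀ G' ⊆ G, ∑ g ∈ G', Function.update c g₀ (u g₀ - ∑ g ∈ G, c g) g
        = ∑ g ∈ G', c g := fun G' hG' => Finset.sum_congr rfl fun g hg =>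
      Function.update_of_ne (fun h : g = g₀ => hg₀ (h ▸ hG' hg)) _ _
    rw [Finset.filter_insert]
    rcases Finset.mem_insert.1 hm with rfl | hmG
    · rw [if_pos hma, Finset.sum_insert (by simp [hg₀]), hsum _ (Finset.filter_subset _ _),
        Finset.filter_true_of_mem fun g hg => (hG g hg).le.trans hma]
      simp
    · have hlt : ¬ g₀ ≤ a := fun h =>
        absurd (hmax g₀ (Finset.mem_insert_self _ _) h) (not_le.2 (hG m hmG))
      rw [if_neg hlt, hsum _ (Finset.filter_subset _ _)]
      exact hc a m hmG hma fun g hg => hmax g (Finset.mem_insert_of_mem hg)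

variable {X : Type*} [NormedAddCommGroup X] [NormedSpace ℂ X]
  {Φ : AC σ →ₐ[ℂ] (X →L[ℂ] X)}

/-- The operators of the ramps, applied to `x`, are close to a step function of the position. -/
lemma ACCalculus.exists_step_approx [Nonempty σ] (x : X) {δ : ℝ} (hδ : 0 < δ)
    (hloc : ∀ t : σ, ∃ η > 0, ∀ w ∈ bumps t η 0, ‖Φ w x‖ ≤ δ) :
    ∃ (G : Finset σ) (c : σ → X), ∀ a b : σ, a < b → (∀ g ∈ G, g ≤ a ∨ b ≤ g) →
      ‖Φ (rampAC σ a b) x - ∑ g ∈ G with g ≤ a, c g‖ ≤ δ ∧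
      ‖Φ (rampAC σ a b - rampAC σ a b * rampAC σ a b) x‖ ≤ δ := by
  classical
  choose η hη hw using hloc
  obtain ⟨G₀, hG₀⟩ := exists_finset_cells hη
  have : CompactSpace σ := isCompact_iff_compactSpace.1 σ.isCompact
  obtain ⟨bot, -, hbot⟩ := (isCompact_univ (X := σ)).exists_isLeast Set.univ_nonempty
  -- The least point of σ guarantees that every a has a point of `G` to its left, so that the step
  -- function is determined at a.
  set G := insert bot G₀ with hG
  have hG' : ∀ a b a' b' : σ, a < b → a' < b' →
      (∀ g ∈ G, (g ≤ a ∧ g ≤ a') ∨ (b ≤ g ∧ b' ≤ g)) →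
      ‖Φ (rampAC σ a b) x - Φ (rampAC σ a' b') x‖ ≤ δ ∧
      ‖Φ (rampAC σ a b - rampAC σ a b * rampAC σ a b) x‖ ≤ δ := by
    intro a b a' b' hab hab' hg
    rcases hG₀ a b a' b' hab hab' fun g h => hg g (Finset.mem_insert_of_mem h) with
      ⟨rfl, rfl, hs⟩ | ⟨t, ht, h1, h1', h2, h2'⟩
    · have : rampAC σ a b - rampAC σ a b * rampAC σ a b = 0 := by
        ext s
        change (rampAC σ a b).1.1 s - (rampAC σ a b).1.1 s * (rampAC σ a b).1.1 s = 0
        rw [rampAC_apply]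
        rcases hs s with h | h
        · rw [ramp_eq_one hab h]; simp
        · rw [ramp_eq_zero (le_of_lt hab) h]; simp
      rw [this]
      simpa using hδ.le
    · constructor
      · have := hw t _ (rampAC_sub_mem_bumps hab hab' ht h1 h1' h2 h2')
        rwa [map_sub] at this
      · exact hw t _ (rampAC_sub_sq_mem_bumps hab (ht.imp And.left And.left) h1 h2)
  -- `Q m` holds for the pairs in the cell of `G` starting at m. One ramp per cell serves as the
  -- value of the step function; by `hG'` any other ramp of the cell differs from it by at most δ at
  -- x.
  set Q : σ → σ × σ → Prop := fun m q => q.1 < q.2 ∧ m ≤ q.1 ∧ ∀ g ∈ G, g ≤ m ∨ q.2 ≤ g with hQ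
  set u : σ → X := fun m => if h : ∃ q, Q m q then Φ (rampAC σ h.choose.1 h.choose.2) x else 0
    with hu
  obtain ⟨c, hc⟩ := exists_step_function G u
  refine ⟨G, c, fun a b hab hg => ⟨?_, (hG' a b a b hab hab fun g h => by simpa using hg g h).2⟩⟩
  have hne : (G.filter (· ≤ a)).Nonempty := ⟨bot, by simp [hG, hbot (Set.mem_univ a)]⟩
  set m := (G.filter (· ≤ a)).max' hne with hm
  have hmG : m ∈ G ∧ m ≤ a := Finset.mem_filter.1 (Finset.max'_mem _ hne)
  have hmmax : ∀ g ∈ G, g ≤ a → g ≤ m := fun g h h' => Finset.le_max' _ _ (by simp [h, h'])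
  rw [hc a m hmG.1 hmG.2 hmmax]
  have hex : ∃ q, Q m q := ⟨(a, b), hab, hmG.2, fun g h => (hg g h).imp_left (hmmax g h)⟩
  simp only [hu]
  rw [dif_pos hex]
  obtain ⟨h1, h2, h3⟩ := hex.choose_spec
  refine (hG' a b _ _ hab h1 fun g h => ?_).1
  rcases hg g h with h' | h'
  · exact Or.inl ⟨h', (hmmax g h h').trans h2⟩
  · exact Or.inr ⟨h', (h3 g h).resolve_left fun h'' =>
      absurd (h'.trans (h''.trans hmG.2)) (not_le.2 hab)⟩

end Cells

/-! ### Subdivisions of σ and piecewise affine interpolation. -/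

section Subdivisions

open Filter Topology

/-- A finite subdivision of `σ`, running from its least to its greatest element. -/
structure Subdivision (σ : Compacts ℝ) where
  /-- The points of the subdivision (constant from some point on in spirit). -/
  pt : ℕ → σ
  /-- The number of cells. -/
  n : ℕ
  mono : Monotone pt
  bot_le : ∀ s, pt 0 ≤ s
  le_top : ∀ s, s ≤ pt n

namespace Subdivision

variable {σ : Compacts ℝ}

open Classical in
/-- The set of points of a subdivision. -/
noncomputable def points (P : Subdivision σ) : Finset σ := (Finset.range (P.n + 1)).image P.pt

lemma exists_points_eq [Nonempty σ] (G : Finset σ) : ∃ P : Subdivision σ, G ⊆ P.points := by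
  classical
  have : CompactSpace σ := isCompact_iff_compactSpace.1 σ.isCompact
  obtain ⟨bot, -, hbot⟩ := (isCompact_univ (X := σ)).exists_isLeast Set.univ_nonempty
  obtain ⟨top, -, htop⟩ := (isCompact_univ (X := σ)).exists_isGreatest Set.univ_nonempty
  set G' := insert bot (insert top G) with hG'
  have hcard : 0 < G'.card := Finset.card_pos.2 ⟨bot, by simp [hG']⟩
  set e := G'.orderIsoOfFin rfl
  -- Truncating the index makes the enumeration constant after the last point.
  set t : ℕ → σ := fun i => (e ⟨min i (G'.card - 1), by omega⟩ : G') with ht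
  have hmono : Monotone t := fun i j hij => by
    simp only [ht, Subtype.coe_le_coe, OrderIso.le_iff_le, Fin.mk_le_mk]
    omega
  have hsurj : ∀ g ∈ G', ∃ i ≤ G'.card - 1, t i = g := fun g hg => by
    refine ⟨(e.symm ⟨g, hg⟩ : Fin _), by have := (e.symm ⟨g, hg⟩).2; omega, ?_⟩
    simp only [ht]
    have : (⟨min ((e.symm ⟨g, hg⟩ : Fin _) : ℕ) (G'.card - 1), by omega⟩ : Fin G'.card)
        = e.symm ⟨g, hg⟩ := by
      ext; simp only [inf_eq_left]; have := (e.symm ⟨g, hg⟩).2; omega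
    rw [this, OrderIso.apply_symm_apply]
  refine ⟨⟨t, G'.card - 1, hmono, fun s => ?_, fun s => ?_⟩, fun g hg => ?_⟩
  · obtain ⟨i, -, hi⟩ := hsurj bot (by simp [hG'])
    exact (hmono (Nat.zero_le i)).trans (hi ▸ hbot (Set.mem_univ s))
  · obtain ⟨i, hi', hi⟩ := hsurj top (by simp [hG'])
    exact (htop (Set.mem_univ s)).trans (hi ▸ hmono hi')
  · obtain ⟨i, hi', hi⟩ := hsurj g (by simp [hG', hg])
    exact Finset.mem_image.2 ⟨i, Finset.mem_range.2 (by simpa using Nat.lt_succ_of_le hi'), hi⟩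

variable (σ) in
/-- The filter of fine subdivisions. -/
noncomputable def refinement : Filter (Subdivision σ) := comap points atTop

instance [Nonempty σ] : (refinement σ).NeBot := by
  refine comap_neBot fun s hs => ?_
  obtain ⟨G, hG⟩ := mem_atTop_sets.1 hs
  obtain ⟨P, hP⟩ := exists_points_eq G
  exact ⟨P, hG _ hP⟩

lemma eventually_subset_points (G : Finset σ) : ∀ᶠ P in refinement σ, G ⊆ P.points :=
  (eventually_ge_atTop G).comap points

/-- The increment of `f` over the `i`-th cell. -/
def incr (P : Subdivision σ) (f : σ → ℂ) (i : ℕ) : ℂ := f (P.pt (i + 1)) - f (P.pt i)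

/-- The ramp over the `i`-th cell. -/
noncomputable def cellRamp (P : Subdivision σ) (i : ℕ) : AC σ :=
  rampAC σ (P.pt i) (P.pt (i + 1))

/-- The piecewise affine interpolation of `f` at the points of the subdivision. -/
noncomputable def interp (P : Subdivision σ) : BV σ →ₗ[ℂ] AC σ where
  toFun f := algebraMap ℂ (AC σ) (f.1 (P.pt P.n))
    - ∑ i ∈ Finset.range P.n, P.incr f.1 i • P.cellRamp i
  map_add' f g := by
    have : ∀ i, P.incr (f + g).1 i = P.incr f.1 i + P.incr g.1 i := fun i => by
      change (f.1 _ + g.1 _) - (f.1 _ + g.1 _) = _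
      simp only [incr]; ring
    simp only [this, add_smul, Finset.sum_add_distrib]
    have h2 : (f + g).1 (P.pt P.n) = f.1 (P.pt P.n) + g.1 (P.pt P.n) := rfl
    rw [h2, (algebraMap ℂ (AC σ)).map_add]; abel
  map_smul' c f := by
    have : ∀ i, P.incr (c • f).1 i = c * P.incr f.1 i := fun i => by
      change c * f.1 _ - c * f.1 _ = _
      simp only [incr]; ring
    simp only [this, mul_smul, RingHom.id_apply, smul_sub, Finset.smul_sum]
    have h2 : (c • f).1 (P.pt P.n) = c * f.1 (P.pt P.n) := rfl
    rw [h2, (algebraMap ℂ (AC σ)).map_mul, Algebra.smul_def]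

lemma interp_apply (P : Subdivision σ) (f : BV σ) : P.interp f
    = algebraMap ℂ (AC σ) (f.1 (P.pt P.n))
      - ∑ i ∈ Finset.range P.n, P.incr f.1 i • P.cellRamp i := rfl

lemma interp_one (P : Subdivision σ) : P.interp 1 = 1 := by
  have : ∀ i, P.incr (1 : BV σ).1 i = 0 := fun i => sub_self (1 : ℂ)
  have h2 : (1 : BV σ).1 (P.pt P.n) = 1 := rfl
  rw [interp_apply, h2, Finset.sum_eq_zero fun i _ => by rw [this, zero_smul], sub_zero, map_one]

lemma sum_smul_apply (n : ℕ) (c : ℕ → ℂ) (w : ℕ → AC σ) (s : σ) :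
    (∑ i ∈ Finset.range n, c i • w i).1.1 s = ∑ i ∈ Finset.range n, c i * (w i).1.1 s := by
  induction n with
  | zero => simp
  | succ n ih =>
    rw [Finset.sum_range_succ, Finset.sum_range_succ, ← ih]; rfl

lemma interp_val (P : Subdivision σ) (f : BV σ) (s : σ) : (P.interp f).1.1 s
    = f.1 (P.pt P.n) - ∑ i ∈ Finset.range P.n,
        P.incr f.1 i * (ramp (P.pt i) (P.pt (i + 1)) s : ℂ) := by
  rw [interp_apply]
  have h1 := sum_smul_apply P.n (P.incr f.1) P.cellRamp s
  simp only [cellRamp, rampAC_apply] at h1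
  rw [← h1]
  rfl

/-- The increment of t ↦ t cancels the denominator of the ramp, and the numerators telescope.
Together with `ACCalculus.algHom_eq_of_ident_eq` this is what makes the limit calculus extend the
original one. -/
lemma interp_ident (P : Subdivision σ) : P.interp (AC.ident σ).1 = AC.ident σ := by
  ext s
  rw [interp_val]
  have hid : ∀ t : σ, (AC.ident σ).1.1 t = ((t : ℝ) : ℂ) := fun t => by simp [AC.ident, polyBV]
  have h : ∀ i, P.incr (AC.ident σ).1.1 i * (ramp (P.pt i) (P.pt (i + 1)) s : ℂ)
      = (max ((P.pt (i + 1) : ℝ) - s) 0 : ℝ) - (max ((P.pt i : ℝ) - s) 0 : ℝ) := by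
    intro i
    rw [incr, hid, hid, ramp]
    -- Points may repeat; the ramp of a degenerate cell is 0, its denominator having inverse 0, and
    -- the increment vanishes as well.
    by_cases h : (P.pt (i + 1) : ℝ) = P.pt i
    · rw [h]; simp
    · have h' : (P.pt (i + 1) : ℝ) - P.pt i ≠ 0 := sub_ne_zero.2 h
      have h'' : ((P.pt (i + 1) : ℝ) : ℂ) - ((P.pt i : ℝ) : ℂ) ≠ 0 := by exact_mod_cast h'
      push_cast
      field_simp
  have h0 : (P.pt 0 : ℝ) ≤ s := P.bot_le s
  have h1 : (s : ℝ) ≤ P.pt P.n := P.le_top s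
  rw [Finset.sum_congr rfl fun i _ => h i,
    Finset.sum_range_sub (fun i => ((max ((P.pt i : ℝ) - s) 0 : ℝ) : ℂ)), hid, hid,
    max_eq_left (a := (P.pt P.n : ℝ) - s) (by linarith),
    max_eq_right (a := (P.pt 0 : ℝ) - s) (by linarith)]
  push_cast
  ring

/-- The factor is 1 + 3: one for the constant term, three for each ramp weighted by the increments
of f. -/
lemma bvNorm_interp_le (P : Subdivision σ) (f : BV σ) :
    bvNorm (P.interp f).1.1 ≤ 4 * bvNorm f.1 := by
  rw [interp_apply]
  have hsum : ∀ n, bvNorm (∑ i ∈ Finset.range n, P.incr f.1 i • P.cellRamp i : AC σ).1.1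
      ≤ 3 * ∑ i ∈ Finset.range n, ‖P.incr f.1 i‖ := by
    intro n
    induction n with
    | zero => simpa using bvNorm_zero.le
    | succ n ih =>
      rw [Finset.sum_range_succ, Finset.sum_range_succ]
      have h1 := bvNorm_add_le (∑ i ∈ Finset.range n, P.incr f.1 i • P.cellRamp i : AC σ).1.2
        (P.incr f.1 n • P.cellRamp n : AC σ).1.2
      have h2 := bvNorm_smul_le (P.incr f.1 n) (P.cellRamp n).1.2
      have h3 : bvNorm (P.cellRamp n).1.1 ≤ 3 := bvNorm_rampAC_le (P.mono n.le_succ)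
      have h4 : ‖P.incr f.1 n‖ * bvNorm (P.cellRamp n).1.1 ≤ ‖P.incr f.1 n‖ * 3 := by gcongr
      refine h1.trans ?_
      change _ + bvNorm (P.incr f.1 n • (P.cellRamp n).1.1) ≤ _
      linarith
  have h1 := AC.bvNorm_sub_le (algebraMap ℂ (AC σ) (f.1 (P.pt P.n)))
    (∑ i ∈ Finset.range P.n, P.incr f.1 i • P.cellRamp i)
  have h2 := bvNorm_algebraMap_le (σ := σ) (f.1 (P.pt P.n))
  have h3 := norm_le_bvNorm f.2 (P.pt P.n)
  have h4 := sum_norm_sub_le_bvNorm f.2 P.mono P.n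
  have h5 := hsum P.n
  simp only [incr] at h5
  simp only [incr] at h1 ⊢
  linarith

/-- The defect of multiplicativity lives inside single cells, where it is a multiple of e - e² for
the ramp e of that cell; terms mixing two cells cancel. The proof is a discrete product rule for the
partial interpolants. -/
lemma interp_mul_sub (P : Subdivision σ) (f g : BV σ) :
    P.interp f * P.interp g - P.interp (f * g) = - ∑ i ∈ Finset.range P.n,
      (P.incr f.1 i * P.incr g.1 i) • (P.cellRamp i - P.cellRamp i * P.cellRamp i) := by
  ext s
  have h1 := sum_smul_apply P.n (fun i => P.incr f.1 i * P.incr g.1 i)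
    (fun i => P.cellRamp i - P.cellRamp i * P.cellRamp i) s
  change (P.interp f).1.1 s * (P.interp g).1.1 s - (P.interp (f * g)).1.1 s
    = - (∑ i ∈ Finset.range P.n,
      (P.incr f.1 i * P.incr g.1 i) • (P.cellRamp i - P.cellRamp i * P.cellRamp i)).1.1 s
  rw [h1]
  set e : ℕ → ℂ := fun i => (ramp (P.pt i) (P.pt (i + 1)) s : ℂ) with he
  have h2 : ∀ i, (P.cellRamp i - P.cellRamp i * P.cellRamp i).1.1 s = e i - e i * e i := by
    intro i
    simp only [he]
    rw [← rampAC_apply]; rfl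
  simp only [h2, interp_val]
  set L : BV σ → ℕ → ℂ := fun f n => f.1 (P.pt n) - ∑ i ∈ Finset.range n, P.incr f.1 i * e i
    with hL
  have hsucc : ∀ f n, L f (n + 1) = L f n + P.incr f.1 n * (1 - e n) := fun f n => by
    simp only [hL, Finset.sum_range_succ, incr]; ring
  have hconst : ∀ f n, P.pt n ≤ s → L f n = f.1 (P.pt n) := fun f n hn => by
    simp only [hL]
    rw [Finset.sum_eq_zero, sub_zero]
    intro i hi
    have h : P.pt (i + 1) ≤ s := (P.mono (Finset.mem_range.1 hi)).trans hn
    simp only [he]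
    rw [ramp_eq_zero (P.mono i.le_succ) h]
    simp
  -- To the left of the cell 1 - e vanishes; to the right of its first point the earlier ramps
  -- vanish and the partial interpolant takes the value of g there. Degenerate cells have zero
  -- increment.
  have hkey : ∀ (f g : BV σ) n, P.incr f.1 n * ((1 - e n) * (L g n - g.1 (P.pt n))) = 0 := by
    intro f g n
    rcases (P.mono n.le_succ).eq_or_lt with h | h
    · simp only [incr]
      rw [← h]; simp
    · rcases le_total s (P.pt n) with h' | h'
      · simp only [he]
        rw [ramp_eq_one h h']; simp
      · rw [hconst g n h']; simp
  have hmain : ∀ n, L f n * L g n - L (f * g) n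
      = -∑ i ∈ Finset.range n, P.incr f.1 i * P.incr g.1 i * (e i - e i * e i) := by
    intro n
    induction n with
    | zero =>
      simp only [hL, Finset.range_zero, Finset.sum_empty, sub_zero, neg_zero]
      exact sub_self _
    | succ n ih =>
      rw [Finset.sum_range_succ, neg_add, ← ih, hsucc, hsucc, hsucc]
      have h3 : P.incr (f * g).1 n = P.incr f.1 n * g.1 (P.pt n) + f.1 (P.pt n) * P.incr g.1 n
          + P.incr f.1 n * P.incr g.1 n := by
        change f.1 _ * g.1 _ - f.1 _ * g.1 _ = _
        simp only [incr]; ring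
      rw [h3]
      linear_combination hkey f g n + hkey g f n
  exact hmain P.n

/-- Abel summation against a step function with jumps in the subdivision. -/
lemma sum_incr_smul_step {X : Type*} [AddCommGroup X] [Module ℂ X] (P : Subdivision σ)
    (f : σ → ℂ) {G : Finset σ} (hG : G ⊆ P.points) (c : σ → X) :
    ∑ i ∈ Finset.range P.n, P.incr f i • ∑ g ∈ G with g ≤ P.pt i, c g
      = ∑ g ∈ G, (f (P.pt P.n) - f g) • c g := by
  classical
  have h1 : ∀ i, P.incr f i • ∑ g ∈ G with g ≤ P.pt i, c g
      = ∑ g ∈ G, (if g ≤ P.pt i then P.incr f i else 0) • c g := fun i => by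
    rw [Finset.smul_sum, Finset.sum_filter]
    refine Finset.sum_congr rfl fun g _ => ?_
    split_ifs <;> simp
  rw [Finset.sum_congr rfl fun i _ => h1 i, Finset.sum_comm]
  refine Finset.sum_congr rfl fun g hg => ?_
  rw [← Finset.sum_smul]
  congr 1
  obtain ⟨k, hk, rfl⟩ := Finset.mem_image.1 (hG hg)
  have hk : k ≤ P.n := Nat.lt_succ_iff.1 (Finset.mem_range.1 hk)
  -- The maximum with k switches off the indices below k, so that the sum telescopes. An index i < k
  -- with pt i = pt k gives a zero increment, because all points from i to k coincide.
  have h2 : ∀ i, (if P.pt k ≤ P.pt i then P.incr f i else 0)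
      = f (P.pt (max k (i + 1))) - f (P.pt (max k i)) := fun i => by
    simp only [incr]
    rcases le_or_gt k i with h | h
    · rw [if_pos (P.mono h), max_eq_right h, max_eq_right (h.trans i.le_succ)]
    · rw [max_eq_left h.le, max_eq_left (Nat.succ_le_of_lt h), sub_self]
      split_ifs with h'
      · have h3 : P.pt i = P.pt k := le_antisymm (P.mono h.le) h'
        have h4 : P.pt (i + 1) = P.pt k :=
          le_antisymm (P.mono (Nat.succ_le_of_lt h)) (h3 ▸ P.mono i.le_succ)
        rw [h3, h4, sub_self]
      · rfl
  rw [Finset.sum_congr rfl fun i _ => h2 i, Finset.sum_range_sub (fun i => f (P.pt (max k i))),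
    max_eq_right hk, max_eq_left (Nat.zero_le k)]

lemma le_or_le_of_mem_points (P : Subdivision σ) {g : σ} (hg : g ∈ P.points) (i : ℕ) :
    g ≤ P.pt i ∨ P.pt (i + 1) ≤ g := by
  classical
  obtain ⟨k, -, rfl⟩ := Finset.mem_image.1 hg
  exact (le_or_gt k i).imp (fun h => P.mono h) fun h => P.mono h

end Subdivision

end Subdivisions

/-! ### Extension of the calculus from AC(σ) to BV(σ). -/

section BVCalculus

open Filter Topology

variable {σ : Compacts ℝ} {X : Type*} [NormedAddCommGroup X] [NormedSpace ℂ X]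
  {Φ : AC σ →ₐ[ℂ] (X →L[ℂ] X)} {M : ℝ}

lemma Subdivision.map_sum_apply (n : ℕ) (c : ℕ → ℂ) (w : ℕ → AC σ) (x : X) :
    Φ (∑ i ∈ Finset.range n, c i • w i) x = ∑ i ∈ Finset.range n, c i • Φ (w i) x := by
  induction n with
  | zero => simp
  | succ n ih => rw [Finset.sum_range_succ, map_add, map_smul, Finset.sum_range_succ, ← ih]; rfl

/-- Replacing each Φ(ramp)x by the step function costs at most δ times the variation of f, and Abel
summation evaluates the replaced sum as a vector independent of the subdivision. The product defect
is estimated through `interp_mul_sub`, with each increment of g at most 2‖g‖. -/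
lemma Subdivision.exists_eventually_norm_le [Nonempty σ] (x : X) {δ : ℝ} (hδ : 0 < δ)
    (hloc : ∀ t : σ, ∃ η > 0, ∀ w ∈ bumps t η 0, ‖Φ w x‖ ≤ δ) (f : BV σ) :
    (∃ y, ∀ᶠ P in refinement σ, ‖Φ (P.interp f) x - y‖ ≤ δ * bvNorm f.1) ∧
    ∀ g : BV σ, ∀ᶠ P in refinement σ,
      ‖Φ (P.interp f * P.interp g - P.interp (f * g)) x‖ ≤ δ * (bvNorm f.1 * (2 * bvNorm g.1)) := by
  obtain ⟨G, c, hG⟩ := ACCalculus.exists_step_approx x hδ hloc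
  have : CompactSpace σ := isCompact_iff_compactSpace.1 σ.isCompact
  obtain ⟨top, -, htop⟩ := (isCompact_univ (X := σ)).exists_isGreatest Set.univ_nonempty
  have hcell : ∀ P : Subdivision σ, G ⊆ P.points → ∀ i, P.pt i < P.pt (i + 1) →
      ‖Φ (P.cellRamp i) x - ∑ g ∈ G with g ≤ P.pt i, c g‖ ≤ δ ∧
      ‖Φ (P.cellRamp i - P.cellRamp i * P.cellRamp i) x‖ ≤ δ := fun P hP i hi =>
    hG _ _ hi fun g hg => P.le_or_le_of_mem_points (hP hg) i
  refine ⟨⟨f.1 top • x - ∑ g ∈ G, (f.1 top - f.1 g) • c g, ?_⟩, fun g => ?_⟩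
  · filter_upwards [eventually_subset_points G] with P hP
    have hn : P.pt P.n = top := le_antisymm (htop (Set.mem_univ _)) (P.le_top _)
    have e : Φ (P.interp f) x - (f.1 top • x - ∑ g ∈ G, (f.1 top - f.1 g) • c g)
        = -∑ i ∈ Finset.range P.n,
          P.incr f.1 i • (Φ (P.cellRamp i) x - ∑ g ∈ G with g ≤ P.pt i, c g) := by
      have h1 := P.sum_incr_smul_step f.1 hP c
      rw [hn] at h1
      have h2 : Φ (algebraMap ℂ (AC σ) (f.1 top)) x = f.1 top • x := by
        rw [AlgHom.commutes]; simp [Algebra.algebraMap_eq_smul_one]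
      rw [P.interp_apply, map_sub, hn, sub_apply, h2, map_sum_apply, ← h1]
      simp only [smul_sub, Finset.sum_sub_distrib]
      abel
    rw [e, norm_neg]
    refine (norm_sum_le _ _).trans ?_
    calc _ ≤ ∑ i ∈ Finset.range P.n, ‖P.incr f.1 i‖ * δ := by
          refine Finset.sum_le_sum fun i _ => ?_
          rw [norm_smul]
          rcases (P.mono i.le_succ).eq_or_lt with h | h
          · have : P.incr f.1 i = 0 := by simp only [incr]; rw [← h, sub_self]
            rw [this]; simp
          · exact mul_le_mul_of_nonneg_left (hcell P hP i h).1 (norm_nonneg _)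
      _ ≤ _ := by
          rw [← Finset.sum_mul, mul_comm]
          exact mul_le_mul_of_nonneg_left (sum_norm_sub_le_bvNorm f.2 P.mono P.n) hδ.le
  · filter_upwards [eventually_subset_points G] with P hP
    rw [P.interp_mul_sub, map_neg, neg_apply, norm_neg, map_sum_apply]
    refine (norm_sum_le _ _).trans ?_
    calc _ ≤ ∑ i ∈ Finset.range P.n, ‖P.incr f.1 i‖ * (2 * bvNorm g.1 * δ) := by
          refine Finset.sum_le_sum fun i _ => ?_
          rw [norm_smul, norm_mul, mul_assoc]
          refine mul_le_mul_of_nonneg_left ?_ (norm_nonneg _)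
          rcases (P.mono i.le_succ).eq_or_lt with h | h
          · have h1 : P.incr g.1 i = 0 := by simp only [incr]; rw [← h, sub_self]
            have h2 : 0 ≤ bvNorm g.1 := bvNorm_nonneg
            rw [h1, norm_zero, zero_mul]; positivity
          · have h1 : ‖P.incr g.1 i‖ ≤ 2 * bvNorm g.1 := by
              refine (norm_sub_le _ _).trans ?_
              have := norm_le_bvNorm g.2 (P.pt (i + 1))
              have := norm_le_bvNorm g.2 (P.pt i)
              linarith
            exact mul_le_mul h1 (hcell P hP i h).2 (norm_nonneg _) ((norm_nonneg _).trans h1)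
      _ ≤ _ := by
          rw [← Finset.sum_mul]
          have h1 := sum_norm_sub_le_bvNorm f.2 P.mono P.n
          have h2 : 0 ≤ bvNorm g.1 := bvNorm_nonneg
          calc _ ≤ bvNorm f.1 * (2 * bvNorm g.1 * δ) := mul_le_mul_of_nonneg_right h1 (by positivity)
            _ = _ := by ring

/-- Polynomials are dense in AC(σ), and on them both homomorphisms are given by the common operator.
-/
lemma ACCalculus.algHom_eq_of_ident_eq {Φ' : AC σ →ₐ[ℂ] (X →L[ℂ] X)} {M' : ℝ}
    (hΦ : ∀ f : AC σ, ‖Φ f‖ ≤ M * bvNorm f.1.1) (hΦ' : ∀ f : AC σ, ‖Φ' f‖ ≤ M' * bvNorm f.1.1)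
    (h : Φ (AC.ident σ) = Φ' (AC.ident σ)) : Φ = Φ' := by
  ext1 f
  refine sub_eq_zero.1 (norm_le_zero_iff.1 (le_of_forall_pos_le_add fun ε hε => ?_))
  obtain ⟨p, hp⟩ := f.2 (ε / (|M| + |M'| + 1)) (by positivity)
  rw [lt_div_iff₀ (by positivity)] at hp
  have hpoly : Φ (polyAC σ p) = Φ' (polyAC σ p) := by
    rw [polyAC_eq_aeval, ← Polynomial.aeval_algHom_apply, ← Polynomial.aeval_algHom_apply, h]
  have e : Φ f - Φ' f = Φ (f - polyAC σ p) - Φ' (f - polyAC σ p) := by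
    rw [map_sub, map_sub, hpoly]; abel
  rw [e]
  have h1 := hΦ (f - polyAC σ p)
  have h2 := hΦ' (f - polyAC σ p)
  have h3 : bvNorm (f - polyAC σ p).1.1 * (|M| + |M'| + 1) < ε := hp
  have h4 : 0 ≤ bvNorm (f - polyAC σ p).1.1 := bvNorm_nonneg
  have h5 := mul_le_mul_of_nonneg_right (le_abs_self M) h4
  have h6 := mul_le_mul_of_nonneg_right (le_abs_self M') h4
  have h7 := norm_sub_le (Φ (f - polyAC σ p)) (Φ' (f - polyAC σ p))
  nlinarith

/-- In a space with a Clarkson inequality, every bounded `AC(σ)` functional calculus extends to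
`BV(σ)`, with values in the strong closure of the original calculus. -/
theorem ACCalculus.exists_BV_extension [CompleteSpace X] {p : ℕ} (hX : IsClarkson X p)
    (hM : 0 ≤ M) (hΦ : ∀ f : AC σ, ‖Φ f‖ ≤ M * bvNorm f.1.1) :
    ∃ Ψ : BV σ →ₐ[ℂ] (X →L[ℂ] X), (∀ f : AC σ, Ψ f.1 = Φ f) ∧
      ∀ f x, Ψ f x ∈ closure ((fun g => Φ g x) '' {g | bvNorm g.1.1 ≤ 4 * bvNorm f.1}) := by
  classical
  rcases isEmpty_or_nonempty σ with hσ | hσ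
  · have hAC : ∀ f : BV σ, f ∈ AC σ := fun f => by
      have : f = 0 := by ext t; exact hσ.elim t
      rw [this]; exact (AC σ).zero_mem
    refine ⟨Φ.comp ((AlgHom.id ℂ (BV σ)).codRestrict (AC σ) hAC), fun f => rfl, fun f x =>
      subset_closure ⟨⟨f, hAC f⟩, ?_, rfl⟩⟩
    have : 0 ≤ bvNorm f.1 := bvNorm_nonneg
    change bvNorm f.1 ≤ 4 * bvNorm f.1
    linarith
  have hM4 : ∀ (P : Subdivision σ) (f : BV σ) (x : X),
      ‖Φ (P.interp f) x‖ ≤ M * (4 * bvNorm f.1) * ‖x‖ := fun P f x =>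
    (ACCalculus.norm_apply_le hΦ _ x).trans (by gcongr; exact P.bvNorm_interp_le f)
  have hloc := fun (x : X) {δ : ℝ} (hδ : 0 < δ) (t : σ) =>
    ACCalculus.exists_forall_bumps_le hX hM hΦ t x hδ
  have hlim : ∀ (f : BV σ) (x : X), ∃ y,
      Tendsto (fun P : Subdivision σ => Φ (P.interp f) x) (Subdivision.refinement σ) (𝓝 y) := by
    intro f x
    refine CompleteSpace.complete (Metric.cauchy_iff.2 ⟨inferInstance, fun ε hε => ?_⟩)
    have hb : 0 ≤ bvNorm f.1 := bvNorm_nonneg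
    have hδ : 0 < ε / (2 * bvNorm f.1 + 1) := by positivity
    obtain ⟨⟨y, hy⟩, -⟩ := Subdivision.exists_eventually_norm_le x hδ (hloc x hδ) f
    refine ⟨_, image_mem_map hy, ?_⟩
    rintro _ ⟨P, hP, rfl⟩ _ ⟨Q, hQ, rfl⟩
    refine (dist_triangle_right _ _ y).trans_lt ?_
    rw [dist_eq_norm, dist_eq_norm]
    refine (add_le_add hP hQ).trans_lt ?_
    rw [← two_mul, div_mul_eq_mul_div, mul_div_assoc', div_lt_iff₀ (by positivity)]
    nlinarith
  choose ψ hψ using hlim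
  have hψadd : ∀ f x y, ψ f (x + y) = ψ f x + ψ f y := fun f x y =>
    tendsto_nhds_unique (hψ f (x + y)) (by simpa using (hψ f x).add (hψ f y))
  have hψsmul : ∀ f (c : ℂ) x, ψ f (c • x) = c • ψ f x := fun f c x =>
    tendsto_nhds_unique (hψ f (c • x)) (by simpa using (hψ f x).const_smul c)
  have hψle : ∀ f x, ‖ψ f x‖ ≤ M * (4 * bvNorm f.1) * ‖x‖ := fun f x =>
    le_of_tendsto' (hψ f x).norm fun P => hM4 P f x
  set Ψ : BV σ → (X →L[ℂ] X) := fun f =>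
    LinearMap.mkContinuous ⟨⟨ψ f, hψadd f⟩, hψsmul f⟩ (M * (4 * bvNorm f.1)) (hψle f) with hΨ
  have hΨapp : ∀ f x, Ψ f x = ψ f x := fun f x => rfl
  have hΨone : Ψ 1 = 1 := by
    ext x
    refine tendsto_nhds_unique (hψ 1 x) ?_
    simp [Subdivision.interp_one]
  have hΨmul : ∀ f g, Ψ (f * g) = Ψ f * Ψ g := by
    intro f g
    ext x
    have h1 : Tendsto (fun P : Subdivision σ => Φ (P.interp f * P.interp g - P.interp (f * g)) x)
        (Subdivision.refinement σ) (𝓝 0) := by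
      rw [Metric.tendsto_nhds]
      intro ε hε
      have hb : 0 ≤ bvNorm f.1 := bvNorm_nonneg
      have hb' : 0 ≤ bvNorm g.1 := bvNorm_nonneg
      have hδ : 0 < ε / (bvNorm f.1 * (2 * bvNorm g.1) + 1) := by positivity
      filter_upwards [(Subdivision.exists_eventually_norm_le x hδ (hloc x hδ) f).2 g] with P hP
      rw [dist_zero_right]
      refine hP.trans_lt ?_
      rw [div_mul_eq_mul_div, div_lt_iff₀ (by positivity)]
      nlinarith
    -- Strong limits multiply here because the operators Φ(interp f) are uniformly bounded.
    have h2 : Tendsto (fun P : Subdivision σ => Φ (P.interp f) (Φ (P.interp g) x))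
        (Subdivision.refinement σ) (𝓝 (ψ f (ψ g x))) := by
      have h3 : Tendsto (fun P : Subdivision σ => Φ (P.interp f) (Φ (P.interp g) x - ψ g x))
          (Subdivision.refinement σ) (𝓝 0) := by
        have h4 : Tendsto (fun P : Subdivision σ =>
            M * (4 * bvNorm f.1) * ‖Φ (P.interp g) x - ψ g x‖)
            (Subdivision.refinement σ) (𝓝 0) := by
          have := ((hψ g x).sub_const (ψ g x)).norm.const_mul (M * (4 * bvNorm f.1))
          simpa using this
        exact squeeze_zero_norm (fun P => hM4 P f _) h4
      simpa using h3.add (hψ f (ψ g x))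
    have h5 := h2.sub h1
    rw [sub_zero] at h5
    refine tendsto_nhds_unique (hψ (f * g) x) (h5.congr fun P => ?_)
    rw [map_sub, map_mul, sub_apply, mul_apply_eq_comp]
    abel
  have hΨadd : ∀ f g, Ψ (f + g) = Ψ f + Ψ g := fun f g => by
    ext x
    exact tendsto_nhds_unique (hψ (f + g) x) (by simpa [hΨapp] using (hψ f x).add (hψ g x))
  have hΨsm : ∀ (c : ℂ) f, Ψ (c • f) = c • Ψ f := fun c f => by
    ext x
    exact tendsto_nhds_unique (hψ (c • f) x) (by simpa [hΨapp] using (hψ f x).const_smul c)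
  set Ψ' : BV σ →ₐ[ℂ] (X →L[ℂ] X) :=
    AlgHom.ofLinearMap ⟨⟨Ψ, hΨadd⟩, hΨsm⟩ hΨone hΨmul with hΨ'
  have hΨn : ∀ f, ‖Ψ' f‖ ≤ 4 * M * bvNorm f.1 := fun f => by
    have hb : 0 ≤ bvNorm f.1 := bvNorm_nonneg
    have h : ‖Ψ f‖ ≤ M * (4 * bvNorm f.1) := LinearMap.mkContinuous_norm_le _ (by positivity) _
    refine (show ‖Ψ' f‖ ≤ M * (4 * bvNorm f.1) from h).trans_eq ?_
    ring
  refine ⟨Ψ', fun f => ?_, fun f x => ?_⟩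
  · have h := ACCalculus.algHom_eq_of_ident_eq (Φ := Ψ'.comp (AC σ).val) (Φ' := Φ)
      (M := 4 * M) (M' := M) (fun f => hΨn f.1) hΦ (by
        ext x
        refine tendsto_nhds_unique (hψ _ x) ?_
        simp [Subdivision.interp_ident])
    exact congrArg (fun Φ : AC σ →ₐ[ℂ] (X →L[ℂ] X) => Φ f) h
  · exact mem_closure_of_tendsto (hψ f x)
      (Eventually.of_forall fun P => ⟨_, P.bvNorm_interp_le f, rfl⟩)

end BVCalculus

/-! ### Clarkson's inequality and a Taylor estimate for even powers. -/

section Clarkson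

open Filter Topology ComplexConjugate

/-- The parallelogram law between two inequalities for the power k + 1 of nonnegative numbers:
superadditivity on the left, convexity on the right. -/
lemma clarkson_complex (k : ℕ) (a b : ℂ) :
    ‖a + b‖ ^ (2 * (k + 1)) + ‖a - b‖ ^ (2 * (k + 1))
      ≤ 2 ^ (2 * (k + 1)) * ((‖a‖ ^ (2 * (k + 1)) + ‖b‖ ^ (2 * (k + 1))) / 2) := by
  have hpar : ‖a + b‖ ^ 2 + ‖a - b‖ ^ 2 = 2 * (‖a‖ ^ 2 + ‖b‖ ^ 2) := by
    have := parallelogram_law_with_norm ℂ a b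
    nlinarith
  simp only [pow_mul]
  have h1 := pow_add_pow_le (x := ‖a + b‖ ^ 2) (y := ‖a - b‖ ^ 2) (by positivity) (by positivity)
    k.add_one_ne_zero
  have h2 := add_pow_le (a := ‖a‖ ^ 2) (b := ‖b‖ ^ 2) (by positivity) (by positivity) (k + 1)
  rw [hpar, mul_pow] at h1
  simp only [Nat.add_sub_cancel] at h2
  refine h1.trans ((mul_le_mul_of_nonneg_left h2 (by positivity)).trans_eq ?_)
  have : (2 : ℝ) ^ 2 = 2 * 2 := by norm_num
  rw [this, mul_pow]
  ring

/-- Raising the exponent multiplies the remainder by A + B, at most 2m in size, and adds (k+1)A^k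
B²; hence the recursion C ↦ 2C + (k+1). -/
lemma exists_taylor_bound (k : ℕ) : ∃ C : ℝ, 0 ≤ C ∧ ∀ A B m s : ℝ, 0 ≤ A → A ≤ m → |s| ≤ 1 →
    |B| ≤ |s| * m →
    |(A + B) ^ (k + 1) - A ^ (k + 1) - (k + 1) * A ^ k * B| ≤ C * s ^ 2 * m ^ (k + 1) := by
  induction k with
  | zero => exact ⟨0, le_rfl, fun A B m s _ _ _ _ => by simp⟩
  | succ k ih =>
    obtain ⟨C, hC0, hC⟩ := ih
    refine ⟨2 * C + (k + 1), by positivity, fun A B m s hA hAm hs hB => ?_⟩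
    have hm : 0 ≤ m := hA.trans hAm
    have h := hC A B m s hA hAm hs hB
    have e : (A + B) ^ (k + 1 + 1) - A ^ (k + 1 + 1) - ((k + 1 : ℕ) + 1) * A ^ (k + 1) * B
        = (A + B) * ((A + B) ^ (k + 1) - A ^ (k + 1) - (k + 1) * A ^ k * B)
          + (k + 1) * (A ^ k * B ^ 2) := by
      push_cast; ring
    rw [e]
    have hB1 : |B| ≤ m := hB.trans (by nlinarith [abs_nonneg s])
    have hAB : |A + B| ≤ 2 * m := by
      have := abs_add_le A B
      rw [abs_of_nonneg hA] at this
      linarith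
    have hB2 : B ^ 2 ≤ s ^ 2 * m ^ 2 := by
      rw [← sq_abs B, ← sq_abs s, ← mul_pow]
      exact pow_le_pow_left₀ (abs_nonneg _) hB 2
    have hAk : A ^ k ≤ m ^ k := pow_le_pow_left₀ hA hAm k
    refine (abs_add_le _ _).trans ?_
    rw [abs_mul, abs_of_nonneg (show (0 : ℝ) ≤ (k + 1) * (A ^ k * B ^ 2) by positivity)]
    have h1 : |A + B| * |(A + B) ^ (k + 1) - A ^ (k + 1) - (k + 1) * A ^ k * B|
        ≤ 2 * m * (C * s ^ 2 * m ^ (k + 1)) := mul_le_mul hAB h (abs_nonneg _) (by positivity)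
    have h2 : A ^ k * B ^ 2 ≤ m ^ k * (s ^ 2 * m ^ 2) :=
      mul_le_mul hAk hB2 (by positivity) (by positivity)
    have h3 : (k + 1 : ℝ) * (A ^ k * B ^ 2) ≤ (k + 1) * (m ^ k * (s ^ 2 * m ^ 2)) :=
      mul_le_mul_of_nonneg_left h2 (by positivity)
    refine (add_le_add h1 h3).trans_eq ?_
    ring

/-- First order Taylor estimate for `‖·‖ ^ (2 (k + 1))` on `ℂ`. -/
lemma exists_norm_pow_taylor (k : ℕ) : ∃ C : ℝ, 0 ≤ C ∧ ∀ (a b : ℂ) (s : ℝ), |s| ≤ 1 →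
    ‖a + s * b‖ ^ (2 * (k + 1)) ≤ ‖a‖ ^ (2 * (k + 1))
      + s * ((2 * (k + 1) : ℝ) * ‖a‖ ^ (2 * k) * (conj a * b).re)
      + s ^ 2 * (C * (‖a‖ + ‖b‖) ^ (2 * (k + 1))) := by
  obtain ⟨C, hC0, hC⟩ := exists_taylor_bound k
  refine ⟨C + (k + 1), by positivity, fun a b s hs => ?_⟩
  set R := (conj a * b).re with hR
  have hRle : |R| ≤ ‖a‖ * ‖b‖ := by
    refine (Complex.abs_re_le_norm _).trans_eq ?_
    rw [norm_mul, Complex.norm_conj]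
  have hsq : ‖a + s * b‖ ^ 2 = ‖a‖ ^ 2 + (2 * s * R + s ^ 2 * ‖b‖ ^ 2) := by
    simp only [← Complex.normSq_eq_norm_sq, Complex.normSq_apply, hR, Complex.add_re,
      Complex.add_im, Complex.mul_re, Complex.mul_im, Complex.ofReal_re, Complex.ofReal_im,
      Complex.conj_re, Complex.conj_im]
    ring
  have hs2 : s ^ 2 ≤ |s| := by rw [← sq_abs]; nlinarith [abs_nonneg s]
  have hB : |2 * s * R + s ^ 2 * ‖b‖ ^ 2| ≤ |s| * (‖a‖ + ‖b‖) ^ 2 := by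
    refine (abs_add_le _ _).trans ?_
    rw [abs_mul, abs_mul, abs_two, abs_of_nonneg (by positivity : 0 ≤ s ^ 2 * ‖b‖ ^ 2)]
    have h1 : 2 * |s| * |R| ≤ 2 * |s| * (‖a‖ * ‖b‖) := by gcongr
    have h2 : s ^ 2 * ‖b‖ ^ 2 ≤ |s| * ‖b‖ ^ 2 := by gcongr
    nlinarith [mul_nonneg (abs_nonneg s) (sq_nonneg ‖a‖)]
  -- ‖a + sb‖² is treated as a perturbation of ‖a‖². Its own second order part s²‖b‖² accounts for
  -- the extra k + 1 in the constant.
  have h := hC (‖a‖ ^ 2) _ ((‖a‖ + ‖b‖) ^ 2) s (by positivity)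
    (pow_le_pow_left₀ (norm_nonneg _) (le_add_of_nonneg_right (norm_nonneg _)) 2) hs hB
  rw [← hsq] at h
  have h' := (abs_le.1 h).2
  have hlast : ‖a‖ ^ (2 * k) * ‖b‖ ^ 2 ≤ (‖a‖ + ‖b‖) ^ (2 * (k + 1)) := by
    have e : (‖a‖ + ‖b‖) ^ (2 * (k + 1)) = (‖a‖ + ‖b‖) ^ (2 * k) * (‖a‖ + ‖b‖) ^ 2 := by ring
    rw [e]
    gcongr <;> linarith [norm_nonneg a, norm_nonneg b]
  have h4 : (k + 1 : ℝ) * s ^ 2 * (‖a‖ ^ (2 * k) * ‖b‖ ^ 2)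
      ≤ (k + 1 : ℝ) * s ^ 2 * (‖a‖ + ‖b‖) ^ (2 * (k + 1)) := by gcongr
  simp only [← pow_mul] at h'
  linear_combination h' + h4

end Clarkson

/-! ### Riesz representation on L^p for even p. -/

section LpEven

open Filter Topology ComplexConjugate

variable {Ω : Type*} [MeasurableSpace Ω] {μ : Measure Ω}

lemma Lp.norm_pow_natCast_eq {n : ℕ} [Fact (1 ≤ (n : ℝ≥0∞))] (x : Lp ℂ n μ) :
    ‖x‖ ^ n = ∫ ω, ‖x ω‖ ^ n ∂μ := by
  have hn : n ≠ 0 := by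
    rintro rfl
    have := Fact.out (p := (1 ≤ ((0 : ℕ) : ℝ≥0∞)))
    simp at this
  have hn' : (n : ℝ≥0∞) ≠ 0 := by exact_mod_cast hn
  rw [Lp.norm_def, (Lp.memLp x).eLpNorm_eq_integral_rpow_norm hn' (ENNReal.natCast_ne_top n),
    ENNReal.toReal_ofReal (by positivity)]
  simp only [ENNReal.toReal_natCast, Real.rpow_natCast]
  rw [Real.rpow_inv_natCast_pow (by positivity) hn]

lemma Lp.isClarkson (k : ℕ) [Fact (1 ≤ ((2 * (k + 1) : ℕ) : ℝ≥0∞))] :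
    IsClarkson (Lp ℂ ((2 * (k + 1) : ℕ) : ℝ≥0∞) μ) (2 * (k + 1)) := by
  intro x y
  have hi : ∀ z : Lp ℂ ((2 * (k + 1) : ℕ) : ℝ≥0∞) μ,
      Integrable (fun ω => ‖z ω‖ ^ (2 * (k + 1))) μ := fun z =>
    (Lp.memLp z).integrable_norm_pow (by positivity)
  simp only [Lp.norm_pow_natCast_eq]
  rw [← integral_add (hi _) (hi _), ← integral_add (hi _) (hi _), ← integral_div,
    ← integral_const_mul]
  refine integral_mono_ae ((hi _).add (hi _)) ((((hi _).add (hi _)).div_const _).const_mul _) ?_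
  filter_upwards [Lp.coeFn_add x y, Lp.coeFn_sub x y] with ω h1 h2
  rw [h1, h2]
  exact clarkson_complex k _ _

/-- Subtracting a real linear functional preserves uniform convexity; the minimiser is the vector
whose derivative of `‖·‖ ^ n` is `l`. -/
lemma exists_minimiser_norm_pow_sub {X : Type*} [NormedAddCommGroup X] [NormedSpace ℂ X]
    [CompleteSpace X] {n : ℕ} (hn : 2 ≤ n) (hX : IsClarkson X n) (l : X →L[ℂ] ℂ) :
    ∃ x₀, ∀ x, ‖x₀‖ ^ n - (l x₀).re ≤ ‖x‖ ^ n - (l x).re := by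
  obtain ⟨x, -, hx⟩ := exists_forall_le_of_uniformlyConvex (X := X) (p := n)
    (F := fun x => ‖x‖ ^ n - (l x).re) (by fun_prop) (c := (2 ^ n)⁻¹) (by positivity)
    (fun x y => by
      have := hX.midpoint x y
      have e : (l ((2⁻¹ : ℂ) • (x + y))).re = ((l x).re + (l y).re) / 2 := by
        rw [map_smul, map_add, smul_eq_mul]
        have : (2⁻¹ : ℂ) = ((2⁻¹ : ℝ) : ℂ) := by simp
        rw [this, Complex.re_ofReal_mul, Complex.add_re]; ring
      rw [e]; linarith)
    (b := -(1 + ‖l‖ ^ 2)) (B := 0)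
    -- Boundedness below: ‖x‖^n ≥ ‖x‖² - 1 since n ≥ 2, and completing the square absorbs the linear
    -- term.
    (fun x => by
      have h1 : (l x).re ≤ ‖l‖ * ‖x‖ :=
        (Complex.re_le_norm _).trans (l.le_opNorm x)
      have h2 : ‖x‖ ^ 2 ≤ ‖x‖ ^ n + 1 := by
        rcases le_total ‖x‖ 1 with h | h
        · have : ‖x‖ ^ 2 ≤ 1 := pow_le_one₀ (norm_nonneg _) h
          have : 0 ≤ ‖x‖ ^ n := by positivity
          linarith
        · have := pow_le_pow_right₀ h hn
          linarith
      nlinarith [sq_nonneg (‖x‖ - ‖l‖ / 2)])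
    (K := fun _ => Set.univ) (fun _ _ _ => le_rfl) (fun _ => isClosed_univ)
    (fun _ _ _ _ _ => Set.mem_univ _) (fun _ => ⟨0, Set.mem_univ _, by
      simp [show n ≠ 0 by omega]⟩)
  exact ⟨x, fun y => hx y fun _ => Set.mem_univ _⟩

lemma eq_zero_of_forall_small {e K : ℝ} (h : ∀ s : ℝ, |s| ≤ 1 → 0 ≤ s * e + s ^ 2 * K) :
    e = 0 := by
  by_contra he
  have he' : 0 < |e| := abs_pos.2 he
  have hpos : 0 < |e| + |K| := by positivity
  have hK := le_abs_self K
  have hu : 0 < |e| / (2 * (|e| + |K|)) := by positivity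
  set u := |e| / (2 * (|e| + |K|)) with hu'
  have hu1 : u * (2 * (|e| + |K|)) = |e| := by rw [hu']; field_simp
  have hu2 : u ≤ 1 := by rw [hu', div_le_one (by positivity)]; linarith [abs_nonneg K]
  rcases lt_or_gt_of_ne he with h' | h'
  · have := h u (by rwa [abs_of_pos hu])
    rw [abs_of_neg h'] at hu1
    nlinarith
  · have := h (-u) (by rwa [abs_neg, abs_of_pos hu])
    rw [abs_of_pos h'] at hu1
    nlinarith

/-- Riesz representation on `L^p`, `p` an even natural number: the density is the derivative of the
norm at a norming vector. -/
theorem Lp.exists_integral_representation (k : ℕ) [Fact (1 ≤ ((2 * (k + 1) : ℕ) : ℝ≥0∞))]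
    (l : Lp ℂ ((2 * (k + 1) : ℕ) : ℝ≥0∞) μ →L[ℂ] ℂ) :
    ∃ x₀ : Lp ℂ ((2 * (k + 1) : ℕ) : ℝ≥0∞) μ, ∀ x : Lp ℂ ((2 * (k + 1) : ℕ) : ℝ≥0∞) μ,
      Integrable (fun ω => ((2 * (k + 1) * ‖x₀ ω‖ ^ (2 * k) : ℝ) : ℂ) * conj (x₀ ω) * x ω) μ ∧
      l x = ∫ ω, ((2 * (k + 1) * ‖x₀ ω‖ ^ (2 * k) : ℝ) : ℂ) * conj (x₀ ω) * x ω ∂μ := by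
  obtain ⟨x₀, hx₀⟩ := exists_minimiser_norm_pow_sub (n := 2 * (k + 1)) (by omega)
    (Lp.isClarkson k) l
  obtain ⟨C, hC0, hC⟩ := exists_norm_pow_taylor k
  set w : Ω → ℂ := fun ω => ((2 * (k + 1) * ‖x₀ ω‖ ^ (2 * k) : ℝ) : ℂ) * conj (x₀ ω) with hw
  have hi : ∀ z : Lp ℂ ((2 * (k + 1) : ℕ) : ℝ≥0∞) μ,
      Integrable (fun ω => ‖z ω‖ ^ (2 * (k + 1))) μ := fun z =>
    (Lp.memLp z).integrable_norm_pow (by positivity)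
  have hsum : ∀ x : Lp ℂ ((2 * (k + 1) : ℕ) : ℝ≥0∞) μ,
      Integrable (fun ω => (‖x₀ ω‖ + ‖x ω‖) ^ (2 * (k + 1))) μ := fun x => by
    have := ((Lp.memLp x₀).norm.add (Lp.memLp x).norm).integrable_norm_pow
      (p := 2 * (k + 1)) (by positivity)
    refine this.congr (Eventually.of_forall fun ω => ?_)
    simp only [Pi.add_apply]
    rw [Real.norm_of_nonneg (by positivity)]
  have hwm : AEStronglyMeasurable w μ := by
    have h1 := (Lp.memLp x₀).1
    have h2 : Continuous fun z : ℂ => ((2 * (k + 1) * ‖z‖ ^ (2 * k) : ℝ) : ℂ) * conj z := by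
      fun_prop
    exact h2.comp_aestronglyMeasurable h1
  have hint : ∀ x : Lp ℂ ((2 * (k + 1) : ℕ) : ℝ≥0∞) μ, Integrable (fun ω => w ω * x ω) μ := by
    intro x
    refine ((hsum x).const_mul (2 * (k + 1))).mono' (hwm.mul (Lp.memLp x).1)
      (Eventually.of_forall fun ω => ?_)
    simp only [hw]
    rw [norm_mul, norm_mul, Complex.norm_conj, Complex.norm_real,
      Real.norm_of_nonneg (by positivity)]
    have h1 : ‖x₀ ω‖ ^ (2 * k) * (‖x₀ ω‖ * ‖x ω‖) ≤ (‖x₀ ω‖ + ‖x ω‖) ^ (2 * k)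
        * ((‖x₀ ω‖ + ‖x ω‖) * (‖x₀ ω‖ + ‖x ω‖)) := by
      gcongr <;> linarith [norm_nonneg (x₀ ω), norm_nonneg (x ω)]
    have h2 : (2 * (k + 1) : ℝ) * (‖x₀ ω‖ ^ (2 * k) * (‖x₀ ω‖ * ‖x ω‖)) ≤ (2 * (k + 1) : ℝ) *
        ((‖x₀ ω‖ + ‖x ω‖) ^ (2 * k) * ((‖x₀ ω‖ + ‖x ω‖) * (‖x₀ ω‖ + ‖x ω‖))) := by gcongr
    linear_combination h2
  have hre : ∀ x, (l x).re = (∫ ω, w ω * x ω ∂μ).re := by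
    intro x
    have key : (∫ ω, w ω * x ω ∂μ).re - (l x).re = 0 := by
      -- First variation at the minimiser: moving by s in the direction x changes the functional by
      -- at most s times the left side plus s² times a fixed constant, and the change is nonnegative
      -- for both signs of s.
      refine eq_zero_of_forall_small (K := ∫ ω, C * (‖x₀ ω‖ + ‖x ω‖) ^ (2 * (k + 1)) ∂μ)
        fun s hs => ?_
      have h1 := hx₀ (x₀ + (s : ℂ) • x)
      have h2 : (l (x₀ + (s : ℂ) • x)).re = (l x₀).re + s * (l x).re := by
        rw [map_add, map_smul, smul_eq_mul, Complex.add_re, Complex.re_ofReal_mul]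
      have h3 : ‖x₀ + (s : ℂ) • x‖ ^ (2 * (k + 1)) ≤ ‖x₀‖ ^ (2 * (k + 1))
          + s * (∫ ω, w ω * x ω ∂μ).re
          + s ^ 2 * ∫ ω, C * (‖x₀ ω‖ + ‖x ω‖) ^ (2 * (k + 1)) ∂μ := by
        have hre' : (∫ ω, w ω * x ω ∂μ).re = ∫ ω, (w ω * x ω).re ∂μ :=
          (integral_re (hint x)).symm
        have hire : Integrable (fun ω => s * (w ω * x ω).re) μ := (hint x).re.const_mul s
        have hisum : Integrable (fun ω => ‖x₀ ω‖ ^ (2 * (k + 1)) + s * (w ω * x ω).re) μ :=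
          (hi x₀).add hire
        rw [Lp.norm_pow_natCast_eq, Lp.norm_pow_natCast_eq, hre', ← integral_const_mul,
          ← integral_const_mul, ← integral_add (hi _) hire,
          ← integral_add hisum
            (((hsum x).const_mul C).const_mul (s ^ 2))]
        refine integral_mono_ae (hi _) (hisum.add
            (((hsum x).const_mul C).const_mul (s ^ 2))) ?_
        filter_upwards [Lp.coeFn_add x₀ ((s : ℂ) • x), Lp.coeFn_smul (s : ℂ) x] with ω h4 h5
        rw [h4, Pi.add_apply, h5, Pi.smul_apply, smul_eq_mul]
        refine (hC (x₀ ω) (x ω) s hs).trans_eq ?_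
        congr 2
        rw [show w ω * x ω = ((2 * (k + 1) * ‖x₀ ω‖ ^ (2 * k) : ℝ) : ℂ) * (conj (x₀ ω) * x ω) from
          mul_assoc _ _ _, Complex.re_ofReal_mul]
      rw [h2] at h1
      linarith
    linarith
  refine ⟨x₀, fun x => ⟨hint x, ?_⟩⟩
  refine Complex.ext (hre x) ?_
  -- The real part at -ix is the imaginary part at x.
  have h1 := hre ((-Complex.I) • x)
  have h2 : ∫ ω, w ω * ((-Complex.I) • x : Lp ℂ ((2 * (k + 1) : ℕ) : ℝ≥0∞) μ) ω ∂μ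
      = -Complex.I * ∫ ω, w ω * x ω ∂μ := by
    rw [← integral_const_mul]
    refine integral_congr_ae ?_
    filter_upwards [Lp.coeFn_smul (-Complex.I) x] with ω h
    rw [h, Pi.smul_apply, smul_eq_mul]; ring
  rw [h2, map_smul, smul_eq_mul] at h1
  change (l x).im = (∫ ω, w ω * x ω ∂μ).im
  simpa using h1

end LpEven

/-! ### Integrability of densities of supremum-bounded functionals. -/

section IntegrableDensity

open Filter Topology ComplexConjugate

variable {Ω : Type*} [MeasurableSpace Ω] {μ : Measure Ω}

/-- A functional on `L^p` (`p` even) which is bounded for the supremum norm is given by an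
integrable density. -/
theorem Lp.exists_integrable_density (k : ℕ) [Fact (1 ≤ ((2 * (k + 1) : ℕ) : ℝ≥0∞))]
    (l : Lp ℂ ((2 * (k + 1) : ℕ) : ℝ≥0∞) μ →L[ℂ] ℂ) {C : ℝ} (hC : 0 ≤ C)
    (hl : ∀ x : Lp ℂ ((2 * (k + 1) : ℕ) : ℝ≥0∞) μ, ∀ c : ℝ, 0 ≤ c → (∀ᵐ ω ∂μ, ‖x ω‖ ≤ c) →
      ‖l x‖ ≤ C * c) :
    ∃ w : Lp ℂ 1 μ, ‖w‖ ≤ C ∧ ∀ x : Lp ℂ ((2 * (k + 1) : ℕ) : ℝ≥0∞) μ,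
      l x = ∫ ω, w ω * x ω ∂μ := by
  obtain ⟨x₀, hx₀⟩ := Lp.exists_integral_representation k l
  set w : Ω → ℂ := fun ω => ((2 * (k + 1) * ‖x₀ ω‖ ^ (2 * k) : ℝ) : ℂ) * conj (x₀ ω) with hw
  have hwm : AEStronglyMeasurable w μ := by
    have h1 := (Lp.memLp x₀).1
    have h2 : Continuous fun z : ℂ => ((2 * (k + 1) * ‖z‖ ^ (2 * k) : ℝ) : ℂ) * conj z := by
      fun_prop
    exact h2.comp_aestronglyMeasurable h1
  set ε : ℕ → ℝ := fun n => 1 / ((n : ℝ) + 1) with hε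
  have hεpos : ∀ n, 0 < ε n := fun n => Nat.one_div_pos_of_nat
  -- `g n` is the density times x₀/(‖x₀‖ + ε n), a vector of L^p bounded by 1 that approximates the
  -- conjugate phase of the density. Its integral is at most C, and Fatou's lemma gives the L^1
  -- bound for w.
  set g : ℕ → Ω → ℝ := fun n ω =>
    2 * (k + 1) * ‖x₀ ω‖ ^ (2 * k) * (‖x₀ ω‖ ^ 2 / (‖x₀ ω‖ + ε n)) with hg
  have hg0 : ∀ n ω, 0 ≤ g n ω := fun n ω => by have := hεpos n; positivity
  have hgm : ∀ n, AEStronglyMeasurable (g n) μ := fun n => by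
    have h1 := (Lp.memLp x₀).1
    have h2 : Continuous fun z : ℂ =>
        2 * (k + 1) * ‖z‖ ^ (2 * k) * (‖z‖ ^ 2 / (‖z‖ + ε n)) := by
      have h3 : ∀ z : ℂ, ‖z‖ + ε n ≠ 0 := fun z =>
        (add_pos_of_nonneg_of_pos (norm_nonneg z) (hεpos n)).ne'
      fun_prop (disch := assumption)
    exact h2.comp_aestronglyMeasurable h1
  have hgint : ∀ n, ∫⁻ ω, ENNReal.ofReal (g n ω) ∂μ ≤ ENNReal.ofReal C := by
    intro n
    have hcont : Continuous fun z : ℂ => ((‖z‖ + ε n)⁻¹ : ℝ) • z := by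
      have h3 : ∀ z : ℂ, ‖z‖ + ε n ≠ 0 := fun z =>
        (add_pos_of_nonneg_of_pos (norm_nonneg z) (hεpos n)).ne'
      fun_prop (disch := assumption)
    have hmem : MemLp (fun ω => ((‖x₀ ω‖ + ε n)⁻¹ : ℝ) • x₀ ω)
        ((2 * (k + 1) : ℕ) : ℝ≥0∞) μ := by
      refine (Lp.memLp x₀).of_le_mul (c := (ε n)⁻¹)
        (hcont.comp_aestronglyMeasurable (Lp.memLp x₀).1) (Eventually.of_forall fun ω => ?_)
      have := hεpos n
      rw [norm_smul, Real.norm_of_nonneg (by positivity)]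
      gcongr
      linarith [norm_nonneg (x₀ ω)]
    have hbd : ∀ᵐ ω ∂μ, ‖hmem.toLp _ ω‖ ≤ 1 := by
      filter_upwards [hmem.coeFn_toLp] with ω h
      have := hεpos n
      rw [h, norm_smul, Real.norm_of_nonneg (by positivity), inv_mul_le_iff₀ (by positivity)]
      linarith
    have hval : ∀ᵐ ω ∂μ, w ω * hmem.toLp _ ω = (g n ω : ℂ) := by
      filter_upwards [hmem.coeFn_toLp] with ω h
      rw [h]
      have h4 : conj (x₀ ω) * x₀ ω = ((‖x₀ ω‖ ^ 2 : ℝ) : ℂ) := by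
        rw [mul_comm, Complex.mul_conj, Complex.normSq_eq_norm_sq]
      simp only [hw, hg, Complex.real_smul]
      rw [show ∀ a b c d : ℂ, a * b * (c * d) = a * (c * (b * d)) from fun a b c d => by ring, h4]
      push_cast
      ring
    obtain ⟨h1, h2⟩ := hx₀ (hmem.toLp _)
    have h3 := hl (hmem.toLp _) 1 zero_le_one hbd
    rw [h2, integral_congr_ae hval, integral_complex_ofReal, Complex.norm_real,
      Real.norm_of_nonneg (integral_nonneg (hg0 n)), mul_one] at h3
    have hgi : Integrable (g n) μ := by
      have := (h1.congr hval).re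
      simpa using this
    rw [← ofReal_integral_eq_lintegral_ofReal hgi (Eventually.of_forall (hg0 n))]
    exact ENNReal.ofReal_le_ofReal h3
  have hlim : ∀ ω, Tendsto (fun n => ENNReal.ofReal (g n ω)) atTop (𝓝 ‖w ω‖ₑ) := by
    intro ω
    rw [← ofReal_norm]
    refine ENNReal.tendsto_ofReal ?_
    have hwn : ‖w ω‖ = 2 * (k + 1) * ‖x₀ ω‖ ^ (2 * k) * ‖x₀ ω‖ := by
      simp only [hw]
      rw [norm_mul, Complex.norm_conj, Complex.norm_real, Real.norm_of_nonneg (by positivity)]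
    rw [hwn]
    refine Tendsto.const_mul _ ?_
    rcases eq_or_ne ‖x₀ ω‖ 0 with h | h
    · simp [h]
    · have h1 : Tendsto (fun n => ‖x₀ ω‖ + ε n) atTop (𝓝 (‖x₀ ω‖ + 0)) :=
        tendsto_const_nhds.add (tendsto_one_div_add_atTop_nhds_zero_nat (𝕜 := ℝ))
      rw [add_zero] at h1
      have h2 := (tendsto_const_nhds (x := ‖x₀ ω‖ ^ 2)).div h1 h
      have h3 : ‖x₀ ω‖ ^ 2 / ‖x₀ ω‖ = ‖x₀ ω‖ := by field_simp
      rwa [h3] at h2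
  have hwnorm : eLpNorm w 1 μ ≤ ENNReal.ofReal C := by
    rw [eLpNorm_one_eq_lintegral_enorm]
    calc ∫⁻ ω, ‖w ω‖ₑ ∂μ = ∫⁻ ω, liminf (fun n => ENNReal.ofReal (g n ω)) atTop ∂μ :=
          lintegral_congr fun ω => (hlim ω).liminf_eq.symm
      _ ≤ liminf (fun n => ∫⁻ ω, ENNReal.ofReal (g n ω) ∂μ) atTop :=
          lintegral_liminf_le' fun n => (hgm n).aemeasurable.ennreal_ofReal
      _ ≤ ENNReal.ofReal C := by
          refine liminf_le_of_le (by isBoundedDefault) fun b hb => ?_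
          obtain ⟨n, hn⟩ := hb.exists
          exact hn.trans (hgint n)
  have hwL : MemLp w 1 μ := ⟨hwm, hwnorm.trans_lt ENNReal.ofReal_lt_top⟩
  refine ⟨hwL.toLp w, ?_, fun x => ?_⟩
  · rw [Lp.norm_toLp]
    exact ENNReal.toReal_le_of_le_ofReal hC hwnorm
  · rw [(hx₀ x).2]
    refine integral_congr_ae ?_
    filter_upwards [hwL.coeFn_toLp] with ω h
    rw [h]

end IntegrableDensity

/-! ### Localizable measures and the dual of L^1. -/

section Localizable

open Filter Topology ComplexConjugate

variable {Ω : Type*} [MeasurableSpace Ω] {μ : Measure Ω}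

/-- Semifiniteness: a set of infinite measure would contain a set of finite positive measure. -/
lemma IsLocalizable.measure_eq_zero (hμ : IsLocalizable μ) {N : Set Ω} (hN : MeasurableSet N)
    (h : ∀ A, MeasurableSet A → μ A < ∞ → μ (N ∩ A) = 0) : μ N = 0 := by
  by_contra h0
  have htop : μ N = ∞ := by
    by_contra h1
    exact h0 (by simpa using h N hN (lt_top_iff_ne_top.2 h1))
  obtain ⟨t, htN, htm, ht0, ht⟩ := hμ.semifinite N hN htop
  have := h t htm ht
  rw [Set.inter_eq_right.2 htN] at this
  exact ht0.ne' this

/-- In a localizable measure space, a compatible family of local functions can be glued. -/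
lemma IsLocalizable.exists_glue (hμ : IsLocalizable μ) {ι : Type*} {S : ι → Set Ω}
    (hS : ∀ i, MeasurableSet (S i)) {f : ι → Ω → ℝ≥0∞} (hf : ∀ i, Measurable (f i))
    (hcompat : ∀ i j, ∀ᵐ ω ∂μ, ω ∈ S i → ω ∈ S j → f i ω = f j ω) :
    ∃ h : Ω → ℝ≥0∞, Measurable h ∧ ∀ i, ∀ᵐ ω ∂μ, ω ∈ S i → h ω = f i ω := by
  -- The glued function is rebuilt from its rational superlevel sets, each the essential supremum of
  -- the local ones. Negative rationals are truncated to 0.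
  set E : ℚ → ι → Set Ω := fun q i => S i ∩ {ω | ((Real.toNNReal q : NNReal) : ℝ≥0∞) < f i ω} with hE
  have hEm : ∀ q i, MeasurableSet (E q i) := fun q i =>
    (hS i).inter (measurableSet_lt measurable_const (hf i))
  have hex : ∀ q : ℚ, ∃ H, MeasurableSet H ∧ (∀ i, μ (E q i \ H) = 0) ∧
      ∀ G, MeasurableSet G → (∀ i, μ (E q i \ G) = 0) → μ (H \ G) = 0 := fun q => by
    obtain ⟨H, h1, h2, h3⟩ := hμ.exists_essSup (Set.range (E q)) (by
      rintro _ ⟨i, rfl⟩; exact hEm q i)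
    exact ⟨H, h1, fun i => h2 _ ⟨i, rfl⟩, fun G hG hG' => h3 G hG (by
      rintro _ ⟨i, rfl⟩; exact hG' i)⟩
  choose H hHm hHub hHleast using hex
  refine ⟨fun ω => ⨆ q : ℚ, (H q).indicator (fun _ => ((Real.toNNReal q : NNReal) : ℝ≥0∞)) ω,
    Measurable.iSup fun q => measurable_const.indicator (hHm q), fun i => ?_⟩
  have h1 : ∀ q : ℚ, ∀ᵐ ω ∂μ, ω ∈ E q i → ω ∈ H q := fun q => by
    have := hHub q i
    rw [measure_eq_zero_iff_ae_notMem] at this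
    filter_upwards [this] with ω hω hω'
    by_contra h
    exact hω ⟨hω', h⟩
  have h2 : ∀ q : ℚ, ∀ᵐ ω ∂μ, ω ∈ H q → ω ∈ S i → ω ∈ E q i := fun q => by
    -- Removing from `H q` the part of `S i` outside `E q i` leaves an upper bound of all `E q j` by
    -- compatibility, so minimality shows that the removed part is null.
    have := hHleast q (H q \ (S i \ E q i)) ((hHm q).diff ((hS i).diff (hEm q i))) fun j => by
      rw [measure_eq_zero_iff_ae_notMem]
      have h3 := hHub q j
      rw [measure_eq_zero_iff_ae_notMem] at h3
      filter_upwards [h3, hcompat i j] with ω h4 h5 h6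
      refine h6.2 ⟨?_, fun h7 => h7.2 ⟨h7.1, ?_⟩⟩
      · by_contra h8
        exact h4 ⟨h6.1, h8⟩
      · have := h6.1.2
        simp only [Set.mem_ofPred_eq] at this ⊢
        rwa [h5 h7.1 h6.1.1]
    rw [measure_eq_zero_iff_ae_notMem] at this
    filter_upwards [this] with ω h3 h4 h5
    by_contra h6
    exact h3 ⟨h4, fun h7 => h7.2 ⟨h5, h6⟩⟩
  filter_upwards [ae_all_iff.2 h1, ae_all_iff.2 h2] with ω h3 h4 hω
  refine le_antisymm (iSup_le fun q => ?_) (le_of_forall_lt fun a ha => ?_)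
  · by_cases hq : ω ∈ H q
    · rw [Set.indicator_of_mem hq]
      exact (h4 q hq hω).2.le
    · rw [Set.indicator_of_notMem hq]; exact zero_le
  · obtain ⟨q, -, hq1, hq2⟩ := ENNReal.lt_iff_exists_rat_btwn.1 ha
    refine lt_iSup_iff.2 ⟨q, ?_⟩
    rw [Set.indicator_of_mem (h3 q ⟨hω, hq2⟩)]
    exact hq1

/-- On a set of finite measure, a functional on `L^1` is represented by a bounded function. -/
lemma exists_bounded_density_on (l : Lp ℂ 1 μ →L[ℂ] ℂ) {A : Set Ω} (hA : MeasurableSet A)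
    (hμA : μ A ≠ ∞) :
    ∃ z : Ω → ℂ, Measurable z ∧ (∀ ω, ‖z ω‖ ≤ ‖l‖) ∧ ∀ B, (hB : MeasurableSet B) →
      B ⊆ A → ∀ hμB : μ B ≠ ∞, l (indicatorConstLp 1 hB hμB 1) = ∫ ω in B, z ω ∂μ := by
  have hp2 : ((2 * (0 + 1) : ℕ) : ℝ≥0∞) = 2 := by norm_num
  have : Fact (1 ≤ ((2 * (0 + 1) : ℕ) : ℝ≥0∞)) := ⟨by rw [hp2]; norm_num⟩
  have : ENNReal.HolderTriple ((2 * (0 + 1) : ℕ) : ℝ≥0∞) ((2 * (0 + 1) : ℕ) : ℝ≥0∞) 1 :=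
    ⟨by rw [hp2, ENNReal.inv_two_add_inv_two, inv_one]⟩
  -- Multiplication by the indicator of `A` maps L² to L¹, so `l` can be represented on `A` by the
  -- Riesz theorem with exponent 2(0 + 1).
  set e := (ContinuousLinearMap.mul ℂ ℂ).holderL μ ((2 * (0 + 1) : ℕ) : ℝ≥0∞)
    ((2 * (0 + 1) : ℕ) : ℝ≥0∞) 1 (indicatorConstLp _ hA hμA 1) with he
  have heval : ∀ x, e x =ᵐ[μ] fun ω => A.indicator (fun _ => (1 : ℂ)) ω * x ω := fun x => by
    have h1 := (ContinuousLinearMap.mul ℂ ℂ).coeFn_holder (r := 1)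
      (indicatorConstLp ((2 * (0 + 1) : ℕ) : ℝ≥0∞) hA hμA (1 : ℂ)) x
    filter_upwards [h1, indicatorConstLp_coeFn (p := ((2 * (0 + 1) : ℕ) : ℝ≥0∞)) (hs := hA)
      (hμs := hμA) (c := (1 : ℂ))] with ω h2 h3
    simp only [he, ContinuousLinearMap.holderL_apply_apply]
    rw [h2, h3]; rfl
  obtain ⟨x₀, hx₀⟩ := Lp.exists_integral_representation 0 (l.comp e)
  simp only [mul_zero, pow_zero, Nat.cast_zero, zero_add, mul_one] at hx₀
  have hxm := (Lp.memLp x₀).1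
  set g : Ω → ℂ := hxm.mk x₀ with hg
  have hgm : Measurable g := hxm.stronglyMeasurable_mk.measurable
  have hgx : x₀ =ᵐ[μ] g := hxm.ae_eq_mk
  set z₀ : Ω → ℂ := fun ω => 2 * conj (g ω) with hz₀
  have hz₀m : Measurable z₀ := by fun_prop
  have hgL : MemLp g ((2 * (0 + 1) : ℕ) : ℝ≥0∞) μ := (Lp.memLp x₀).ae_eq hgx
  have hrep : ∀ x, l (e x) = ∫ ω, z₀ ω * x ω ∂μ := fun x => by
    have := (hx₀ x).2
    rw [ContinuousLinearMap.comp_apply] at this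
    rw [this]
    refine integral_congr_ae ?_
    filter_upwards [hgx] with ω h
    simp only [hz₀]
    rw [← h]
    push_cast
    rfl
  have hind : ∀ B, (hB : MeasurableSet B) → B ⊆ A → ∀ hμB : μ B ≠ ∞,
      l (indicatorConstLp 1 hB hμB 1) = ∫ ω in B, z₀ ω ∂μ := by
    intro B hB hBA hμB
    have h1 := hrep (indicatorConstLp _ hB hμB 1)
    have h2 : e (indicatorConstLp _ hB hμB 1) = indicatorConstLp 1 hB hμB 1 := by
      refine Lp.ext ?_
      filter_upwards [heval (indicatorConstLp _ hB hμB 1),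
        indicatorConstLp_coeFn (p := 1) (hs := hB) (hμs := hμB) (c := (1 : ℂ)),
        indicatorConstLp_coeFn (p := ((2 * (0 + 1) : ℕ) : ℝ≥0∞)) (hs := hB)
          (hμs := hμB) (c := (1 : ℂ))] with ω h3 h4 h5
      rw [h3, h4, h5]
      by_cases hω : ω ∈ B
      · simp [hω, hBA hω]
      · simp [hω]
    rw [h2] at h1
    rw [h1, ← integral_indicator hB]
    refine integral_congr_ae ?_
    filter_upwards [indicatorConstLp_coeFn (p := ((2 * (0 + 1) : ℕ) : ℝ≥0∞)) (hs := hB)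
          (hμs := hμB) (c := (1 : ℂ))] with ω h5
    rw [h5]
    by_cases hω : ω ∈ B <;> simp [hω]
  set C := ‖l‖ with hC
  have hbound : ∀ᵐ ω ∂μ, ω ∈ A → ‖z₀ ω‖ ≤ C := by
    -- Testing against the conjugate of `z₀` on `B` gives ∫_B ‖z₀‖² ≤ C ∫_B ‖z₀‖, which is only
    -- possible if `B` is null.
    set B := A ∩ {ω | C < ‖z₀ ω‖} with hB
    have hBm : MeasurableSet B := hA.inter (measurableSet_lt measurable_const hz₀m.norm)
    have hzL : MemLp (B.indicator fun ω => conj (z₀ ω)) ((2 * (0 + 1) : ℕ) : ℝ≥0∞) μ := by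
      refine MemLp.indicator hBm ?_
      refine hgL.of_le_mul (c := 2) (by fun_prop) (Eventually.of_forall fun ω => ?_)
      simp [hz₀]
    have hB' : μ B ≠ ∞ := ne_top_of_le_ne_top hμA (measure_mono Set.inter_subset_left)
    have hzi : IntegrableOn (fun ω => ‖z₀ ω‖) B μ := by
      have : MemLp z₀ ((2 * (0 + 1) : ℕ) : ℝ≥0∞) (μ.restrict B) := by
        refine (hgL.restrict B).of_le_mul (c := 2) (by fun_prop) (Eventually.of_forall fun ω => ?_)
        simp [hz₀]
      have hfin : IsFiniteMeasure (μ.restrict B) := ⟨by simpa using hB'.lt_top⟩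
      exact (this.integrable Fact.out).norm
    have hzi2 : IntegrableOn (fun ω => ‖z₀ ω‖ ^ 2) B μ := by
      have : MemLp z₀ ((2 * (0 + 1) : ℕ) : ℝ≥0∞) (μ.restrict B) := by
        refine (hgL.restrict B).of_le_mul (c := 2) (by fun_prop) (Eventually.of_forall fun ω => ?_)
        simp [hz₀]
      exact this.integrable_norm_pow (by norm_num)
    have h1 := hrep (hzL.toLp _)
    have h2 : ∫ ω, z₀ ω * hzL.toLp _ ω ∂μ = ((∫ ω in B, ‖z₀ ω‖ ^ 2 ∂μ : ℝ) : ℂ) := by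
      rw [← integral_complex_ofReal, ← integral_indicator hBm]
      refine integral_congr_ae ?_
      filter_upwards [hzL.coeFn_toLp] with ω h
      rw [h]
      by_cases hω : ω ∈ B
      · rw [Set.indicator_of_mem hω, Set.indicator_of_mem hω, Complex.mul_conj,
          Complex.normSq_eq_norm_sq]
      · rw [Set.indicator_of_notMem hω, Set.indicator_of_notMem hω, mul_zero]
    have h3 : ‖e (hzL.toLp _)‖ = ∫ ω in B, ‖z₀ ω‖ ∂μ := by
      rw [L1.norm_eq_integral_norm, ← integral_indicator hBm]
      refine integral_congr_ae ?_
      filter_upwards [heval (hzL.toLp _), hzL.coeFn_toLp] with ω h h'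
      rw [h, h']
      by_cases hω : ω ∈ B
      · rw [Set.indicator_of_mem hω, Set.indicator_of_mem hω, Set.indicator_of_mem hω.1, one_mul,
          Complex.norm_conj]
      · rw [Set.indicator_of_notMem hω, Set.indicator_of_notMem hω, mul_zero, norm_zero]
    have h4 := l.le_opNorm (e (hzL.toLp _))
    rw [h1, h2, h3, Complex.norm_real, Real.norm_of_nonneg (by positivity)] at h4
    have h5 : ∫ ω in B, (‖z₀ ω‖ ^ 2 - C * ‖z₀ ω‖) ∂μ ≤ 0 := by
      rw [integral_sub hzi2 (hzi.const_mul C), integral_const_mul]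
      linarith
    have h6 : ∀ ω ∈ B, 0 < ‖z₀ ω‖ ^ 2 - C * ‖z₀ ω‖ := fun ω hω => by
      have h7 : C < ‖z₀ ω‖ := hω.2
      have h8 : 0 < ‖z₀ ω‖ := (norm_nonneg l).trans_lt h7
      nlinarith
    have h9 : μ B = 0 := by
      have h10 : 0 ≤ᵐ[μ.restrict B] fun ω => ‖z₀ ω‖ ^ 2 - C * ‖z₀ ω‖ :=
        (ae_restrict_iff' hBm).2 (Eventually.of_forall fun ω hω => (h6 ω hω).le)
      have h11 := (setIntegral_eq_zero_iff_of_nonneg_ae h10 (hzi2.sub (hzi.const_mul C))).1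
        (le_antisymm h5 (integral_nonneg_of_ae h10))
      have h12 := (ae_restrict_iff' hBm).1 h11
      rw [measure_eq_zero_iff_ae_notMem]
      filter_upwards [h12] with ω h13 h14
      exact (h6 ω h14).ne' (h13 h14)
    rw [measure_eq_zero_iff_ae_notMem] at h9
    filter_upwards [h9] with ω h10 h11
    by_contra h12
    exact h10 ⟨h11, not_le.1 h12⟩
  have hsm : MeasurableSet {ω | ‖z₀ ω‖ ≤ C} := measurableSet_le hz₀m.norm measurable_const
  refine ⟨{ω | ‖z₀ ω‖ ≤ C}.indicator z₀, hz₀m.indicator hsm, fun ω => ?_,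
    fun B hB hBA hμB => ?_⟩
  · by_cases h : ω ∈ {ω | ‖z₀ ω‖ ≤ C}
    · rw [Set.indicator_of_mem h]; exact h
    · rw [Set.indicator_of_notMem h, norm_zero]; exact norm_nonneg l
  · rw [hind B hB hBA hμB]
    refine setIntegral_congr_ae hB ?_
    filter_upwards [hbound] with ω h hω
    have h' : ω ∈ {ω | ‖z₀ ω‖ ≤ C} := h (hBA hω)
    rw [Set.indicator_of_mem h']

lemma indicatorConstLp_eq_smul {p : ℝ≥0∞} {s : Set Ω} (hs : MeasurableSet s) (hμs : μ s ≠ ∞)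
    (c : ℂ) : indicatorConstLp p hs hμs c = c • indicatorConstLp p hs hμs (1 : ℂ) := by
  refine Lp.ext ?_
  filter_upwards [indicatorConstLp_coeFn (p := p) (hs := hs) (hμs := hμs) (c := c),
    indicatorConstLp_coeFn (p := p) (hs := hs) (hμs := hμs) (c := (1 : ℂ)),
    Lp.coeFn_smul c (indicatorConstLp p hs hμs (1 : ℂ))] with ω h1 h2 h3
  rw [h1, h3, Pi.smul_apply, h2]
  by_cases hω : ω ∈ s <;> simp [hω]

/-- For a localizable measure, `L^∞` is the dual of `L^1`. -/
theorem IsLocalizable.exists_Linfty_density (hμ : IsLocalizable μ) (l : Lp ℂ 1 μ →L[ℂ] ℂ) :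
    ∃ z : Lp ℂ ∞ μ, ‖z‖ ≤ ‖l‖ ∧ ∀ y : Lp ℂ 1 μ, l y = ∫ ω, y ω * z ω ∂μ := by
  have hloc : ∀ A : {A : Set Ω // MeasurableSet A ∧ μ A ≠ ∞}, ∃ z : Ω → ℂ, Measurable z ∧
      (∀ ω, ‖z ω‖ ≤ ‖l‖) ∧ ∀ B, (hB : MeasurableSet B) → B ⊆ A.1 → ∀ hμB : μ B ≠ ∞,
        l (indicatorConstLp 1 hB hμB 1) = ∫ ω in B, z ω ∂μ := fun A =>
    exists_bounded_density_on l A.2.1 A.2.2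
  choose f hfm hfb hf using hloc
  set C := ‖l‖ with hC
  have hC0 : 0 ≤ C := norm_nonneg l
  have hcompat : ∀ A B : {A : Set Ω // MeasurableSet A ∧ μ A ≠ ∞}, ∀ᵐ ω ∂μ,
      ω ∈ A.1 → ω ∈ B.1 → f A ω = f B ω := by
    intro A B
    have hAB : MeasurableSet (A.1 ∩ B.1) := A.2.1.inter B.2.1
    have hfin : μ (A.1 ∩ B.1) ≠ ∞ := ne_top_of_le_ne_top A.2.2 (measure_mono Set.inter_subset_left)
    have hfm' : IsFiniteMeasure (μ.restrict (A.1 ∩ B.1)) := ⟨by simpa using hfin.lt_top⟩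
    have hint : ∀ A', Integrable (f A') (μ.restrict (A.1 ∩ B.1)) := fun A' =>
      Integrable.of_bound (hfm A').aestronglyMeasurable C (Eventually.of_forall (hfb A'))
    have := Integrable.ae_eq_of_forall_setIntegral_eq (f A) (f B) (hint A) (hint B)
      fun s hs _ => by
        rw [Measure.restrict_restrict hs]
        have h1 : MeasurableSet (s ∩ (A.1 ∩ B.1)) := hs.inter hAB
        have h2 : μ (s ∩ (A.1 ∩ B.1)) ≠ ∞ :=
          ne_top_of_le_ne_top hfin (measure_mono Set.inter_subset_right)
        rw [← hf A _ h1 (fun ω h => h.2.1) h2, ← hf B _ h1 (fun ω h => h.2.2) h2]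
    filter_upwards [(ae_restrict_iff' hAB).1 this] with ω h h1 h2 using h ⟨h1, h2⟩
  -- Adding C = ‖l‖ makes the real and imaginary parts nonnegative, as gluing is available for
  -- values in [0, ∞].
  obtain ⟨u, hum, hu⟩ := hμ.exists_glue (fun A : {A : Set Ω // MeasurableSet A ∧ μ A ≠ ∞} => A.2.1)
    (f := fun A ω => ENNReal.ofReal ((f A ω).re + C))
    (fun A => ((Complex.measurable_re.comp (hfm A)).add_const C).ennreal_ofReal)
    (fun A B => (hcompat A B).mono fun ω h h1 h2 => by rw [h h1 h2])
  obtain ⟨v, hvm, hv⟩ := hμ.exists_glue (fun A : {A : Set Ω // MeasurableSet A ∧ μ A ≠ ∞} => A.2.1)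
    (f := fun A ω => ENNReal.ofReal ((f A ω).im + C))
    (fun A => ((Complex.measurable_im.comp (hfm A)).add_const C).ennreal_ofReal)
    (fun A B => (hcompat A B).mono fun ω h h1 h2 => by rw [h h1 h2])
  set z : Ω → ℂ := fun ω => (((u ω).toReal - C : ℝ) : ℂ) + (((v ω).toReal - C : ℝ) : ℂ) * Complex.I
    with hz
  have hzm : Measurable z := by fun_prop
  have hzf : ∀ A : {A : Set Ω // MeasurableSet A ∧ μ A ≠ ∞}, ∀ᵐ ω ∂μ, ω ∈ A.1 → z ω = f A ω := by
    intro A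
    filter_upwards [hu A, hv A] with ω h1 h2 hω
    have h3 := (abs_le.1 ((Complex.abs_re_le_norm (f A ω)).trans (hfb A ω))).1
    have h4 := (abs_le.1 ((Complex.abs_im_le_norm (f A ω)).trans (hfb A ω))).1
    simp only [hz]
    rw [h1 hω, h2 hω, ENNReal.toReal_ofReal (by linarith), ENNReal.toReal_ofReal (by linarith),
      add_sub_cancel_right, add_sub_cancel_right, Complex.re_add_im]
  have hzb : ∀ᵐ ω ∂μ, ‖z ω‖ ≤ C := by
    have := hμ.measure_eq_zero (N := {ω | C < ‖z ω‖}) (measurableSet_lt measurable_const hzm.norm)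
      fun A hA hμA => by
        rw [measure_eq_zero_iff_ae_notMem]
        filter_upwards [hzf ⟨A, hA, hμA.ne⟩] with ω h h'
        have h1 : C < ‖z ω‖ := h'.1
        rw [h h'.2] at h1
        exact absurd (hfb ⟨A, hA, hμA.ne⟩ ω) (not_le.2 h1)
    rw [measure_eq_zero_iff_ae_notMem] at this
    filter_upwards [this] with ω h
    exact not_lt.1 h
  have hzL : MemLp z ∞ μ := memLp_top_of_bound hzm.aestronglyMeasurable C hzb
  refine ⟨hzL.toLp z, ?_, ?_⟩
  · rw [Lp.norm_toLp]
    refine ENNReal.toReal_le_of_le_ofReal hC0 ?_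
    rw [eLpNorm_exponent_top]
    exact eLpNormEssSup_le_of_ae_bound hzb
  · set L := ((ContinuousLinearMap.mul ℂ ℂ).lpPairing μ 1 ∞).flip (hzL.toLp z) with hL
    have hLapp : ∀ y, L y = ∫ ω, y ω * hzL.toLp z ω ∂μ := fun y => by
      simp only [hL, ContinuousLinearMap.flip_apply]
      rw [ContinuousLinearMap.lpPairing_eq_integral]
      rfl
    intro y
    rw [← hLapp]
    induction y using Lp.induction ENNReal.one_ne_top with
    | indicatorConst c hs hμs =>
      rename_i s
      rw [Lp.simpleFunc.coe_indicatorConst]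
      rw [indicatorConstLp_eq_smul, map_smul, map_smul, hLapp, hf ⟨s, hs, hμs.ne⟩ s hs subset_rfl hμs.ne,
        ← integral_indicator hs]
      congr 1
      refine integral_congr_ae ?_
      filter_upwards [indicatorConstLp_coeFn (p := 1) (hs := hs) (hμs := hμs.ne) (c := (1 : ℂ)),
        hzL.coeFn_toLp, hzf ⟨s, hs, hμs.ne⟩] with ω h1 h2 h3
      rw [h1, h2]
      by_cases hω : ω ∈ s
      · simp [hω, h3 hω]
      · simp [hω]
    | add hf hg _ h1 h2 => rw [map_add, map_add, h1, h2]
    | isClosed => exact isClosed_eq l.continuous L.continuous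

end Localizable

/-! ### Preadjoints on L^1 and adjoints on L^∞. -/

section Transfer

open Filter Topology

variable {Ω : Type*} [MeasurableSpace Ω] {μ : Measure Ω}

/-- The measurable function `x` is essentially bounded. -/
def EssBdd (μ : Measure Ω) (x : Ω → ℂ) : Prop := ∃ c : ℝ, 0 ≤ c ∧ ∀ᵐ ω ∂μ, ‖x ω‖ ≤ c

lemma integrable_Lp_one_mul (y : Lp ℂ 1 μ) {g : Ω → ℂ} (hg : AEStronglyMeasurable g μ)
    (hb : EssBdd μ g) : Integrable (fun ω => y ω * g ω) μ := by
  obtain ⟨c, -, hc⟩ := hb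
  exact (Lp.memLp y).integrable_mul (memLp_top_of_bound hg c hc)

lemma norm_integral_Lp_one_mul_le (y : Lp ℂ 1 μ) {g : Ω → ℂ} {c : ℝ}
    (hc : ∀ᵐ ω ∂μ, ‖g ω‖ ≤ c) : ‖∫ ω, y ω * g ω ∂μ‖ ≤ ‖y‖ * c := by
  rw [L1.norm_eq_integral_norm, ← integral_mul_const]
  refine norm_integral_le_of_norm_le ((L1.integrable_coeFn y).norm.mul_const c) ?_
  filter_upwards [hc] with ω h
  rw [norm_mul]
  exact mul_le_mul_of_nonneg_left h (norm_nonneg _)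

lemma Lp.ae_norm_le_norm_top (z : Lp ℂ ∞ μ) : ∀ᵐ ω ∂μ, ‖z ω‖ ≤ ‖z‖ := by
  filter_upwards [ae_le_eLpNormEssSup (f := z) (μ := μ)] with ω h
  rw [← eLpNorm_exponent_top] at h
  have h2 := ENNReal.toReal_mono (Lp.eLpNorm_ne_top z) h
  rwa [toReal_enorm] at h2

lemma Lp.essBdd_top (z : Lp ℂ ∞ μ) : EssBdd μ z :=
  ⟨‖z‖, norm_nonneg _, Lp.ae_norm_le_norm_top z⟩

lemma integral_add_Lp_one_mul (y y' : Lp ℂ 1 μ) {g : Ω → ℂ} (hg : AEStronglyMeasurable g μ)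
    (hb : EssBdd μ g) : ∫ ω, (y + y' : Lp ℂ 1 μ) ω * g ω ∂μ
      = ∫ ω, y ω * g ω ∂μ + ∫ ω, y' ω * g ω ∂μ := by
  rw [← integral_add (integrable_Lp_one_mul y hg hb) (integrable_Lp_one_mul y' hg hb)]
  refine integral_congr_ae ?_
  filter_upwards [Lp.coeFn_add y y'] with ω h
  rw [h, Pi.add_apply, add_mul]

lemma integral_smul_Lp_one_mul (c : ℂ) (y : Lp ℂ 1 μ) (g : Ω → ℂ) :
    ∫ ω, (c • y : Lp ℂ 1 μ) ω * g ω ∂μ = c * ∫ ω, y ω * g ω ∂μ := by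
  rw [← integral_const_mul]
  refine integral_congr_ae ?_
  filter_upwards [Lp.coeFn_smul c y] with ω h
  rw [h, Pi.smul_apply, smul_eq_mul, mul_assoc]

lemma integral_Lp_one_mul_add {p : ℝ≥0∞} (y : Lp ℂ 1 μ) {x x' : Lp ℂ p μ} (hx : EssBdd μ x)
    (hx' : EssBdd μ x') : ∫ ω, y ω * (x + x' : Lp ℂ p μ) ω ∂μ
      = ∫ ω, y ω * x ω ∂μ + ∫ ω, y ω * x' ω ∂μ := by
  rw [← integral_add (integrable_Lp_one_mul y (Lp.aestronglyMeasurable x) hx)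
    (integrable_Lp_one_mul y (Lp.aestronglyMeasurable x') hx')]
  refine integral_congr_ae ?_
  filter_upwards [Lp.coeFn_add x x'] with ω h
  rw [h, Pi.add_apply, mul_add]

lemma integral_Lp_one_mul_smul {p : ℝ≥0∞} (y : Lp ℂ 1 μ) (c : ℂ) (x : Lp ℂ p μ) :
    ∫ ω, y ω * (c • x : Lp ℂ p μ) ω ∂μ = c * ∫ ω, y ω * x ω ∂μ := by
  rw [← integral_const_mul]
  refine integral_congr_ae ?_
  filter_upwards [Lp.coeFn_smul c x] with ω h
  rw [h, Pi.smul_apply, smul_eq_mul, mul_left_comm]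

/-- Pairing with a bounded function, as a functional on `L^1`. -/
lemma exists_pairing_functional {g : Ω → ℂ} (hg : AEStronglyMeasurable g μ) (hb : EssBdd μ g) :
    ∃ L : Lp ℂ 1 μ →L[ℂ] ℂ, ∀ y, L y = ∫ ω, y ω * g ω ∂μ := by
  obtain ⟨c, -, hc⟩ := hb
  have hgL := memLp_top_of_bound hg c hc
  refine ⟨((ContinuousLinearMap.mul ℂ ℂ).lpPairing μ 1 ∞).flip (hgL.toLp g), fun y => ?_⟩
  rw [ContinuousLinearMap.flip_apply, ContinuousLinearMap.lpPairing_eq_integral]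
  refine integral_congr_ae ?_
  filter_upwards [hgL.coeFn_toLp] with ω h
  rw [h]; rfl

lemma integral_mul_indicatorConstLp (p : ℝ≥0∞) {A : Set Ω} (hA : MeasurableSet A)
    (hμA : μ A ≠ ∞) (f : Ω → ℂ) :
    ∫ ω, f ω * (indicatorConstLp p hA hμA (1 : ℂ)) ω ∂μ = ∫ ω in A, f ω ∂μ := by
  rw [← integral_indicator hA]
  refine integral_congr_ae ?_
  filter_upwards [indicatorConstLp_coeFn (p := p) (hs := hA) (hμs := hμA) (c := (1 : ℂ))] with ω h
  rw [h]
  by_cases hω : ω ∈ A <;> simp [hω]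

lemma essBdd_indicatorConstLp (p : ℝ≥0∞) {A : Set Ω} (hA : MeasurableSet A) (hμA : μ A ≠ ∞) :
    EssBdd μ (indicatorConstLp p hA hμA (1 : ℂ)) := ⟨1, zero_le_one, by
  filter_upwards [indicatorConstLp_coeFn (p := p) (hs := hA) (hμs := hμA) (c := (1 : ℂ))] with ω h
  rw [h]
  by_cases hω : ω ∈ A <;> simp [hω]⟩

lemma Lp.ext_of_integral_mul (p : ℝ≥0∞) {w w' : Lp ℂ 1 μ}
    (h : ∀ x : Lp ℂ p μ, EssBdd μ x → ∫ ω, w ω * x ω ∂μ = ∫ ω, w' ω * x ω ∂μ) : w = w' := by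
  refine Lp.ext (Integrable.ae_eq_of_forall_setIntegral_eq _ _ (L1.integrable_coeFn w)
    (L1.integrable_coeFn w') fun s hs hμs => ?_)
  have := h _ (essBdd_indicatorConstLp p hs hμs.ne)
  rwa [integral_mul_indicatorConstLp, integral_mul_indicatorConstLp] at this

lemma IsLocalizable.ae_eq_of_forall_setIntegral_eq (hμ : IsLocalizable μ) {f g : Ω → ℂ}
    (hf : StronglyMeasurable f) (hg : StronglyMeasurable g)
    (hfi : ∀ A, MeasurableSet A → μ A < ∞ → IntegrableOn f A μ)
    (hgi : ∀ A, MeasurableSet A → μ A < ∞ → IntegrableOn g A μ)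
    (h : ∀ A, MeasurableSet A → μ A < ∞ → ∫ ω in A, f ω ∂μ = ∫ ω in A, g ω ∂μ) : f =ᵐ[μ] g := by
  have := hμ.measure_eq_zero (N := {ω | f ω = g ω}ᶜ)
    (hf.measurableSet_eq_fun hg).compl fun A hA hμA => by
      rw [measure_eq_zero_iff_ae_notMem]
      have h1 := Integrable.ae_eq_of_forall_setIntegral_eq f g (hfi A hA hμA) (hgi A hA hμA)
        fun s hs _ => by
          rw [Measure.restrict_restrict hs]
          exact h _ (hs.inter hA) ((measure_mono Set.inter_subset_right).trans_lt hμA)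
      filter_upwards [(ae_restrict_iff' hA).1 h1] with ω h2 h3
      exact h3.1 (h2 h3.2)
  rw [measure_eq_zero_iff_ae_notMem] at this
  filter_upwards [this] with ω h1
  by_contra h2
  exact h1 h2

lemma IsLocalizable.Lp_top_ext (hμ : IsLocalizable μ) {z z' : Lp ℂ ∞ μ}
    (h : ∀ y : Lp ℂ 1 μ, ∫ ω, y ω * z ω ∂μ = ∫ ω, y ω * z' ω ∂μ) : z = z' := by
  have hint : ∀ z : Lp ℂ ∞ μ, ∀ A, MeasurableSet A → μ A < ∞ → IntegrableOn z A μ :=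
    fun z A hA hμA => by
      have : IsFiniteMeasure (μ.restrict A) := ⟨by simpa using hμA⟩
      exact ((Lp.memLp z).restrict A).integrable le_top
  refine Lp.ext (hμ.ae_eq_of_forall_setIntegral_eq (Lp.stronglyMeasurable z)
    (Lp.stronglyMeasurable z') (hint z) (hint z') fun A hA hμA => ?_)
  have := h (indicatorConstLp 1 hA hμA.ne 1)
  simp only [mul_comm (indicatorConstLp 1 hA hμA.ne (1 : ℂ) _)] at this
  rwa [integral_mul_indicatorConstLp, integral_mul_indicatorConstLp] at this

/-- An operator on `L^p`, `p` even, which is bounded for the supremum norm, has a preadjoint on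
`L^1`. -/
theorem Lp.exists_preadjoint (k : ℕ) [Fact (1 ≤ ((2 * (k + 1) : ℕ) : ℝ≥0∞))]
    (V : Lp ℂ ((2 * (k + 1) : ℕ) : ℝ≥0∞) μ →L[ℂ] Lp ℂ ((2 * (k + 1) : ℕ) : ℝ≥0∞) μ) {C : ℝ}
    (hC : 0 ≤ C) (hV : ∀ (x : Lp ℂ ((2 * (k + 1) : ℕ) : ℝ≥0∞) μ) (c : ℝ), 0 ≤ c →
      (∀ᵐ ω ∂μ, ‖x ω‖ ≤ c) → ∀ᵐ ω ∂μ, ‖V x ω‖ ≤ C * c) :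
    ∃ U : Lp ℂ 1 μ →L[ℂ] Lp ℂ 1 μ, ‖U‖ ≤ C ∧
      ∀ (y : Lp ℂ 1 μ) (x : Lp ℂ ((2 * (k + 1) : ℕ) : ℝ≥0∞) μ), EssBdd μ x →
        ∫ ω, U y ω * x ω ∂μ = ∫ ω, y ω * V x ω ∂μ := by
  set p : ℝ≥0∞ := ((2 * (k + 1) : ℕ) : ℝ≥0∞) with hp
  set q := ENNReal.conjExponent p with hq
  have hpq : ENNReal.HolderConjugate q p := (inferInstance : p.HolderConjugate q).symm
  have hVb : ∀ x : Lp ℂ p μ, EssBdd μ x → EssBdd μ (V x) := by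
    rintro x ⟨c, hc0, hc⟩
    exact ⟨C * c, mul_nonneg hC hc0, hV x c hc0 hc⟩
  have hq1 : Fact (1 ≤ q) := ⟨hpq.one_le⟩
  -- L^1 ∩ L^q with the L^1 norm, dense in L^1. For y in it the pairing with V x is continuous on
  -- L^p and also bounded by C‖y‖₁ times the supremum of x.
  let S : Submodule ℂ (Lp ℂ 1 μ) :=
    { carrier := {y | MemLp y q μ}
      add_mem' := fun {y y'} hy hy' => by
        exact (hy.add hy').ae_eq (Lp.coeFn_add y y').symm
      zero_mem' := by
        exact (MemLp.zero (p := q) (μ := μ)).ae_eq (Lp.coeFn_zero ℂ 1 μ).symm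
      smul_mem' := fun c y hy => by
        exact (hy.const_smul c).ae_eq (Lp.coeFn_smul c y).symm }
  have hex : ∀ y : S, ∃ w : Lp ℂ 1 μ, ‖w‖ ≤ C * ‖y‖ ∧ ∀ x : Lp ℂ p μ, EssBdd μ x →
      ∫ ω, w ω * x ω ∂μ = ∫ ω, y.1 ω * V x ω ∂μ := by
    intro y
    have hy : MemLp y.1 q μ := y.2
    set l := ((ContinuousLinearMap.mul ℂ ℂ).lpPairing μ q p (hy.toLp y.1)).comp V with hl
    have hlapp : ∀ x, l x = ∫ ω, y.1 ω * V x ω ∂μ := fun x => by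
      rw [hl, ContinuousLinearMap.comp_apply, ContinuousLinearMap.lpPairing_eq_integral]
      refine integral_congr_ae ?_
      filter_upwards [hy.coeFn_toLp] with ω h
      rw [h]; rfl
    obtain ⟨w, hw, hwx⟩ := Lp.exists_integrable_density k l (C := C * ‖y‖)
      (mul_nonneg hC (norm_nonneg _)) fun x c hc0 hc => by
        rw [hlapp]
        refine (norm_integral_Lp_one_mul_le y.1 (hV x c hc0 hc)).trans_eq ?_
        rw [Submodule.coe_norm]; ring
    exact ⟨w, hw, fun x _ => by rw [← hwx, hlapp]⟩
  choose W hWn hW using hex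
  have hWadd : ∀ y y', W (y + y') = W y + W y' := fun y y' => by
    refine Lp.ext_of_integral_mul p fun x hx => ?_
    rw [hW _ x hx, integral_add_Lp_one_mul _ _ (Lp.aestronglyMeasurable x) hx, hW y x hx,
      hW y' x hx]
    exact integral_add_Lp_one_mul _ _ (Lp.aestronglyMeasurable (V x)) (hVb x hx)
  have hWsmul : ∀ (c : ℂ) y, W (c • y) = c • W y := fun c y => by
    refine Lp.ext_of_integral_mul p fun x hx => ?_
    rw [hW _ x hx, integral_smul_Lp_one_mul, hW y x hx]
    exact integral_smul_Lp_one_mul _ _ _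
  -- Linearity comes from uniqueness of integrable densities; the bound is in L^1 norms only, so the
  -- map extends from the dense subspace.
  set U₀ : S →L[ℂ] Lp ℂ 1 μ := LinearMap.mkContinuous ⟨⟨W, hWadd⟩, hWsmul⟩ C hWn with hU₀
  have hdense : DenseRange S.subtypeL := by
    have hcl : ∀ y : Lp ℂ 1 μ, y ∈ S.topologicalClosure := fun y => by
      induction y using Lp.induction ENNReal.one_ne_top with
      | indicatorConst c hs hμs =>
        refine Submodule.le_topologicalClosure S ?_
        rw [Lp.simpleFunc.coe_indicatorConst]
        exact (memLp_indicator_const q hs c (Or.inr hμs.ne)).ae_eq indicatorConstLp_coeFn.symm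
      | add hf hg _ h1 h2 => exact S.topologicalClosure.add_mem h1 h2
      | isClosed => exact S.isClosed_topologicalClosure
    intro y
    have := hcl y
    rw [← SetLike.mem_coe, Submodule.topologicalClosure_coe] at this
    simpa using this
  have hind : IsUniformInducing S.subtypeL := isUniformEmbedding_subtype_val.isUniformInducing
  refine ⟨U₀.extend S.subtypeL, ?_, fun y x hx => ?_⟩
  · refine (ContinuousLinearMap.opNorm_extend_le (N := 1) U₀ hdense fun y => by simp).trans ?_
    rw [NNReal.coe_one, one_mul]
    exact LinearMap.mkContinuous_norm_le _ hC _
  · obtain ⟨L, hL⟩ := exists_pairing_functional (Lp.aestronglyMeasurable x) hx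
    obtain ⟨L', hL'⟩ := exists_pairing_functional (Lp.aestronglyMeasurable (V x)) (hVb x hx)
    rw [← hL, ← hL']
    have hclosed : IsClosed {y | L ((U₀.extend S.subtypeL) y) = L' y} :=
      isClosed_eq (by fun_prop) (by fun_prop)
    refine hdense.induction_on (p := fun y => L ((U₀.extend S.subtypeL) y) = L' y) y hclosed
      fun y => ?_
    rw [ContinuousLinearMap.extend_eq _ hdense hind, hL, hL']
    exact hW y x hx

/-- The adjoint on `L^∞` of an operator on `L^1`. -/
theorem IsLocalizable.exists_adjoint (hμ : IsLocalizable μ) (U : Lp ℂ 1 μ →L[ℂ] Lp ℂ 1 μ) :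
    ∃ W : Lp ℂ ∞ μ →L[ℂ] Lp ℂ ∞ μ, ‖W‖ ≤ ‖U‖ ∧ IsAdjointOfL1 W U := by
  have hex : ∀ x : Lp ℂ ∞ μ, ∃ z : Lp ℂ ∞ μ, ‖z‖ ≤ ‖U‖ * ‖x‖ ∧
      ∀ y : Lp ℂ 1 μ, ∫ ω, U y ω * x ω ∂μ = ∫ ω, y ω * z ω ∂μ := fun x => by
    obtain ⟨L, hL⟩ := exists_pairing_functional (Lp.aestronglyMeasurable x) (Lp.essBdd_top x)
    obtain ⟨z, hz, hzy⟩ := hμ.exists_Linfty_density (L.comp U)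
    refine ⟨z, hz.trans ?_, fun y => by rw [← hzy, ← hL]; rfl⟩
    refine ContinuousLinearMap.opNorm_le_bound _ (by positivity) fun y => ?_
    rw [ContinuousLinearMap.comp_apply, hL]
    refine (norm_integral_Lp_one_mul_le (U y) (Lp.ae_norm_le_norm_top x)).trans ?_
    have := U.le_opNorm y
    calc ‖U y‖ * ‖x‖ ≤ ‖U‖ * ‖y‖ * ‖x‖ := by gcongr
      _ = _ := by ring
  choose W hWn hW using hex
  refine ⟨LinearMap.mkContinuous ⟨⟨W, fun x x' => ?_⟩, fun c x => ?_⟩ ‖U‖ hWn,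
    LinearMap.mkContinuous_norm_le _ (norm_nonneg _) _, fun y x => hW x y⟩
  · refine hμ.Lp_top_ext fun y => ?_
    rw [← hW, integral_Lp_one_mul_add _ (Lp.essBdd_top _) (Lp.essBdd_top _),
      integral_Lp_one_mul_add _ (Lp.essBdd_top _) (Lp.essBdd_top _), hW, hW]
  · refine hμ.Lp_top_ext fun y => ?_
    rw [← hW, integral_Lp_one_mul_smul, RingHom.id_apply, integral_Lp_one_mul_smul, hW]

end Transfer

/-! ### Transfer of algebra homomorphisms from L^p to L^∞. -/

section TransferAlgebra

variable {Ω : Type*} [MeasurableSpace Ω] {μ : Measure Ω} {p : ℝ≥0∞} [Fact (1 ≤ p)]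

/-- The operator `W` on `L^∞` and the operator `V` on `L^p` are dual to the same operator on
`L^1`. -/
def Transfers (V : Lp ℂ p μ →L[ℂ] Lp ℂ p μ) (W : Lp ℂ ∞ μ →L[ℂ] Lp ℂ ∞ μ) : Prop :=
  ∃ U : Lp ℂ 1 μ →L[ℂ] Lp ℂ 1 μ, (∀ (y : Lp ℂ 1 μ) (x : Lp ℂ p μ), EssBdd μ x →
    ∫ ω, U y ω * x ω ∂μ = ∫ ω, y ω * V x ω ∂μ) ∧ IsAdjointOfL1 W U

/-- Bounded vectors of L^p separate L^1, so V determines U; L^1 separates L^∞ by semifiniteness, so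
U determines W. -/
lemma Transfers.unique (hμ : IsLocalizable μ) {V : Lp ℂ p μ →L[ℂ] Lp ℂ p μ}
    {W W' : Lp ℂ ∞ μ →L[ℂ] Lp ℂ ∞ μ} (h : Transfers V W) (h' : Transfers V W') : W = W' := by
  obtain ⟨U, hU, hW⟩ := h
  obtain ⟨U', hU', hW'⟩ := h'
  have e : U = U' := ContinuousLinearMap.ext fun y =>
    Lp.ext_of_integral_mul p fun x hx => by rw [hU y x hx, hU' y x hx]
  subst e
  exact ContinuousLinearMap.ext fun x => hμ.Lp_top_ext fun y => by rw [← hW, ← hW']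

lemma Transfers.one : Transfers (1 : Lp ℂ p μ →L[ℂ] Lp ℂ p μ) (1 : Lp ℂ ∞ μ →L[ℂ] Lp ℂ ∞ μ) :=
  ⟨1, fun _ _ _ => rfl, fun _ _ => rfl⟩

lemma Transfers.add {V V' : Lp ℂ p μ →L[ℂ] Lp ℂ p μ} {W W' : Lp ℂ ∞ μ →L[ℂ] Lp ℂ ∞ μ}
    (hV : ∀ x : Lp ℂ p μ, EssBdd μ x → EssBdd μ (V x))
    (hV' : ∀ x : Lp ℂ p μ, EssBdd μ x → EssBdd μ (V' x))
    (h : Transfers V W) (h' : Transfers V' W') : Transfers (V + V') (W + W') := by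
  obtain ⟨U, hU, hW⟩ := h
  obtain ⟨U', hU', hW'⟩ := h'
  refine ⟨U + U', fun y x hx => ?_, fun y x => ?_⟩
  · simp only [add_apply]
    rw [integral_add_Lp_one_mul _ _ (Lp.aestronglyMeasurable x) hx,
      integral_Lp_one_mul_add _ (hV x hx) (hV' x hx), hU y x hx, hU' y x hx]
  · simp only [add_apply]
    rw [integral_add_Lp_one_mul _ _ (Lp.aestronglyMeasurable x) (Lp.essBdd_top x),
      integral_Lp_one_mul_add _ (Lp.essBdd_top _) (Lp.essBdd_top _), hW, hW']

lemma Transfers.smul (c : ℂ) {V : Lp ℂ p μ →L[ℂ] Lp ℂ p μ} {W : Lp ℂ ∞ μ →L[ℂ] Lp ℂ ∞ μ}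
    (h : Transfers V W) : Transfers (c • V) (c • W) := by
  obtain ⟨U, hU, hW⟩ := h
  refine ⟨c • U, fun y x hx => ?_, fun y x => ?_⟩
  · simp only [smul_apply]
    rw [integral_smul_Lp_one_mul, integral_Lp_one_mul_smul, hU y x hx]
  · simp only [smul_apply]
    rw [integral_smul_Lp_one_mul, integral_Lp_one_mul_smul, hW]

/-- The intermediate operator on L^1 is `U' * U`: order is reversed on the way down and restored on
the way up. -/
lemma Transfers.mul {V V' : Lp ℂ p μ →L[ℂ] Lp ℂ p μ} {W W' : Lp ℂ ∞ μ →L[ℂ] Lp ℂ ∞ μ}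
    (hV' : ∀ x : Lp ℂ p μ, EssBdd μ x → EssBdd μ (V' x))
    (h : Transfers V W) (h' : Transfers V' W') : Transfers (V * V') (W * W') := by
  obtain ⟨U, hU, hW⟩ := h
  obtain ⟨U', hU', hW'⟩ := h'
  refine ⟨U' * U, fun y x hx => ?_, fun y x => ?_⟩
  · simp only [mul_apply_eq_comp]
    rw [hU' _ x hx, hU y _ (hV' x hx)]
  · simp only [mul_apply_eq_comp]
    rw [hW', hW]

/-- A homomorphism into the operators on `L^p`, `p` even, with values bounded for the supremum norm
transfers to `L^∞`. -/
theorem IsLocalizable.exists_algHom_transfers (hμ : IsLocalizable μ) (k : ℕ)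
    [Fact (1 ≤ ((2 * (k + 1) : ℕ) : ℝ≥0∞))] {A : Type*} [Ring A] [Algebra ℂ A]
    (Ψ : A →ₐ[ℂ] (Lp ℂ ((2 * (k + 1) : ℕ) : ℝ≥0∞) μ →L[ℂ] Lp ℂ ((2 * (k + 1) : ℕ) : ℝ≥0∞) μ))
    {C : A → ℝ} (hC : ∀ a, 0 ≤ C a)
    (hΨ : ∀ a (x : Lp ℂ ((2 * (k + 1) : ℕ) : ℝ≥0∞) μ) (c : ℝ), 0 ≤ c →
      (∀ᵐ ω ∂μ, ‖x ω‖ ≤ c) → ∀ᵐ ω ∂μ, ‖Ψ a x ω‖ ≤ C a * c) :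
    ∃ Θ : A →ₐ[ℂ] (Lp ℂ ∞ μ →L[ℂ] Lp ℂ ∞ μ), ∀ a, ‖Θ a‖ ≤ C a ∧ Transfers (Ψ a) (Θ a) := by
  have hb : ∀ a (x : Lp ℂ ((2 * (k + 1) : ℕ) : ℝ≥0∞) μ), EssBdd μ x → EssBdd μ (Ψ a x) := by
    rintro a x ⟨c, hc0, hc⟩
    exact ⟨C a * c, mul_nonneg (hC a) hc0, hΨ a x c hc0 hc⟩
  have hex : ∀ a, ∃ W : Lp ℂ ∞ μ →L[ℂ] Lp ℂ ∞ μ, ‖W‖ ≤ C a ∧ Transfers (Ψ a) W := fun a => by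
    obtain ⟨U, hUn, hU⟩ := Lp.exists_preadjoint k (Ψ a) (hC a) (hΨ a)
    obtain ⟨W, hWn, hW⟩ := hμ.exists_adjoint U
    exact ⟨W, hWn.trans hUn, U, hU, hW⟩
  choose W hWn hW using hex
  refine ⟨AlgHom.ofLinearMap ⟨⟨W, fun a b => ?_⟩, fun c a => ?_⟩ ?_ fun a b => ?_,
    fun a => ⟨hWn a, hW a⟩⟩
  · refine (hW (a + b)).unique hμ ?_
    rw [map_add]
    exact (hW a).add (hb a) (hb b) (hW b)
  · refine (hW (c • a)).unique hμ ?_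
    rw [map_smul]
    exact (hW a).smul c
  · refine (hW 1).unique hμ ?_
    rw [map_one]
    exact Transfers.one
  · refine (hW (a * b)).unique hμ ?_
    rw [map_mul]
    exact (hW a).mul (hb b) (hW b)

end TransferAlgebra

/-! ### From uniform L^n bounds to a supremum bound. -/

section Exponents

open Filter Topology

variable {Ω : Type*} [MeasurableSpace Ω] {μ : Measure Ω} {σ : Compacts ℝ}

lemma lintegral_rpow_le_of_ae_le {f : Ω → ℂ} {c : ℝ≥0∞} {p q : ℝ} (hp : 0 ≤ p) (hpq : p ≤ q)
    (h : ∀ᵐ ω ∂μ, ‖f ω‖ₑ ≤ c) (hc : c ≠ ∞) :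
    ∫⁻ ω, ‖f ω‖ₑ ^ q ∂μ ≤ c ^ (q - p) * ∫⁻ ω, ‖f ω‖ₑ ^ p ∂μ := by
  rw [← lintegral_const_mul' _ _ (ENNReal.rpow_ne_top_of_nonneg (by linarith) hc)]
  refine lintegral_mono_ae ?_
  filter_upwards [h] with ω hω
  calc ‖f ω‖ₑ ^ q = ‖f ω‖ₑ ^ (q - p) * ‖f ω‖ₑ ^ p := by
        rw [← ENNReal.rpow_add_of_nonneg _ _ (by linarith) hp, sub_add_cancel]
    _ ≤ _ := by gcongr

lemma MeasureTheory.MemLp.of_exponent_le_of_ae_le {f : Ω → ℂ} {c : ℝ≥0∞} {p q : ℝ≥0∞} (hp : p ≠ 0)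
    (hpq : p ≤ q) (hq : q ≠ ∞) (hf : MemLp f p μ) (h : ∀ᵐ ω ∂μ, ‖f ω‖ₑ ≤ c) (hc : c ≠ ∞) :
    MemLp f q μ := by
  have hp' : p ≠ ∞ := ne_top_of_le_ne_top hq hpq
  have hpq' : p.toReal ≤ q.toReal := ENNReal.toReal_mono hq hpq
  refine ⟨hf.1, ?_⟩
  rw [eLpNorm_lt_top_iff_lintegral_rpow_enorm_lt_top (hp.bot_lt.trans_le hpq).ne' hq]
  refine (lintegral_rpow_le_of_ae_le ENNReal.toReal_nonneg hpq' h hc).trans_lt ?_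
  exact ENNReal.mul_lt_top (ENNReal.rpow_lt_top_of_nonneg (by linarith) hc)
    ((eLpNorm_lt_top_iff_lintegral_rpow_enorm_lt_top hp hp').1 hf.2)

/-- A bound for the norms in `L^n`, for all large `n`, gives a bound for the supremum norm. -/
lemma ae_enorm_le_of_forall_eLpNorm_le {x v : Ω → ℂ} {m : ℕ} (hm : m ≠ 0) {c K : ℝ≥0∞}
    (hK : K ≠ ∞) (hc0 : c ≠ 0) (hc : c ≠ ∞) (hx : MemLp x m μ) (hv : AEStronglyMeasurable v μ)
    (hxc : ∀ᵐ ω ∂μ, ‖x ω‖ₑ ≤ c)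
    (h : ∀ n : ℕ, m ≤ n → eLpNorm v n μ ≤ K * eLpNorm x n μ) : ∀ᵐ ω ∂μ, ‖v ω‖ₑ ≤ K * c := by
  have hm' : (m : ℝ≥0∞) ≠ 0 := by exact_mod_cast hm
  set I := ∫⁻ ω, ‖x ω‖ₑ ^ (m : ℝ) ∂μ with hI
  have hIfin : I < ∞ := by
    simpa [hI] using (eLpNorm_lt_top_iff_lintegral_rpow_enorm_lt_top hm' (ENNReal.natCast_ne_top m)).1
      hx.2
  have key : ∀ t : ℝ≥0∞, t ≠ ∞ → K * c < t → μ {ω | t ≤ ‖v ω‖ₑ} = 0 := by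
    intro t ht hKt
    have ht0 : t ≠ 0 := (bot_le.trans_lt hKt).ne'
    -- Chebyshev's inequality with exponent N = n + m, where the N-th moment of x is at most c^n
    -- times its m-th moment. For t > Kc the right side tends to 0 geometrically.
    have hb : ∀ n : ℕ, μ {ω | t ≤ ‖v ω‖ₑ} ≤ (K * c / t) ^ (n + m) * (I / c ^ m) := fun n => by
      have hnm : ((n + m : ℕ) : ℝ≥0∞) ≠ 0 := by exact_mod_cast (by omega)
      have h1 := mul_meas_ge_le_pow_eLpNorm' μ hnm (ENNReal.natCast_ne_top _) hv t
      have h2 := h (n + m) (by omega)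
      have h3 := lintegral_rpow_le_of_ae_le (p := m) (q := (n + m : ℕ)) (by positivity)
        (by push_cast; linarith [(Nat.cast_nonneg n : (0 : ℝ) ≤ n)]) hxc hc
      have h4 : eLpNorm x (n + m : ℕ) μ ^ (n + m) = ∫⁻ ω, ‖x ω‖ₑ ^ ((n + m : ℕ) : ℝ) ∂μ := by
        have := eLpNorm_nnreal_pow_eq_lintegral (μ := μ) (f := x) (p := ((n + m : ℕ) : NNReal))
          (by exact_mod_cast (by omega : n + m ≠ 0))
        simpa [← ENNReal.rpow_natCast] using this
      rw [ENNReal.toReal_natCast, ENNReal.rpow_natCast, ENNReal.rpow_natCast] at h1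
      have e : ((n + m : ℕ) : ℝ) - (m : ℝ) = (n : ℝ) := by push_cast; ring
      rw [e, ENNReal.rpow_natCast, ← h4] at h3
      have h5 : t ^ (n + m) * μ {ω | t ≤ ‖v ω‖ₑ} ≤ K ^ (n + m) * (c ^ n * I) :=
        calc _ ≤ _ := h1
          _ ≤ (K * eLpNorm x (n + m : ℕ) μ) ^ (n + m) := by gcongr
          _ ≤ _ := by rw [mul_pow]; gcongr
      have hcm : c ^ m ≠ 0 := pow_ne_zero _ hc0
      have hcm' : c ^ m ≠ ∞ := ENNReal.pow_ne_top hc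
      have htm : t ^ (n + m) ≠ 0 := pow_ne_zero _ ht0
      have htm' : t ^ (n + m) ≠ ∞ := ENNReal.pow_ne_top ht
      calc μ {ω | t ≤ ‖v ω‖ₑ} ≤ K ^ (n + m) * (c ^ n * I) / t ^ (n + m) := by
            rw [ENNReal.le_div_iff_mul_le (Or.inl htm) (Or.inl htm'), mul_comm]; exact h5
        _ = _ := by
            have e2 : c ^ n * I = c ^ (n + m) * (I / c ^ m) := by
              rw [pow_add, mul_assoc, ENNReal.mul_div_cancel hcm hcm']
            rw [e2, ENNReal.div_eq_inv_mul, ENNReal.div_eq_inv_mul (a := K * c), mul_pow, mul_pow,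
              ENNReal.inv_pow, mul_assoc, mul_assoc]
    have hρ : K * c / t < 1 := by
      rw [ENNReal.div_lt_iff (Or.inl ht0) (Or.inl ht), one_mul]; exact hKt
    have hlim : Tendsto (fun n : ℕ => (K * c / t) ^ (n + m) * (I / c ^ m)) atTop (𝓝 0) := by
      have := (ENNReal.tendsto_pow_atTop_nhds_zero_of_lt_one hρ).comp (tendsto_add_atTop_nat m)
      have h2 := ENNReal.Tendsto.mul_const (b := I / c ^ m) this
        (Or.inr (ENNReal.div_lt_top hIfin.ne (pow_ne_zero _ hc0)).ne)
      simpa using h2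
    exact le_antisymm (ge_of_tendsto' hlim hb) bot_le
  have hall : ∀ᵐ ω ∂μ, ∀ n : ℕ, ‖v ω‖ₑ < K * c + (n + 1 : ℝ≥0∞)⁻¹ := by
    rw [ae_all_iff]
    intro n
    have hpos : ((n : ℝ≥0∞) + 1)⁻¹ ≠ 0 := by simp
    have hfin : ((n : ℝ≥0∞) + 1)⁻¹ ≠ ∞ := by simp
    have hKc : K * c ≠ ∞ := ENNReal.mul_ne_top hK hc
    have := key (K * c + (n + 1 : ℝ≥0∞)⁻¹) (ENNReal.add_ne_top.2 ⟨hKc, hfin⟩)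
      (ENNReal.lt_add_right hKc hpos)
    rw [measure_eq_zero_iff_ae_notMem] at this
    filter_upwards [this] with ω hω
    exact not_le.1 hω
  filter_upwards [hall] with ω hω
  have hlim : Tendsto (fun n : ℕ => K * c + (n + 1 : ℝ≥0∞)⁻¹) atTop (𝓝 (K * c + 0)) := by
    refine Tendsto.const_add _ ?_
    have := ENNReal.tendsto_inv_nat_nhds_zero.comp (tendsto_add_atTop_nat 1)
    simpa [Function.comp_def] using this
  rw [add_zero] at hlim
  exact ge_of_tendsto' hlim fun n => (hω n).le

end Exponents

/-! ### Consistency of the calculi across exponents. -/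

section Consistency

open Filter Topology

variable {Ω : Type*} [MeasurableSpace Ω] {μ : Measure Ω} {σ : Compacts ℝ} {p q : ℝ≥0∞}
  [Fact (1 ≤ p)] [Fact (1 ≤ q)]

/-- Convergence in either norm implies convergence in measure, whose limit is unique almost
everywhere. -/
lemma Lp.coe_eq_of_tendsto {u : ℕ → Lp ℂ p μ} {v : ℕ → Lp ℂ q μ} {a : Lp ℂ p μ} {b : Lp ℂ q μ}
    (hu : Tendsto u atTop (𝓝 a)) (hv : Tendsto v atTop (𝓝 b))
    (h : ∀ n, (u n : Ω →ₘ[μ] ℂ) = v n) : (a : Ω →ₘ[μ] ℂ) = b := by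
  refine AEEqFun.ext (tendstoInMeasure_ae_unique (tendstoInMeasure_of_tendsto_Lp hu) ?_)
  have e : (fun n => (u n : Ω → ℂ)) = fun n => (v n : Ω → ℂ) := funext fun n =>
    congrArg (fun w : Ω →ₘ[μ] ℂ => (w : Ω → ℂ)) (h n)
  rw [e]
  exact tendstoInMeasure_of_tendsto_Lp hv

lemma Lp.isClosed_setOf_ae_norm_le (c : ℝ) : IsClosed {v : Lp ℂ p μ | ∀ᵐ ω ∂μ, ‖v ω‖ ≤ c} := by
  refine IsSeqClosed.isClosed fun u a hu ha => ?_
  obtain ⟨ns, -, h⟩ := (tendstoInMeasure_of_tendsto_Lp ha).exists_seq_tendsto_ae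
  have hall : ∀ᵐ ω ∂μ, ∀ n, ‖u n ω‖ ≤ c := ae_all_iff.2 hu
  filter_upwards [h, hall] with ω h1 h2
  exact le_of_tendsto' h1.norm fun n => h2 _

lemma DefinesOnLp.coe_eq {T : (Ω →ₘ[μ] ℂ) →ₗ.[ℂ] (Ω →ₘ[μ] ℂ)} {S : Lp ℂ p μ →L[ℂ] Lp ℂ p μ}
    {S' : Lp ℂ q μ →L[ℂ] Lp ℂ q μ} (hS : DefinesOnLp T p S) (hS' : DefinesOnLp T q S')
    {x : Lp ℂ p μ} {x' : Lp ℂ q μ} (h : (x : Ω →ₘ[μ] ℂ) = x') :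
    (S x : Ω →ₘ[μ] ℂ) = S' x' := by
  obtain ⟨h1, e1⟩ := hS x
  obtain ⟨h2, e2⟩ := hS' x'
  rw [← e1, ← e2]
  congr 1
  exact Subtype.ext h

lemma coe_aeval_eq {S : Lp ℂ p μ →L[ℂ] Lp ℂ p μ} {S' : Lp ℂ q μ →L[ℂ] Lp ℂ q μ}
    (hS : ∀ (x : Lp ℂ p μ) (x' : Lp ℂ q μ), (x : Ω →ₘ[μ] ℂ) = x' → (S x : Ω →ₘ[μ] ℂ) = S' x')
    (P : ℂ[X]) {x : Lp ℂ p μ} {x' : Lp ℂ q μ} (h : (x : Ω →ₘ[μ] ℂ) = x') :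
    (Polynomial.aeval S P x : Ω →ₘ[μ] ℂ) = Polynomial.aeval S' P x' := by
  induction P using Polynomial.induction_on' with
  | add P Q hP hQ =>
    rw [map_add, map_add, add_apply, add_apply, AddSubgroup.coe_add, AddSubgroup.coe_add, hP, hQ]
  | monomial n a =>
    have hn : ∀ n : ℕ, ∀ (x : Lp ℂ p μ) (x' : Lp ℂ q μ), (x : Ω →ₘ[μ] ℂ) = x' →
        ((S ^ n) x : Ω →ₘ[μ] ℂ) = (S' ^ n) x' := by
      intro n
      induction n with
      | zero => intro x x' h; simpa using h
      | succ n ih =>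
        intro x x' h
        rw [pow_succ, pow_succ]
        exact ih _ _ (hS _ _ h)
    rw [Polynomial.aeval_monomial, Polynomial.aeval_monomial, ← Algebra.smul_def,
      ← Algebra.smul_def]
    exact congrArg (fun w : Ω →ₘ[μ] ℂ => a • w) (hn n x x' h)

/-- Functional calculi of operators defined by the same transformation agree. -/
lemma IsACCalculus.coe_eq {T : (Ω →ₘ[μ] ℂ) →ₗ.[ℂ] (Ω →ₘ[μ] ℂ)} {S : Lp ℂ p μ →L[ℂ] Lp ℂ p μ}
    {S' : Lp ℂ q μ →L[ℂ] Lp ℂ q μ} (hS : DefinesOnLp T p S) (hS' : DefinesOnLp T q S')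
    {M : ℝ} {Φ : AC σ →ₐ[ℂ] (Lp ℂ p μ →L[ℂ] Lp ℂ p μ)}
    {Φ' : AC σ →ₐ[ℂ] (Lp ℂ q μ →L[ℂ] Lp ℂ q μ)} (hM : 0 ≤ M) (hΦ : IsACCalculus σ S M Φ)
    (hΦ' : IsACCalculus σ S' M Φ') (g : AC σ) {x : Lp ℂ p μ} {x' : Lp ℂ q μ}
    (h : (x : Ω →ₘ[μ] ℂ) = x') : (Φ g x : Ω →ₘ[μ] ℂ) = Φ' g x' := by
  -- One sequence of polynomials approximates g on both spaces at once; polynomials in the two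
  -- operators agree on a common vector.
  have hex : ∀ n : ℕ, ∃ P : ℂ[X], bvNorm (g - polyAC σ P).1.1 < 1 / ((n : ℝ) + 1) := fun n =>
    g.2 _ (by positivity)
  choose P hP using hex
  have hlim : ∀ K : ℝ, Tendsto (fun n : ℕ => M * (1 / ((n : ℝ) + 1)) * K) atTop (𝓝 0) := fun K => by
    simpa using (tendsto_one_div_add_atTop_nhds_zero_nat (𝕜 := ℝ)).const_mul M |>.mul_const K
  refine Lp.coe_eq_of_tendsto (u := fun n => Φ (polyAC σ (P n)) x)
    (v := fun n => Φ' (polyAC σ (P n)) x') ?_ ?_ fun n => ?_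
  · rw [tendsto_iff_norm_sub_tendsto_zero]
    refine squeeze_zero (fun _ => norm_nonneg _) (fun n => ?_) (hlim ‖x‖)
    rw [norm_sub_rev, ← sub_apply, ← map_sub]
    refine (ACCalculus.norm_apply_le hΦ.2 _ x).trans ?_
    gcongr
    exact (hP n).le
  · rw [tendsto_iff_norm_sub_tendsto_zero]
    refine squeeze_zero (fun _ => norm_nonneg _) (fun n => ?_) (hlim ‖x'‖)
    rw [norm_sub_rev, ← sub_apply, ← map_sub]
    refine (ACCalculus.norm_apply_le hΦ'.2 _ x').trans ?_
    gcongr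
    exact (hP n).le
  · simp only [polyAC_eq_aeval, ← Polynomial.aeval_algHom_apply, hΦ.1, hΦ'.1]
    exact coe_aeval_eq (fun _ _ => hS.coe_eq hS') (P n) h

variable {r : ℝ≥0∞} {M : ℝ} {T : (Ω →ₘ[μ] ℂ) →ₗ.[ℂ] (Ω →ₘ[μ] ℂ)}

/-- A functional calculus which is uniformly bounded on the spaces `L^p` for large `p` is bounded
for the supremum norm. -/
theorem IsACCalculus.ae_norm_le (hM : 0 ≤ M)
    (hT : ∀ (p : ℝ≥0∞) [Fact (1 ≤ p)], r < p → p < ∞ →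
      ∃ S : Lp ℂ p μ →L[ℂ] Lp ℂ p μ, DefinesOnLp T p S ∧
        ∃ Φ : AC σ →ₐ[ℂ] (Lp ℂ p μ →L[ℂ] Lp ℂ p μ), IsACCalculus σ S M Φ)
    {m : ℕ} [hm1 : Fact (1 ≤ (m : ℝ≥0∞))] (hm : r < m) {S : Lp ℂ m μ →L[ℂ] Lp ℂ m μ}
    (hS : DefinesOnLp T m S) {Φ : AC σ →ₐ[ℂ] (Lp ℂ m μ →L[ℂ] Lp ℂ m μ)}
    (hΦ : IsACCalculus σ S M Φ) (g : AC σ) (x : Lp ℂ m μ) {c : ℝ} (hc : 0 ≤ c)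
    (hxc : ∀ᵐ ω ∂μ, ‖x ω‖ ≤ c) : ∀ᵐ ω ∂μ, ‖Φ g x ω‖ ≤ M * bvNorm g.1.1 * c := by
  have hK : 0 ≤ M * bvNorm g.1.1 := mul_nonneg hM bvNorm_nonneg
  rcases hc.eq_or_lt with rfl | hc0
  · have hx0 : x = 0 := by
      rw [Lp.eq_zero_iff_ae_eq_zero]
      filter_upwards [hxc] with ω h
      exact norm_le_zero_iff.1 h
    rw [hx0, map_zero]
    filter_upwards [Lp.coeFn_zero ℂ m μ] with ω h
    rw [h]; simp
  · have hm0 : m ≠ 0 := by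
      rintro rfl
      simpa using hm1.out
    have hxc' : ∀ᵐ ω ∂μ, ‖x ω‖ₑ ≤ ENNReal.ofReal c := by
      filter_upwards [hxc] with ω h
      rw [← ofReal_norm]
      exact ENNReal.ofReal_le_ofReal h
    have := ae_enorm_le_of_forall_eLpNorm_le (v := Φ g x) hm0 (c := ENNReal.ofReal c)
      (K := ENNReal.ofReal (M * bvNorm g.1.1)) ENNReal.ofReal_ne_top (by simpa using hc0)
      ENNReal.ofReal_ne_top (Lp.memLp x) (Lp.aestronglyMeasurable _) hxc' fun n hmn => by
        have hmn' : (m : ℝ≥0∞) ≤ n := by exact_mod_cast hmn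
        have : Fact (1 ≤ (n : ℝ≥0∞)) := ⟨hm1.out.trans hmn'⟩
        obtain ⟨S', hS', Φ', hΦ'⟩ := hT n (hm.trans_le hmn') (ENNReal.natCast_lt_top n)
        have hxn : MemLp x n μ := (Lp.memLp x).of_exponent_le_of_ae_le (by exact_mod_cast hm0) hmn'
          (ENNReal.natCast_ne_top n) hxc' ENNReal.ofReal_ne_top
        have hxe : (x : Ω →ₘ[μ] ℂ) = hxn.toLp x := AEEqFun.ext hxn.coeFn_toLp.symm
        have e1 := hΦ.coe_eq hS hS' hM hΦ' g hxe
        have e2 : (Φ g x : Ω → ℂ) = Φ' g (hxn.toLp x) :=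
          congrArg (fun w : Ω →ₘ[μ] ℂ => (w : Ω → ℂ)) e1
        have e3 : (x : Ω → ℂ) = hxn.toLp x := congrArg (fun w : Ω →ₘ[μ] ℂ => (w : Ω → ℂ)) hxe
        rw [e2, show eLpNorm x n μ = eLpNorm (hxn.toLp x) n μ from congrArg (eLpNorm · n μ) e3,
          ← Lp.enorm_def, ← Lp.enorm_def, ← ofReal_norm, ← ofReal_norm, ← ENNReal.ofReal_mul hK]
        exact ENNReal.ofReal_le_ofReal (ACCalculus.norm_apply_le hΦ'.2 g _)
    filter_upwards [this] with ω h
    rw [← ofReal_norm, ← ENNReal.ofReal_mul hK] at h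
    exact (ENNReal.ofReal_le_ofReal_iff (mul_nonneg hK hc)).1 h

end Consistency

/-! ### Agreement of the L^∞ operator with the L^q operators. -/

section Compatibility

open Filter Topology

variable {Ω : Type*} [MeasurableSpace Ω] {μ : Measure Ω} {p q : ℝ≥0∞}
  [Fact (1 ≤ p)] [Fact (1 ≤ q)]

/-- Integration over a set of finite measure, as a functional on `L^p`. -/
lemma exists_setIntegral_functional {A : Set Ω} (hA : MeasurableSet A) (hμA : μ A ≠ ∞) :
    ∃ L : Lp ℂ p μ →L[ℂ] ℂ, ∀ x, L x = ∫ ω in A, x ω ∂μ := by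
  have hpq : ENNReal.HolderConjugate p.conjExponent p :=
    (inferInstance : p.HolderConjugate p.conjExponent).symm
  have hq1 : Fact (1 ≤ p.conjExponent) := ⟨hpq.one_le⟩
  refine ⟨(ContinuousLinearMap.mul ℂ ℂ).lpPairing μ p.conjExponent p
    (indicatorConstLp _ hA hμA 1), fun x => ?_⟩
  rw [ContinuousLinearMap.lpPairing_eq_integral, ← integral_mul_indicatorConstLp p.conjExponent hA
    hμA]
  simp only [ContinuousLinearMap.mul_apply', mul_comm]

/-- An operator on `L^∞` which is transferred from `L^p` agrees on `L^q ∩ L^∞` with the operators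
on `L^q` that are consistent with the one on `L^p`. -/
lemma Transfers.coe_eq (hμ : IsLocalizable μ) {V : Lp ℂ p μ →L[ℂ] Lp ℂ p μ}
    {W : Lp ℂ ∞ μ →L[ℂ] Lp ℂ ∞ μ} (hVW : Transfers V W) (hq : q ≠ ∞)
    {S : Lp ℂ q μ →L[ℂ] Lp ℂ q μ} (hVS : ∀ (x : Lp ℂ p μ) (x' : Lp ℂ q μ),
      (x : Ω →ₘ[μ] ℂ) = x' → (V x : Ω →ₘ[μ] ℂ) = S x') {x : Lp ℂ q μ} {z : Lp ℂ ∞ μ}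
    (h : (x : Ω →ₘ[μ] ℂ) = z) : (S x : Ω →ₘ[μ] ℂ) = W z := by
  obtain ⟨U, hU, hUW⟩ := hVW
  have hq0 : q ≠ 0 := (zero_lt_one.trans_le Fact.out).ne'
  have hfz : (x : Ω → ℂ) = z := congrArg (fun w : Ω →ₘ[μ] ℂ => (w : Ω → ℂ)) h
  have hf : Measurable (x : Ω → ℂ) := (Lp.stronglyMeasurable x).measurable
  -- Simple functions in L^q have support of finite measure, hence lie in L^p as well, where V and S
  -- can be compared; they stay below 2‖z‖ and converge pointwise to x.
  set s : ℕ → SimpleFunc Ω ℂ :=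
    fun n => SimpleFunc.approxOn x hf (Set.range x ∪ {0}) 0 (by simp) n with hs
  have hsq : ∀ n, MemLp (s n) q μ := SimpleFunc.memLp_approxOn_range hf (Lp.memLp x)
  have hsp : ∀ n, MemLp (s n) p μ := fun n =>
    SimpleFunc.memLp_of_finite_measure_preimage p ((SimpleFunc.memLp_iff hq0 hq).1 (hsq n))
  have hsb : ∀ n, ∀ᵐ ω ∂μ, ‖s n ω‖ ≤ 2 * ‖z‖ := fun n => by
    filter_upwards [Lp.ae_norm_le_norm_top z] with ω hω
    have := SimpleFunc.norm_approxOn_zero_le hf (s := Set.range x ∪ {0}) (by simp) ω n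
    rw [← hfz] at hω
    exact this.trans (by linarith)
  have hslim : ∀ ω, Tendsto (fun n => s n ω) atTop (𝓝 (x ω)) := fun ω =>
    SimpleFunc.tendsto_approxOn hf _ (subset_closure (by simp))
  have hint : ∀ {p : ℝ≥0∞} [Fact (1 ≤ p)] (y : Lp ℂ p μ) (A), MeasurableSet A → μ A < ∞ →
      IntegrableOn y A μ := fun y A _ hμA => by
    have : IsFiniteMeasure (μ.restrict A) := ⟨by simpa using hμA⟩
    exact ((Lp.memLp y).restrict A).integrable Fact.out
  refine AEEqFun.ext (hμ.ae_eq_of_forall_setIntegral_eq (Lp.stronglyMeasurable (S x))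
    (Lp.stronglyMeasurable (W z)) (hint _) (hint _) fun A hA hμA => ?_)
  set y : Lp ℂ 1 μ := indicatorConstLp 1 hA hμA.ne 1 with hy
  have hyA : ∀ f : Ω → ℂ, ∫ ω, y ω * f ω ∂μ = ∫ ω in A, f ω ∂μ := fun f => by
    rw [← integral_mul_indicatorConstLp 1 hA hμA.ne]
    simp only [hy, mul_comm]
  have h1 : Tendsto (fun n => ∫ ω in A, S ((hsq n).toLp (s n)) ω ∂μ) atTop
      (𝓝 (∫ ω in A, S x ω ∂μ)) := by
    obtain ⟨L, hL⟩ := exists_setIntegral_functional (p := q) hA hμA.ne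
    simp only [← hL]
    have hl := SimpleFunc.tendsto_approxOn_range_Lp hq hf (Lp.memLp x)
    rw [Lp.toLp_coeFn] at hl
    exact ((L.comp S).continuous.tendsto x).comp hl
  -- The same integrals are pairings of U y ∈ L^1 with a bounded pointwise convergent sequence.
  -- Dominated convergence replaces norm convergence, which simple functions of finite support need
  -- not have in L^∞.
  have h2 : Tendsto (fun n => ∫ ω in A, S ((hsq n).toLp (s n)) ω ∂μ) atTop
      (𝓝 (∫ ω in A, W z ω ∂μ)) := by
    have e : ∀ n, ∫ ω in A, S ((hsq n).toLp (s n)) ω ∂μ = ∫ ω, U y ω * s n ω ∂μ := fun n => by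
      have e1 : (((hsp n).toLp (s n) : Lp ℂ p μ) : Ω →ₘ[μ] ℂ) = (hsq n).toLp (s n) := rfl
      have e2 : (V ((hsp n).toLp (s n)) : Ω → ℂ) = S ((hsq n).toLp (s n)) :=
        congrArg (fun w : Ω →ₘ[μ] ℂ => (w : Ω → ℂ)) (hVS _ _ e1)
      rw [← e2, ← hyA, ← hU]
      · refine integral_congr_ae ?_
        filter_upwards [(hsp n).coeFn_toLp] with ω hω
        rw [hω]
      · refine ⟨2 * ‖z‖, by positivity, ?_⟩
        filter_upwards [(hsp n).coeFn_toLp, hsb n] with ω hω hb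
        rwa [hω]
    simp only [e]
    rw [← hyA, ← hUW]
    refine tendsto_integral_of_dominated_convergence (fun ω => ‖U y ω‖ * (2 * ‖z‖)) (fun n => ?_)
      ((L1.integrable_coeFn (U y)).norm.mul_const _) (fun n => ?_) ?_
    · exact (Lp.aestronglyMeasurable (U y)).mul (s n).aestronglyMeasurable
    · filter_upwards [hsb n] with ω hω
      rw [norm_mul]
      gcongr
    · refine ae_of_all _ fun ω => ?_
      rw [← hfz]
      exact (hslim ω).const_mul _
  exact tendsto_nhds_unique h1 h2

end Compatibility

/-! ### Bounded elements of the span, and extension of the transformation. -/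

section Span

variable {Ω : Type*} [MeasurableSpace Ω] {μ : Measure Ω} {r : ℝ≥0∞}

/-- Also discarding the set where the function is at least 1 in modulus, of finite measure by
Chebyshev's inequality, leaves a function bounded by 1, for which the exponent may be raised. -/
lemma exists_memLp_indicator_compl_of_le {x : Ω → ℂ} (hx : StronglyMeasurable x) {p q : ℝ≥0∞}
    (hp : p ≠ 0) (hpq : p ≤ q) (hq : q ≠ ∞) {A : Set Ω} (hA : MeasurableSet A) (hμA : μ A < ∞)
    (h : MemLp (Aᶜ.indicator x) p μ) :
    ∃ B, MeasurableSet B ∧ μ B < ∞ ∧ MemLp (Bᶜ.indicator x) q μ := by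
  have hm : StronglyMeasurable (Aᶜ.indicator x) := hx.indicator hA.compl
  have hB : MeasurableSet {ω | 1 ≤ ‖Aᶜ.indicator x ω‖₊} :=
    measurableSet_le measurable_const hm.measurable.nnnorm
  refine ⟨A ∪ {ω | 1 ≤ ‖Aᶜ.indicator x ω‖₊}, hA.union hB, measure_union_lt_top hμA
    (h.meas_ge_lt_top hp (ne_top_of_le_ne_top hq hpq) one_ne_zero), ?_⟩
  rw [Set.compl_union, Set.inter_comm, ← Set.indicator_indicator]
  refine (h.indicator hB.compl).of_exponent_le_of_ae_le (c := 1) hp hpq hq (ae_of_all _ fun ω => ?_)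
    ENNReal.one_ne_top
  by_cases hω : ω ∈ {ω | 1 ≤ ‖Aᶜ.indicator x ω‖₊}ᶜ
  · rw [Set.indicator_of_mem hω]
    have : ‖Aᶜ.indicator x ω‖₊ < 1 := not_le.1 hω
    rw [enorm_eq_nnnorm]
    exact_mod_cast this.le
  · rw [Set.indicator_of_notMem hω]
    simp

/-- Being in some L^p off a set of finite measure is stable under sums, since exponents can be
raised to their maximum; membership in one L^p is not. -/
lemma exists_memLp_indicator_compl_of_mem_lpSpan (hr : r < ∞) {x : Ω →ₘ[μ] ℂ}
    (hx : x ∈ lpSpan μ r) : ∃ p, r < p ∧ p < ∞ ∧ ∃ A, MeasurableSet A ∧ μ A < ∞ ∧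
      MemLp (Aᶜ.indicator x) p μ := by
  refine Submodule.iSup_induction _ (motive := fun x : Ω →ₘ[μ] ℂ => ∃ p, r < p ∧ p < ∞ ∧ ∃ A,
    MeasurableSet A ∧ μ A < ∞ ∧ MemLp (Aᶜ.indicator x) p μ) hx (fun p x hxp => ?_) ?_ fun x y hx hy => ?_
  · refine ⟨p, p.2.1, p.2.2, ∅, MeasurableSet.empty, by simp, ?_⟩
    rw [Set.compl_empty, Set.indicator_univ]
    exact Lp.mem_Lp_iff_memLp.1 hxp
  · obtain ⟨p, hp1, hp2⟩ := exists_between hr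
    refine ⟨p, hp1, hp2, ∅, MeasurableSet.empty, by simp, ?_⟩
    rw [Set.compl_empty, Set.indicator_univ]
    exact MemLp.zero.ae_eq AEEqFun.coeFn_zero.symm
  · obtain ⟨p, hp1, hp2, A, hA, hμA, hxA⟩ := hx
    obtain ⟨q, hq1, hq2, B, hB, hμB, hyB⟩ := hy
    have hm := max_lt hp2 hq2
    obtain ⟨A', hA', hμA', hxA'⟩ := exists_memLp_indicator_compl_of_le x.stronglyMeasurable
      (bot_le.trans_lt hp1).ne' (le_max_left p q) hm.ne hA hμA hxA
    obtain ⟨B', hB', hμB', hyB'⟩ := exists_memLp_indicator_compl_of_le y.stronglyMeasurable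
      (bot_le.trans_lt hq1).ne' (le_max_right p q) hm.ne hB hμB hyB
    refine ⟨max p q, hp1.trans_le (le_max_left _ _), hm, A' ∪ B', hA'.union hB',
      measure_union_lt_top hμA' hμB', ?_⟩
    have h1 : MemLp ((A' ∪ B')ᶜ.indicator x) (max p q) μ := by
      rw [Set.compl_union, Set.inter_comm, ← Set.indicator_indicator]
      exact hxA'.indicator hB'.compl
    have h2 : MemLp ((A' ∪ B')ᶜ.indicator y) (max p q) μ := by
      rw [Set.compl_union, ← Set.indicator_indicator]
      exact hyB'.indicator hA'.compl
    refine (h1.add h2).ae_eq ?_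
    filter_upwards [AEEqFun.coeFn_add x y] with ω h
    rw [← Set.indicator_add']
    by_cases hω : ω ∈ (A' ∪ B')ᶜ
    · rw [Set.indicator_of_mem hω, Set.indicator_of_mem hω, h]
    · rw [Set.indicator_of_notMem hω, Set.indicator_of_notMem hω]

/-- The bounded functions in the linear span of the spaces `L^p` belong to a single `L^p`. -/
lemma exists_mem_Lp_of_mem_lpSpan (hr : r < ∞) {x : Ω →ₘ[μ] ℂ} (hx : x ∈ lpSpan μ r)
    (hb : x ∈ Lp ℂ ∞ μ) : ∃ p, r < p ∧ p < ∞ ∧ x ∈ Lp ℂ p μ := by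
  obtain ⟨p, hp1, hp2, A, hA, hμA, hxA⟩ := exists_memLp_indicator_compl_of_mem_lpSpan hr hx
  refine ⟨p, hp1, hp2, Lp.mem_Lp_iff_memLp.2 ?_⟩
  have : IsFiniteMeasure (μ.restrict A) := ⟨by simpa using hμA⟩
  -- On the exceptional set, of finite measure, boundedness suffices.
  have h1 : MemLp (A.indicator x) p μ :=
    (memLp_indicator_iff_restrict hA).2 (((Lp.mem_Lp_iff_memLp.1 hb).restrict A).mono_exponent
      le_top)
  have := h1.add hxA
  rwa [Set.indicator_self_add_compl] at this

/-- A transformation which agrees with an operator on `L^∞` where both are defined has an extension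
which defines this operator. -/
lemma exists_extension_definesOnLp (T : (Ω →ₘ[μ] ℂ) →ₗ.[ℂ] (Ω →ₘ[μ] ℂ)) {p : ℝ≥0∞} [Fact (1 ≤ p)]
    (S : Lp ℂ p μ →L[ℂ] Lp ℂ p μ) (h : ∀ (x : T.domain) (y : Lp ℂ p μ),
      (x : Ω →ₘ[μ] ℂ) = y → T x = (S y : Ω →ₘ[μ] ℂ)) : ∃ T', T ≤ T' ∧ DefinesOnLp T' p S := by
  let G : (Ω →ₘ[μ] ℂ) →ₗ.[ℂ] (Ω →ₘ[μ] ℂ) :=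
    ⟨Lp.LpSubmodule ℂ ℂ p μ, (Lp.LpSubmodule ℂ ℂ p μ).subtype ∘ₗ (S : Lp ℂ p μ →ₗ[ℂ] Lp ℂ p μ)⟩
  have hG : ∀ (x : T.domain) (y : G.domain), (x : Ω →ₘ[μ] ℂ) = y → T x = G y :=
    fun x y hxy => h x y hxy
  refine ⟨T.sup G hG, LinearPMap.left_le_sup T G hG, fun x => ?_⟩
  have hle := LinearPMap.right_le_sup T G hG
  have hx : (x : Ω →ₘ[μ] ℂ) ∈ G.domain := x.2
  exact ⟨hle.1 hx, (hle.2 (x := ⟨x, hx⟩) rfl).symm⟩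

end Span

theorem mainTheorem5 {Ω : Type*} [MeasurableSpace Ω] (μ : Measure Ω) (hμ : IsLocalizable μ)
    (σ : Compacts ℝ) (r : ℝ≥0∞) (hr : 1 < r) (hr' : r < ∞)
    (T : (Ω →ₘ[μ] ℂ) →ₗ.[ℂ] (Ω →ₘ[μ] ℂ)) (M : ℝ)
    (hT : ∀ (p : ℝ≥0∞) [Fact (1 ≤ p)], r < p → p < ∞ →
      ∃ S : Lp ℂ p μ →L[ℂ] Lp ℂ p μ, DefinesOnLp T p S ∧
        ∃ Φ : AC σ →ₐ[ℂ] (Lp ℂ p μ →L[ℂ] Lp ℂ p μ), IsACCalculus σ S M Φ) :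
    ∃ T' : (Ω →ₘ[μ] ℂ) →ₗ.[ℂ] (Ω →ₘ[μ] ℂ), T.domRestrict (lpSpan μ r) ≤ T' ∧
      (T.domain ⊓ Lp.LpSubmodule ℂ ℂ ∞ μ ≤ lpSpan μ r → T ≤ T') ∧
      ∃ S : Lp ℂ ∞ μ →L[ℂ] Lp ℂ ∞ μ, DefinesOnLp T' ∞ S ∧ IsRealACOperator σ S ∧
        ∀ (M' : ℝ) (Φ : AC σ →ₐ[ℂ] (Lp ℂ ∞ μ →L[ℂ] Lp ℂ ∞ μ)), IsACCalculus σ S M' Φ →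
          ∃ Ψ : BV σ →ₐ[ℂ] (Lp ℂ ∞ μ →L[ℂ] Lp ℂ ∞ μ), IsBVExtension σ Φ Ψ ∧
            ∀ f : BV σ, ∃ U : Lp ℂ 1 μ →L[ℂ] Lp ℂ 1 μ, IsAdjointOfL1 (Ψ f) U := by
  have hN : 0 ≤ max M 0 := le_max_right _ _
  -- M is not assumed nonnegative, so it is replaced by max M 0.
  replace hT : ∀ (p : ℝ≥0∞) [Fact (1 ≤ p)], r < p → p < ∞ →
      ∃ S : Lp ℂ p μ →L[ℂ] Lp ℂ p μ, DefinesOnLp T p S ∧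
        ∃ Φ : AC σ →ₐ[ℂ] (Lp ℂ p μ →L[ℂ] Lp ℂ p μ), IsACCalculus σ S (max M 0) Φ :=
    fun p _ hp hp' => by
      obtain ⟨S, hS, Φ, hΦ⟩ := hT p hp hp'
      exact ⟨S, hS, Φ, hΦ.1, fun f => (hΦ.2 f).trans
        (mul_le_mul_of_nonneg_right (le_max_left _ _) bvNorm_nonneg)⟩
  generalize max M 0 = N at hN hT
  obtain ⟨k, hk⟩ := ENNReal.exists_nat_gt hr'.ne
  have hkp : r < ((2 * (k + 1) : ℕ) : ℝ≥0∞) :=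
    hk.trans_le (by exact_mod_cast (by omega : k ≤ 2 * (k + 1)))
  have : Fact (1 ≤ ((2 * (k + 1) : ℕ) : ℝ≥0∞)) := ⟨hr.le.trans hkp.le⟩
  obtain ⟨S₀, hS₀, Φ₀, hΦ₀⟩ := hT _ hkp (ENNReal.natCast_lt_top _)
  obtain ⟨Ψ, hΨ, hΨcl⟩ := ACCalculus.exists_BV_extension (Lp.isClarkson k) hN hΦ₀.2
  have hΨb : ∀ (f : BV σ) (x : Lp ℂ ((2 * (k + 1) : ℕ) : ℝ≥0∞) μ) (c : ℝ), 0 ≤ c →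
      (∀ᵐ ω ∂μ, ‖x ω‖ ≤ c) → ∀ᵐ ω ∂μ, ‖Ψ f x ω‖ ≤ 4 * N * bvNorm f.1 * c := by
    intro f x c hc hxc
    -- The supremum bound for Φ₀(g) passes to Ψ(f) because a bound almost everywhere is closed under
    -- L^p limits.
    refine closure_minimal ?_ (Lp.isClosed_setOf_ae_norm_le (4 * N * bvNorm f.1 * c)) (hΨcl f x)
    rintro _ ⟨g, hg, rfl⟩
    filter_upwards [hΦ₀.ae_norm_le hN hT hkp hS₀ g x hc hxc] with ω hω
    refine hω.trans ?_
    calc N * bvNorm g.1.1 * c ≤ N * (4 * bvNorm f.1) * c := by gcongr; exact hg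
      _ = _ := by ring
  obtain ⟨Θ, hΘ⟩ := hμ.exists_algHom_transfers k Ψ (C := fun f => 4 * N * bvNorm f.1)
    (fun f => mul_nonneg (by positivity) bvNorm_nonneg) hΨb
  set S := Θ (AC.ident σ).1 with hS
  have htr : Transfers S₀ S := by
    have := (hΘ (AC.ident σ).1).2
    rwa [hΨ, hΦ₀.1] at this
  have hagree : ∀ (x : T.domain) (y : Lp ℂ ∞ μ), (x : Ω →ₘ[μ] ℂ) ∈ lpSpan μ r →
      (x : Ω →ₘ[μ] ℂ) = y → T x = (S y : Ω →ₘ[μ] ℂ) := by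
    intro x y hx hxy
    obtain ⟨p, hp1, hp2, hxp⟩ := exists_mem_Lp_of_mem_lpSpan hr' hx (hxy ▸ y.2)
    have : Fact (1 ≤ p) := ⟨hr.le.trans hp1.le⟩
    obtain ⟨S₁, hS₁, -⟩ := hT p hp1 hp2
    obtain ⟨h1, e1⟩ := hS₁ ⟨x, hxp⟩
    refine Eq.trans ?_ (e1.trans (htr.coe_eq hμ hp2.ne (fun _ _ => hS₀.coe_eq hS₁) hxy))
    rfl
  have hreal : IsACCalculus σ S (4 * N) (Θ.comp (AC σ).val) := ⟨rfl, fun f => (hΘ f.1).1⟩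
  have hext : ∀ (M' : ℝ) (Φ : AC σ →ₐ[ℂ] (Lp ℂ ∞ μ →L[ℂ] Lp ℂ ∞ μ)), IsACCalculus σ S M' Φ →
      ∃ Ψ : BV σ →ₐ[ℂ] (Lp ℂ ∞ μ →L[ℂ] Lp ℂ ∞ μ), IsBVExtension σ Φ Ψ ∧
        ∀ f : BV σ, ∃ U : Lp ℂ 1 μ →L[ℂ] Lp ℂ 1 μ, IsAdjointOfL1 (Ψ f) U := by
    intro M' Φ hΦ
    -- Uniqueness of the calculus lets Θ extend an arbitrary given Φ, with its own bound M'.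
    have e : Φ = Θ.comp (AC σ).val := ACCalculus.algHom_eq_of_ident_eq hΦ.2 hreal.2 hΦ.1
    refine ⟨Θ, ⟨⟨4 * N, fun f => (hΘ f).1⟩, fun f => by rw [e]; rfl⟩, fun f => ?_⟩
    obtain ⟨U, -, hU⟩ := (hΘ f).2
    exact ⟨U, hU⟩
  -- If all bounded elements of the domain lie in the span, T itself agrees with S on the overlap;
  -- otherwise agreement is known only for the restriction to the span.
  by_cases h : T.domain ⊓ Lp.LpSubmodule ℂ ℂ ∞ μ ≤ lpSpan μ r
  · obtain ⟨T', hTT', hT'⟩ := exists_extension_definesOnLp T S fun x y hxy =>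
      hagree x y (h ⟨x.2, hxy ▸ y.2⟩) hxy
    exact ⟨T', LinearPMap.domRestrict_le.trans hTT', fun _ => hTT', S, hT', ⟨_, _, hreal⟩, hext⟩
  · obtain ⟨T', hTT', hT'⟩ := exists_extension_definesOnLp (T.domRestrict (lpSpan μ r)) S
      fun x y hxy => (LinearPMap.domRestrict_apply (x := x) (y := ⟨x, x.2.2⟩) rfl).trans
        (hagree _ y x.2.1 hxy)
    exact ⟨T', hTT', fun h' => absurd h' h, S, hT', ⟨_, _, hreal⟩, hext⟩
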